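/- **Conventions.** A quiver $Q=(Q_0,Q_1,s,t)$ has finite sets of vertices and arrows; loops and multiple arrows are allowed. A *pseudotree* is a connected quiver $Q$ whose underlying undirected graph $\overline{Q}$ satisfies $\operatorname{rank}H_1(\overline{Q},\mathbb{Z})\le 1$; it is a *tree* if it is connected and $H_1(\overline{Q},\mathbb{Z})=0$. An $\mathbb{F}_1$-vector space is a finite pointed set, and an $\mathbb{F}_1$-linear map is a pointed map that is injective outside the preimage of the base point. An $\mathbb{F}_1$-representation $M$ of $Q$ consists of $\mathbb{F}_1$-vector spaces $M_v$ ($v\in Q_0$) and $\mathbb{F}_1$-linear maps $M_\alpha:M_{s(\alpha)}\to M_{t(\alpha)}$ ($\alpha\in Q_1$). It is *nilpotent* if all sufficiently long paths act by zero, and *indecomposable* if it is nonzero and not a direct sum (pointwise wedge) of two nonzero representations. Its *coefficient quiver* $\Gamma_M$ has the nonzero elements of the $M_v$ as vertices and an arrow of colour $\alpha$ from $i$ to $j$ whenever $M_\alpha(i)=j$ (with $i,j$ nonzero). The Hall algebra $H_Q$ is the space of finitely supported complex functions on isomorphism classes of $\mathbb{F}_1$-representations of $Q$, with the associative product $$[M]\cdot[N]=\sum_{[R]}\#\{L\le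 R\mid L\cong N,\ R/L\cong M\}\,[R]$$ and the coproduct $\Delta(f)([M],[N])=f([M\oplus N])$. Let $\mathfrak{n}_Q$ be the Lie algebra, under the commutator, of those primitive elements of $H_Q$ that are supported on nilpotent representations; equivalently, $\mathfrak{n}_Q$ is the span of the classes of nilpotent indecomposable representations. Let $\mathcal{T}_Q$ (resp. $\mathcal{P}_Q$) be the set of isomorphism classes of nilpotent indecomposable representations whose coefficient quiver is a tree (resp. a pseudotree but not a tree), and let $\mathfrak{p}_Q=\operatorname{Span}(\mathcal{P}_Q)\subseteq\mathfrak{n}_Q$. **Theorem B.** Let $Q$ be a (not necessarily proper) pseudotree. 1. As a Lie algebra, $\mathfrak{n}_Q$ is generated by $\mathcal{T}_Q$. 2. $\mathfrak{p}_Q$ is a Lie ideal of $\mathfrak{n}_Q$, and the isomorphism class of the Lie algebra $\mathfrak{n}_Q/\mathfrak{p}_Q$ depends only on the underlying undirected graph of $Q$: if $R$ is a quiver with $\overline{R}\cong\overline{Q}$, then $\mathfrak{p}_R$ is a Lie ideal of $\mathfrak{n}_R$ and $\mathfrak{n}_Q/\mathfrak{p}_Q\cong\mathfrak{n}_R/\mathfrak{p}_R$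 as complex Lie algebras. More precisely, for a set $D\subseteq Q_1$ let $r_DQ$ be the quiver obtained from $Q$ by reversing all arrows in $D$, and for $T\in\mathcal{T}_Q$ let $r_DT\in\mathcal{T}_{r_DQ}$ be the representation whose coefficient quiver is obtained from $\Gamma_T$ by reversing all arrows with colour in $D$. Then there is an isomorphism of Lie algebras $\mathfrak{n}_Q/\mathfrak{p}_Q\to\mathfrak{n}_{r_DQ}/\mathfrak{p}_{r_DQ}$ that sends the class of $T$ to $(-1)^{\epsilon}$ times the class of $r_DT$ for all $T\in\mathcal{T}_Q$, where $\epsilon$ is the number of arrows of $\Gamma_T$ with colour in $D$. In particular, for $D=\{\alpha\}$ the sign is $(-1)^{\#\alpha\text{-arrows of }\Gamma_T}$. -/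

import Mathlib

universe u v

set_option linter.unusedVariables false
set_option linter.unusedSectionVars false

noncomputable section

namespace F1

/-! ### Quivers and their underlying graphs -/

/-- A quiver with vertex set `V`, arrow set `A`, source and target functions. Loops and multiple
arrows are allowed. Finiteness of `V` and `A` is imposed separately by `[Finite V] [Finite A]`. -/
structure FinQuiver (V : Type u) (A : Type v) where
  src : A → V
  tgt : A → V

namespace FinQuiver

variable {V : Type u} {A : Type v}

/-- The underlying undirected graph is nonempty and connected. -/
def Connected (Q : FinQuiver V A) : Prop :=
  Nonempty V ∧ ∀ x y : V, Relation.EqvGen (fun s t => ∃ a, Q.src a = s ∧ Q.tgt a = t) x y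

/-- The boundary map `C₁ → C₀` of the underlying graph, seen as a one-dimensional complex. -/
def boundary (Q : FinQuiver V A) : (A →₀ ℤ) →ₗ[ℤ] (V →₀ ℤ) :=
  Finsupp.linearCombination ℤ
    (fun a => Finsupp.single (Q.tgt a) (1 : ℤ) - Finsupp.single (Q.src a) (1 : ℤ))

/-- The first integral homology group of the underlying graph. -/
def H1 (Q : FinQuiver V A) : Submodule ℤ (A →₀ ℤ) := LinearMap.ker Q.boundary

def IsTree (Q : FinQuiver V A) : Prop := Q.Connected ∧ Q.H1 = ⊥

/-- A (not necessarily proper) pseudotree: a connected quiver with `rank H₁ ≤ 1`. -/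
def IsPseudotree (Q : FinQuiver V A) : Prop := Q.Connected ∧ Module.rank ℤ Q.H1 ≤ 1

open Classical in
/-- The quiver obtained by reversing all the arrows in `D`. -/
def reverse (Q : FinQuiver V A) (D : Set A) : FinQuiver V A where
  src a := if a ∈ D then Q.tgt a else Q.src a
  tgt a := if a ∈ D then Q.src a else Q.tgt a

/-- The underlying undirected (multi)graphs of `Q` and `R` are isomorphic. -/
def SameUnderlyingGraph {W B : Type*} (Q : FinQuiver V A) (R : FinQuiver W B) : Prop :=
  ∃ (e₀ : V ≃ W) (e₁ : A ≃ B),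
    ∀ a, s(R.src (e₁ a), R.tgt (e₁ a)) = s(e₀ (Q.src a), e₀ (Q.tgt a))

/-- Oriented paths in a quiver. -/
inductive Path (Q : FinQuiver V A) (x : V) : V → Type (max u v)
  | nil : Path Q x x
  | cons (a : A) (p : Path Q x (Q.src a)) : Path Q x (Q.tgt a)

def Path.length {Q : FinQuiver V A} {x : V} : {y : V} → Q.Path x y → ℕ
  | _, .nil => 0
  | _, .cons _ p => p.length + 1

end FinQuiver

/-! ### Representations over the field with one element -/

/-- Linear maps of vector spaces over `𝔽₁`: pointed maps that are injective outside the
preimage of the base point. -/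
def IsLinear {X Y : Type*} [Zero X] [Zero Y] (f : X → Y) : Prop :=
  f 0 = 0 ∧ Set.InjOn f {x | f x ≠ 0}

/-- An `𝔽₁`-representation of `Q`: finite pointed sets (the base point is written `0`) at the
vertices, and `𝔽₁`-linear maps along the arrows. -/
structure Rep {V : Type u} {A : Type v} (Q : FinQuiver V A) where
  obj : V → Type
  [zero : ∀ x, Zero (obj x)]
  [fin : ∀ x, Finite (obj x)]
  map : ∀ a, obj (Q.src a) → obj (Q.tgt a)
  isLinear : ∀ a, IsLinear (map a)

attribute [instance] Rep.zero Rep.fin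

namespace Rep

variable {V : Type u} {A : Type v} {Q : FinQuiver V A}

lemma map_zero (M : Rep Q) (a : A) : M.map a 0 = 0 := (M.isLinear a).1

/-- Isomorphism of representations: pointed bijections (these are exactly the invertible
`𝔽₁`-linear maps) that commute with the structure maps. -/
def Iso (M N : Rep Q) : Prop :=
  ∃ e : ∀ x, M.obj x ≃ N.obj x, (∀ x, e x 0 = 0) ∧
    ∀ a m, e _ (M.map a m) = N.map a (e _ m)

lemma Iso.refl (M : Rep Q) : Iso M M := ⟨fun _ => Equiv.refl _, fun _ => rfl, fun _ _ => rfl⟩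

lemma Iso.symm {M N : Rep Q} : Iso M N → Iso N M := by
  rintro ⟨e, h0, h⟩
  refine ⟨fun x => (e x).symm, fun x => ?_, fun a m => ?_⟩
  · rw [Equiv.symm_apply_eq, h0]
  · rw [Equiv.symm_apply_eq, h, Equiv.apply_symm_apply]

lemma Iso.trans {M N P : Rep Q} : Iso M N → Iso N P → Iso M P := by
  rintro ⟨e, h0, h⟩ ⟨e', h0', h'⟩
  exact ⟨fun x => (e x).trans (e' x), fun x => by simp [h0, h0'], fun a m => by simp [h, h']⟩

instance isoSetoid (Q : FinQuiver V A) : Setoid (Rep Q) where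
  r := Iso
  iseqv := ⟨Iso.refl, Iso.symm, Iso.trans⟩

def IsZero (M : Rep Q) : Prop := ∀ x (m : M.obj x), m = 0

/-- The zero representation. -/
def zeroRep (Q : FinQuiver V A) : Rep Q where
  obj _ := Unit
  map _ := id
  isLinear _ := ⟨rfl, fun _ _ _ _ _ => rfl⟩

/-- The direct sum: the wedge of pointed sets at each vertex, realised as the set of pairs
with at most one nonzero entry. -/
def sum (M N : Rep Q) : Rep Q where
  obj x := {p : M.obj x × N.obj x // p.1 = 0 ∨ p.2 = 0}
  zero x := ⟨⟨0, Or.inl rfl⟩⟩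
  map a p := ⟨(M.map a p.1.1, N.map a p.1.2), p.2.imp
    (fun h => by simp only [h, M.map_zero]) (fun h => by simp only [h, N.map_zero])⟩
  isLinear a := by
    refine ⟨Subtype.ext (Prod.ext (M.map_zero a) (N.map_zero a)), ?_⟩
    rintro ⟨⟨x, y⟩, h⟩ hx ⟨⟨x', y'⟩, h'⟩ hx' hxx
    have h1 : M.map a x = M.map a x' := congrArg (fun p => p.1.1) hxx
    have h2 : N.map a y = N.map a y' := congrArg (fun p => p.1.2) hxx
    have hne : ¬ (M.map a x = 0 ∧ N.map a y = 0) := fun hh =>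
      hx (Subtype.ext (Prod.ext hh.1 hh.2))
    have hM := M.map_zero a
    have hN := N.map_zero a
    apply Subtype.ext
    by_cases hx0 : M.map a x = 0
    · have hy0 : N.map a y ≠ 0 := fun hy => hne ⟨hx0, hy⟩
      have hyy : y = y' := (N.isLinear a).2 hy0 (by simpa [← h2] using hy0) h2
      have e1 : x = 0 := h.resolve_right (fun hy : y = 0 => hy0 (hy ▸ hN))
      have e2 : x' = 0 := h'.resolve_right (fun hy : y' = 0 => hy0 (h2.trans (hy ▸ hN)))
      exact Prod.ext (e1.trans e2.symm) hyy
    · have hxx' : x = x' := (M.isLinear a).2 hx0 (by simpa [← h1] using hx0) h1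
      have e1 : y = 0 := h.resolve_left (fun hy : x = 0 => hx0 (hy ▸ hM))
      have e2 : y' = 0 := h'.resolve_left (fun hy : x' = 0 => hx0 (h1.trans (hy ▸ hM)))
      exact Prod.ext hxx' (e1.trans e2.symm)

def IsIndecomposable (M : Rep Q) : Prop :=
  ¬ M.IsZero ∧ ∀ N P : Rep Q, Iso M (N.sum P) → N.IsZero ∨ P.IsZero

/-- The composite of the structure maps along a path. -/
def pathMap (M : Rep Q) {x : V} : {y : V} → Q.Path x y → M.obj x → M.obj y
  | _, .nil, m => m
  | _, .cons a p, m => M.map a (M.pathMap p m)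

/-- All sufficiently long paths act by zero. -/
def IsNilpotent (M : Rep Q) : Prop :=
  ∃ n : ℕ, ∀ (x y : V) (p : Q.Path x y), n ≤ p.length → ∀ m, M.pathMap p m = 0

/-! ### Coefficient quivers -/

/-- Vertices of the coefficient quiver: the nonzero elements. -/
def Vert (M : Rep Q) : Type u := Σ x : V, {m : M.obj x // m ≠ 0}

/-- Arrows of the coefficient quiver: an arrow `(a, m, M.map a m)`, with nonzero ends, is recorded
as the pair `(a, m)`. -/
def Arr (M : Rep Q) : Type v := Σ a : A, {m : M.obj (Q.src a) // M.map a m ≠ 0}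

/-- The coefficient quiver. -/
def coeffQuiver (M : Rep Q) : FinQuiver M.Vert M.Arr where
  src b := ⟨Q.src b.1, b.2.1, fun h => b.2.2 (h ▸ M.map_zero b.1)⟩
  tgt b := ⟨Q.tgt b.1, M.map b.1 b.2.1, b.2.2⟩

/-- The structure map of the coefficient quiver on vertices. -/
def vertColor (M : Rep Q) (m : M.Vert) : V := m.1

/-- The structure map of the coefficient quiver on arrows. -/
def arrColor (M : Rep Q) (b : M.Arr) : A := b.1

/-- Nilpotent indecomposable representations whose coefficient quiver is a tree. -/
def IsTreeRep (M : Rep Q) : Prop :=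
  (M.IsNilpotent ∧ M.IsIndecomposable) ∧ M.coeffQuiver.IsTree

/-- Nilpotent indecomposable representations whose coefficient quiver is a pseudotree
but not a tree. -/
def IsProperPseudotreeRep (M : Rep Q) : Prop :=
  (M.IsNilpotent ∧ M.IsIndecomposable) ∧ M.coeffQuiver.IsPseudotree ∧ ¬ M.coeffQuiver.IsTree

/-- The coefficient quiver of `N` over `Q.reverse D` is (up to a colour-preserving isomorphism)
obtained from that of `M` by reversing all arrows with colour in `D`. -/
def IsReversal (D : Set A) (M : Rep Q) (N : Rep (Q.reverse D)) : Prop :=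
  ∃ (e₀ : M.Vert ≃ N.Vert) (e₁ : M.Arr ≃ N.Arr),
    (∀ m, N.vertColor (e₀ m) = M.vertColor m) ∧ (∀ b, N.arrColor (e₁ b) = M.arrColor b) ∧
    ∀ b, N.coeffQuiver.src (e₁ b) = e₀ ((M.coeffQuiver.reverse (M.arrColor ⁻¹' D)).src b) ∧
      N.coeffQuiver.tgt (e₁ b) = e₀ ((M.coeffQuiver.reverse (M.arrColor ⁻¹' D)).tgt b)

/-! ### Subrepresentations and quotients -/

/-- Subrepresentations. -/
@[ext]
structure Sub (M : Rep Q) where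
  carrier : ∀ x, Set (M.obj x)
  zero_mem : ∀ x, 0 ∈ carrier x
  map_mem : ∀ a m, m ∈ carrier (Q.src a) → M.map a m ∈ carrier (Q.tgt a)

namespace Sub

variable {M N : Rep Q}

/-- A subrepresentation, as a representation. -/
def toRep (L : Sub M) : Rep Q where
  obj x := {m : M.obj x // m ∈ L.carrier x}
  zero x := ⟨⟨0, L.zero_mem x⟩⟩
  map a m := ⟨M.map a m.1, L.map_mem a m.1 m.2⟩
  isLinear a := by
    refine ⟨Subtype.ext (M.map_zero a), ?_⟩
    intro m hm n hn h
    exact Subtype.ext ((M.isLinear a).2 (fun h0 => hm (Subtype.ext h0))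
      (fun h0 => hn (Subtype.ext h0)) (congrArg Subtype.val h))

open Classical in
/-- The quotient representation: at each vertex the elements of `L` are collapsed to the base
point, so that the nonzero elements of the quotient are the elements outside `L`. -/
def quot (L : Sub M) : Rep Q where
  obj x := {m : M.obj x // m = 0 ∨ m ∉ L.carrier x}
  zero x := ⟨⟨0, Or.inl rfl⟩⟩
  map a m := if h : M.map a m.1 ∈ L.carrier _ then ⟨0, Or.inl rfl⟩ else ⟨M.map a m.1, Or.inr h⟩
  isLinear a := by
    have hz : M.map a 0 ∈ L.carrier _ := by rw [M.map_zero]; exact L.zero_mem _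
    refine ⟨dif_pos hz, ?_⟩
    intro m hm n hn h
    have hm' : M.map a m.1 ∉ L.carrier _ := fun h' => hm (dif_pos h')
    have hn' : M.map a n.1 ∉ L.carrier _ := fun h' => hn (dif_pos h')
    dsimp only at h
    rw [dif_neg hm', dif_neg hn'] at h
    refine Subtype.ext ((M.isLinear a).2 ?_ ?_ (congrArg Subtype.val h))
    · intro h0; exact hm' (h0 ▸ L.zero_mem _)
    · intro h0; exact hn' (h0 ▸ L.zero_mem _)

lemma quot_map_of_mem (L : Sub M) (a : A) (m : L.quot.obj (Q.src a))
    (h : M.map a m.1 ∈ L.carrier _) : (L.quot.map a m).1 = 0 := by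
  simp only [quot, dif_pos h]

lemma quot_map_of_not_mem (L : Sub M) (a : A) (m : L.quot.obj (Q.src a))
    (h : M.map a m.1 ∉ L.carrier _) : (L.quot.map a m).1 = M.map a m.1 := by
  simp only [quot, dif_neg h]

instance [Finite V] : Finite (Sub M) :=
  Finite.of_injective (fun L : Sub M => L.carrier) (fun _ _ h => Sub.ext h)

instance [Finite V] : Fintype (Sub M) := Fintype.ofFinite _

instance : LE (Sub M) := ⟨fun L K => ∀ x, L.carrier x ⊆ K.carrier x⟩

/-- The zero subrepresentation. -/
def zeroSub (M : Rep Q) : Sub M where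
  carrier x := {0}
  zero_mem _ := rfl
  map_mem a m h := by rw [Set.mem_singleton_iff.1 h]; exact M.map_zero a

/-- The whole representation. -/
def fullSub (M : Rep Q) : Sub M where
  carrier x := Set.univ
  zero_mem _ := trivial
  map_mem _ _ _ := trivial

/-- `(L ∩ K)` as a subrepresentation of `K`. -/
def restrict (L K : Sub M) : Sub K.toRep where
  carrier x := {m | m.1 ∈ L.carrier x}
  zero_mem x := L.zero_mem x
  map_mem a m h := L.map_mem a m.1 h

/-- The image of `K` in the quotient by `L`. -/
def push (L K : Sub M) : Sub L.quot where
  carrier x := {m | m.1 ∈ K.carrier x}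
  zero_mem x := K.zero_mem x
  map_mem a m h := by
    change (L.quot.map a m).1 ∈ K.carrier _
    by_cases h' : M.map a m.1 ∈ L.carrier _
    · rw [quot_map_of_mem L a m h']; exact K.zero_mem _
    · rw [quot_map_of_not_mem L a m h']; exact K.map_mem a _ h

/-- Subrepresentations of the quotient by `L` are the subrepresentations that contain `L`. -/
def pushEquiv (L : Sub M) : {K : Sub M // L ≤ K} ≃ Sub L.quot where
  toFun K := L.push K.1
  invFun P :=
    ⟨{ carrier := fun x => {m | ∀ h : m ∉ L.carrier x, (⟨m, Or.inr h⟩ : L.quot.obj x) ∈ P.carrier x}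
       zero_mem := fun x h => absurd (L.zero_mem x) h
       map_mem := fun a m hm h => by
        have hmL : m ∉ L.carrier _ := fun h' => h (L.map_mem a m h')
        have := P.map_mem a _ (hm hmL)
        have e : L.quot.map a ⟨m, Or.inr hmL⟩ = ⟨M.map a m, Or.inr h⟩ :=
          Subtype.ext (quot_map_of_not_mem L a ⟨m, Or.inr hmL⟩ h)
        exact e ▸ this },
      fun x m hm h => absurd hm h⟩
  left_inv K := by
    apply Subtype.ext
    ext x m
    constructor
    · intro h
      by_cases hm : m ∈ L.carrier x
      · exact K.2 x hm
      · exact h hm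
    · intro h _
      exact h
  right_inv P := by
    ext x m
    constructor
    · intro h
      rcases m.2 with h0 | h0
      · have : m = 0 := Subtype.ext h0
        rw [this]; exact P.zero_mem x
      · exact h h0
    · intro h _
      exact h

/-- Subrepresentations of `K` are the subrepresentations contained in `K`. -/
def restrictEquiv (K : Sub M) : {L : Sub M // L ≤ K} ≃ Sub K.toRep where
  toFun L := L.1.restrict K
  invFun P :=
    ⟨{ carrier := fun x => {m | ∃ h : m ∈ K.carrier x, (⟨m, h⟩ : K.toRep.obj x) ∈ P.carrier x}
       zero_mem := fun x => ⟨K.zero_mem x, P.zero_mem x⟩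
       map_mem := fun a m hm => ⟨K.map_mem a m hm.1, P.map_mem a _ hm.2⟩ },
      fun x m hm => hm.1⟩
  left_inv L := by
    apply Subtype.ext
    ext x m
    exact ⟨fun h => h.2, fun h => ⟨L.2 x h, h⟩⟩
  right_inv P := by
    ext x m
    exact ⟨fun h => h.2, fun h => ⟨m.2, h⟩⟩

lemma quot_push_iso (L K : Sub M) (h : L ≤ K) : Iso (L.push K).quot K.quot := by
  refine ⟨fun x =>
    { toFun := fun m => ⟨m.1.1, m.2.imp (fun h0 => congrArg Subtype.val h0) (fun h0 => h0)⟩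
      invFun := fun m => ⟨⟨m.1, m.2.imp id (fun h0 h1 => h0 (h x h1))⟩,
        m.2.imp (fun h0 => Subtype.ext h0) (fun h0 => h0)⟩
      left_inv := fun m => rfl
      right_inv := fun m => rfl }, fun x => rfl, fun a m => ?_⟩
  apply Subtype.ext
  change ((L.push K).quot.map a m).1.1 = _
  by_cases h1 : M.map a m.1.1 ∈ K.carrier _
  · rw [quot_map_of_mem K a _ h1]
    have : L.quot.map a m.1 ∈ (L.push K).carrier _ := by
      change (L.quot.map a m.1).1 ∈ K.carrier _
      by_cases h2 : M.map a m.1.1 ∈ L.carrier _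
      · rw [quot_map_of_mem L a _ h2]; exact K.zero_mem _
      · rw [quot_map_of_not_mem L a _ h2]; exact h1
    rw [quot_map_of_mem (L.push K) a _ this]
    rfl
  · rw [quot_map_of_not_mem K a _ h1]
    have h2 : M.map a m.1.1 ∉ L.carrier _ := fun h2 => h1 (h _ h2)
    have : L.quot.map a m.1 ∉ (L.push K).carrier _ := by
      change (L.quot.map a m.1).1 ∉ K.carrier _
      rw [quot_map_of_not_mem L a _ h2]; exact h1
    rw [quot_map_of_not_mem (L.push K) a _ this, quot_map_of_not_mem L a _ h2]
    rfl

lemma push_iso (L K : Sub M) : Iso (L.push K).toRep (L.restrict K).quot := by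
  refine ⟨fun x =>
    { toFun := fun m => ⟨⟨m.1.1, m.2⟩, m.1.2.imp (fun h0 => Subtype.ext h0) (fun h0 => h0)⟩
      invFun := fun m => ⟨⟨m.1.1, m.2.imp (fun h0 => congrArg Subtype.val h0) (fun h0 => h0)⟩,
        m.1.2⟩
      left_inv := fun m => rfl
      right_inv := fun m => rfl }, fun x => rfl, fun a m => ?_⟩
  apply Subtype.ext
  apply Subtype.ext
  change (L.quot.map a m.1).1 = ((L.restrict K).quot.map a _).1.1
  by_cases h2 : M.map a m.1.1 ∈ L.carrier _
  · rw [quot_map_of_mem L a _ h2]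
    exact (congrArg Subtype.val (quot_map_of_mem (L.restrict K) a ⟨⟨m.1.1, m.2⟩, _⟩ h2)).symm
  · rw [quot_map_of_not_mem L a _ h2]
    exact (congrArg Subtype.val (quot_map_of_not_mem (L.restrict K) a ⟨⟨m.1.1, m.2⟩, _⟩ h2)).symm

lemma restrict_iso (L K : Sub M) (h : L ≤ K) : Iso (L.restrict K).toRep L.toRep :=
  ⟨fun x =>
    { toFun := fun m => ⟨m.1.1, m.2⟩
      invFun := fun m => ⟨⟨m.1, h x m.2⟩, m.2⟩
      left_inv := fun m => rfl
      right_inv := fun m => rfl }, fun x => rfl, fun a m => rfl⟩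

lemma fullSub_iso (M : Rep Q) : Iso (fullSub M).toRep M :=
  ⟨fun x =>
    { toFun := fun m => m.1
      invFun := fun m => ⟨m, trivial⟩
      left_inv := fun m => rfl
      right_inv := fun m => rfl }, fun x => rfl, fun a m => rfl⟩

lemma quot_zeroSub_iso (M : Rep Q) : Iso (zeroSub M).quot M := by
  refine ⟨fun x =>
    { toFun := fun m => m.1
      invFun := fun m => ⟨m, em _⟩
      left_inv := fun m => rfl
      right_inv := fun m => rfl }, fun x => rfl, fun a m => ?_⟩
  change ((zeroSub M).quot.map a m).1 = _
  by_cases h : M.map a m.1 ∈ (zeroSub M).carrier _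
  · rw [quot_map_of_mem _ a _ h]; exact (Set.mem_singleton_iff.1 h).symm
  · rw [quot_map_of_not_mem _ a _ h]; rfl

lemma toRep_isZero_iff (L : Sub M) : L.toRep.IsZero ↔ L = zeroSub M := by
  constructor
  · intro h
    ext x m
    constructor
    · intro hm; exact congrArg Subtype.val (h x ⟨m, hm⟩)
    · intro hm; rw [Set.mem_singleton_iff.1 hm]; exact L.zero_mem x
  · rintro rfl x m
    exact Subtype.ext m.2

lemma quot_isZero_iff (L : Sub M) : L.quot.IsZero ↔ L = fullSub M := by
  constructor
  · intro h
    ext x m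
    refine ⟨fun _ => trivial, fun _ => ?_⟩
    by_contra hm
    have h0 : m = 0 := congrArg Subtype.val (h x ⟨m, Or.inr hm⟩)
    exact hm (h0 ▸ L.zero_mem x)
  · rintro rfl x m
    exact Subtype.ext (m.2.resolve_right (fun h => h trivial))

/-- Transport of subrepresentations along an isomorphism. -/
lemma exists_equiv_of_iso (h : Iso M N) :
    ∃ e : Sub M ≃ Sub N, ∀ L, Iso L.toRep (e L).toRep ∧ Iso L.quot (e L).quot := by
  obtain ⟨e, h0, he⟩ := h
  have h0' : ∀ x, (e x).symm 0 = 0 := fun x => by rw [Equiv.symm_apply_eq, h0]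
  have he' : ∀ a n, (e _).symm (N.map a n) = M.map a ((e _).symm n) := fun a n => by
    rw [Equiv.symm_apply_eq, he, Equiv.apply_symm_apply]
  refine ⟨
    { toFun := fun L =>
        { carrier := fun x => {n | (e x).symm n ∈ L.carrier x}
          zero_mem := fun x => by
            change (e x).symm 0 ∈ L.carrier x
            rw [h0']; exact L.zero_mem x
          map_mem := fun a n hn => by
            change (e _).symm (N.map a n) ∈ L.carrier _
            rw [he']; exact L.map_mem a _ hn }
      invFun := fun L =>
        { carrier := fun x => {n | e x n ∈ L.carrier x}
          zero_mem := fun x => by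
            change e x 0 ∈ L.carrier x
            rw [h0]; exact L.zero_mem x
          map_mem := fun a n hn => by
            change e _ (M.map a n) ∈ L.carrier _
            rw [he]; exact L.map_mem a _ hn }
      left_inv := fun L => by ext x m; simp
      right_inv := fun L => by ext x m; simp }, fun L => ⟨?_, ?_⟩⟩
  · refine ⟨fun x => (e x).subtypeEquiv (fun m => by simp), fun x => Subtype.ext (h0 x),
      fun a m => Subtype.ext (he a m.1)⟩
  · refine ⟨fun x => (e x).subtypeEquiv (fun m => ?_), fun x => Subtype.ext (h0 x),
      fun a m => Subtype.ext ?_⟩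
    · have : m = 0 ↔ e x m = 0 := by rw [← h0 x, (e x).apply_eq_iff_eq]
      simp [this]
    · change e _ (L.quot.map a m).1 = _
      by_cases h : M.map a m.1 ∈ L.carrier _
      · rw [quot_map_of_mem L a _ h, quot_map_of_mem, h0]
        change (e _).symm (N.map a (e _ m.1)) ∈ L.carrier _
        simpa [← he] using h
      · rw [quot_map_of_not_mem L a _ h, quot_map_of_not_mem, he]
        · rfl
        · change (e _).symm (N.map a (e _ m.1)) ∉ L.carrier _
          simpa [← he] using h

/-- The subrepresentations of a direct sum are the direct sums of subrepresentations. -/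
def sumSub (L : Sub M) (K : Sub N) : Sub (M.sum N) where
  carrier x := {p | p.1.1 ∈ L.carrier x ∧ p.1.2 ∈ K.carrier x}
  zero_mem x := ⟨L.zero_mem x, K.zero_mem x⟩
  map_mem a p h := ⟨L.map_mem a _ h.1, K.map_mem a _ h.2⟩

def sumSubEquiv (M N : Rep Q) : Sub M × Sub N ≃ Sub (M.sum N) where
  toFun P := sumSub P.1 P.2
  invFun P :=
    ({ carrier := fun x => {m | (⟨(m, 0), Or.inr rfl⟩ : (M.sum N).obj x) ∈ P.carrier x}
       zero_mem := fun x => P.zero_mem x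
       map_mem := fun a m hm => by
        have e : (M.sum N).map a ⟨(m, 0), Or.inr rfl⟩ = ⟨(M.map a m, 0), Or.inr rfl⟩ :=
          Subtype.ext (Prod.ext rfl (N.map_zero a))
        change (⟨(M.map a m, 0), Or.inr rfl⟩ : (M.sum N).obj _) ∈ P.carrier _
        exact e ▸ P.map_mem a _ hm },
     { carrier := fun x => {m | (⟨(0, m), Or.inl rfl⟩ : (M.sum N).obj x) ∈ P.carrier x}
       zero_mem := fun x => P.zero_mem x
       map_mem := fun a m hm => by
        have e : (M.sum N).map a ⟨(0, m), Or.inl rfl⟩ = ⟨(0, N.map a m), Or.inl rfl⟩ :=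
          Subtype.ext (Prod.ext (M.map_zero a) rfl)
        change (⟨(0, N.map a m), Or.inl rfl⟩ : (M.sum N).obj _) ∈ P.carrier _
        exact e ▸ P.map_mem a _ hm })
  left_inv P := by
    refine Prod.ext ?_ ?_
    · ext x m
      exact ⟨fun h => h.1, fun h => ⟨h, P.2.zero_mem x⟩⟩
    · ext x m
      exact ⟨fun h => h.2, fun h => ⟨P.1.zero_mem x, h⟩⟩
  right_inv P := by
    ext x p
    obtain ⟨⟨m, n⟩, h⟩ := p
    constructor
    · rintro ⟨h1, h2⟩
      rcases h with h | h
      · dsimp only at h; subst h; exact h2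
      · dsimp only at h; subst h; exact h1
    · intro hp
      rcases h with h | h
      · dsimp only at h; subst h; exact ⟨P.zero_mem x, hp⟩
      · dsimp only at h; subst h; exact ⟨hp, P.zero_mem x⟩

lemma sumSub_iso (L : Sub M) (K : Sub N) : Iso (sumSub L K).toRep (L.toRep.sum K.toRep) :=
  ⟨fun x =>
    { toFun := fun p => ⟨(⟨p.1.1.1, p.2.1⟩, ⟨p.1.1.2, p.2.2⟩),
        p.1.2.imp (fun h => Subtype.ext h) (fun h => Subtype.ext h)⟩
      invFun := fun p => ⟨⟨(p.1.1.1, p.1.2.1), p.2.imp (fun h => congrArg Subtype.val h)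
        (fun h => congrArg Subtype.val h)⟩, p.1.1.2, p.1.2.2⟩
      left_inv := fun p => rfl
      right_inv := fun p => rfl }, fun x => rfl, fun a m => rfl⟩

lemma quot_sumSub_map (L : Sub M) (K : Sub N) (a : A) (p : (sumSub L K).quot.obj (Q.src a))
    (m : L.quot.obj (Q.src a)) (n : K.quot.obj (Q.src a)) (hpm : p.1.1.1 = m.1)
    (hpn : p.1.1.2 = n.1) :
    ((sumSub L K).quot.map a p).1.1 = ((L.quot.map a m).1, (K.quot.map a n).1) := by
  have hp : ((M.sum N).map a p.1).1 = (M.map a m.1, N.map a n.1) :=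
    Prod.ext (congrArg (M.map a) hpm) (congrArg (N.map a) hpn)
  have hMN : M.map a m.1 = 0 ∨ N.map a n.1 = 0 := p.1.2.imp
    (fun h => by rw [← hpm, h, M.map_zero]) (fun h => by rw [← hpn, h, N.map_zero])
  have hiff : (M.sum N).map a p.1 ∈ (sumSub L K).carrier _ ↔
      M.map a m.1 ∈ L.carrier _ ∧ N.map a n.1 ∈ K.carrier _ := by
    change ((M.sum N).map a p.1).1.1 ∈ _ ∧ ((M.sum N).map a p.1).1.2 ∈ _ ↔ _
    rw [hp]
  by_cases hm : M.map a m.1 ∈ L.carrier _ <;> by_cases hn : N.map a n.1 ∈ K.carrier _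
  · rw [quot_map_of_mem L a _ hm, quot_map_of_mem K a _ hn]
    exact congrArg Subtype.val (quot_map_of_mem _ a p (hiff.2 ⟨hm, hn⟩))
  · have h0 : M.map a m.1 = 0 :=
      hMN.resolve_right (fun h0 => hn (by rw [h0]; exact K.zero_mem _))
    rw [quot_map_of_mem L a _ hm, quot_map_of_not_mem K a _ hn]
    refine (congrArg Subtype.val
      (quot_map_of_not_mem _ a p (fun h => hn (hiff.1 h).2))).trans (hp.trans ?_)
    rw [h0]
  · have h0 : N.map a n.1 = 0 :=
      hMN.resolve_left (fun h0 => hm (by rw [h0]; exact L.zero_mem _))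
    rw [quot_map_of_not_mem L a _ hm, quot_map_of_mem K a _ hn]
    refine (congrArg Subtype.val
      (quot_map_of_not_mem _ a p (fun h => hm (hiff.1 h).1))).trans (hp.trans ?_)
    rw [h0]
  · exfalso
    rcases hMN with h0 | h0
    · exact hm (by rw [h0]; exact L.zero_mem _)
    · exact hn (by rw [h0]; exact K.zero_mem _)

lemma quot_sumSub_fst (L : Sub M) (K : Sub N) {x : V} (p : (sumSub L K).quot.obj x) :
    p.1.1.1 = 0 ∨ p.1.1.1 ∉ L.carrier x := by
  obtain ⟨⟨⟨m, n⟩, h⟩, h'⟩ := p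
  change m = 0 ∨ m ∉ _
  rcases h with h | h
  · exact Or.inl h
  · rcases h' with h' | h'
    · exact Or.inl (congrArg (fun p => p.1.1) h')
    · right
      intro hm
      dsimp only at h; subst h
      exact h' ⟨hm, K.zero_mem x⟩

lemma quot_sumSub_snd (L : Sub M) (K : Sub N) {x : V} (p : (sumSub L K).quot.obj x) :
    p.1.1.2 = 0 ∨ p.1.1.2 ∉ K.carrier x := by
  obtain ⟨⟨⟨m, n⟩, h⟩, h'⟩ := p
  change n = 0 ∨ n ∉ _
  rcases h with h | h
  · rcases h' with h' | h'
    · exact Or.inl (congrArg (fun p => p.1.2) h')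
    · right
      intro hm
      dsimp only at h; subst h
      exact h' ⟨L.zero_mem x, hm⟩
  · exact Or.inl h

lemma quot_sumSub_iso (L : Sub M) (K : Sub N) :
    Iso (sumSub L K).quot (L.quot.sum K.quot) := by
  refine ⟨fun x =>
    { toFun := fun p => ⟨(⟨p.1.1.1, quot_sumSub_fst L K p⟩, ⟨p.1.1.2, quot_sumSub_snd L K p⟩),
        p.1.2.imp (fun h => Subtype.ext h) (fun h => Subtype.ext h)⟩
      invFun := fun p => ⟨⟨(p.1.1.1, p.1.2.1), p.2.imp (fun h => congrArg Subtype.val h)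
        (fun h => congrArg Subtype.val h)⟩, ?_⟩
      left_inv := fun p => rfl
      right_inv := fun p => rfl }, fun x => rfl, fun a p => ?_⟩
  · obtain ⟨⟨⟨m, hm⟩, ⟨n, hn⟩⟩, h⟩ := p
    rcases hm with hm | hm
    · rcases hn with hn | hn
      · left; exact Subtype.ext (Prod.ext hm hn)
      · right; exact fun h' => hn h'.2
    · right; exact fun h' => hm h'.1
  · have key := quot_sumSub_map L K a p ⟨p.1.1.1, quot_sumSub_fst L K p⟩
      ⟨p.1.1.2, quot_sumSub_snd L K p⟩ rfl rfl
    exact Subtype.ext (Prod.ext (Subtype.ext (congrArg Prod.fst key))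
      (Subtype.ext (congrArg Prod.snd key)))

end Sub

/-! ### Elementary facts on isomorphisms, direct sums and nilpotency -/

lemma IsZero.iso {M N : Rep Q} (hM : M.IsZero) (hN : N.IsZero) : Iso M N :=
  ⟨fun x => ⟨fun _ => 0, fun _ => 0, fun m => (hM x m).symm, fun n => (hN x n).symm⟩,
    fun _ => rfl, fun a _ => (N.map_zero a).symm⟩

lemma IsZero.of_iso {M N : Rep Q} (h : Iso M N) (hM : M.IsZero) : N.IsZero := by
  obtain ⟨e, h0, -⟩ := h
  intro x n
  rw [← (e x).apply_symm_apply n, hM x ((e x).symm n), h0]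

lemma isZero_zeroRep (Q : FinQuiver V A) : (zeroRep Q).IsZero := fun _ _ => rfl

lemma isZero_sum_iff {M N : Rep Q} : (M.sum N).IsZero ↔ M.IsZero ∧ N.IsZero := by
  constructor
  · intro h
    exact ⟨fun x m => congrArg (fun p => p.1.1) (h x ⟨(m, 0), Or.inr rfl⟩),
      fun x m => congrArg (fun p => p.1.2) (h x ⟨(0, m), Or.inl rfl⟩)⟩
  · rintro ⟨h1, h2⟩ x p
    exact Subtype.ext (Prod.ext (h1 x _) (h2 x _))

lemma sum_iso_left {M N : Rep Q} (hN : N.IsZero) : Iso (M.sum N) M :=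
  ⟨fun x => ⟨fun p => p.1.1, fun m => ⟨(m, 0), Or.inr rfl⟩,
    fun p => Subtype.ext (Prod.ext rfl (hN x _).symm), fun _ => rfl⟩, fun _ => rfl, fun _ _ => rfl⟩

lemma sum_iso_right {M N : Rep Q} (hM : M.IsZero) : Iso (M.sum N) N :=
  ⟨fun x => ⟨fun p => p.1.2, fun m => ⟨(0, m), Or.inl rfl⟩,
    fun p => Subtype.ext (Prod.ext (hM x _).symm rfl), fun _ => rfl⟩, fun _ => rfl, fun _ _ => rfl⟩

lemma sum_congr {M M' N N' : Rep Q} (h : Iso M M') (h' : Iso N N') :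
    Iso (M.sum N) (M'.sum N') := by
  obtain ⟨e, h0, he⟩ := h
  obtain ⟨e', h0', he'⟩ := h'
  refine ⟨fun x => ((e x).prodCongr (e' x)).subtypeEquiv (fun p => ?_),
    fun x => Subtype.ext (Prod.ext (h0 x) (h0' x)),
    fun a p => Subtype.ext (Prod.ext (he a _) (he' a _))⟩
  have h1 : p.1 = 0 ↔ e x p.1 = 0 := by rw [← h0 x, (e x).apply_eq_iff_eq]
  have h2 : p.2 = 0 ↔ e' x p.2 = 0 := by rw [← h0' x, (e' x).apply_eq_iff_eq]
  simp [h1, h2]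

lemma pathMap_iso {M N : Rep Q} (e : ∀ x, M.obj x ≃ N.obj x)
    (he : ∀ a m, e _ (M.map a m) = N.map a (e _ m)) {x y : V} (p : Q.Path x y) (m : M.obj x) :
    e y (M.pathMap p m) = N.pathMap p (e x m) := by
  induction p with
  | nil => rfl
  | cons a p ih => simp only [pathMap, he, ih]

lemma IsNilpotent.of_iso {M N : Rep Q} (h : Iso M N) (hM : M.IsNilpotent) : N.IsNilpotent := by
  obtain ⟨e, h0, he⟩ := h
  obtain ⟨n, hn⟩ := hM
  refine ⟨n, fun x y p hp m => ?_⟩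
  rw [← (e x).apply_symm_apply m, ← pathMap_iso e he, hn x y p hp, h0]

lemma exists_split {x y : V} (p : Q.Path x y) (k : ℕ) (hk : k ≤ p.length) :
    ∃ (z : V) (q : Q.Path x z) (r : Q.Path z y), q.length = k ∧ k + r.length = p.length ∧
      ∀ (M : Rep Q) (m : M.obj x), M.pathMap p m = M.pathMap r (M.pathMap q m) := by
  induction p with
  | nil =>
    refine ⟨x, .nil, .nil, ?_, ?_, fun _ _ => rfl⟩
    · simp only [FinQuiver.Path.length] at hk ⊢; omega
    · simp only [FinQuiver.Path.length] at hk ⊢; omega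
  | cons a p ih =>
    rcases Nat.lt_or_ge p.length k with h | h
    · refine ⟨_, .cons a p, .nil, ?_, ?_, fun _ _ => rfl⟩
      · simp only [FinQuiver.Path.length] at hk ⊢; omega
      · simp only [FinQuiver.Path.length] at hk ⊢; omega
    · obtain ⟨z, q, r, h1, h2, h3⟩ := ih h
      refine ⟨z, q, .cons a r, h1, ?_, fun M m => ?_⟩
      · simp only [FinQuiver.Path.length]; omega
      · simp only [pathMap, h3]

lemma pathMap_toRep {M : Rep Q} (L : Sub M) {x y : V} (p : Q.Path x y) (m : L.toRep.obj x) :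
    (L.toRep.pathMap p m).1 = M.pathMap p m.1 := by
  induction p with
  | nil => rfl
  | cons a p ih => simp only [pathMap, ← ih]; rfl

lemma pathMap_quot {M : Rep Q} (L : Sub M) {x y : V} (p : Q.Path x y) (m : M.obj x)
    (h : M.pathMap p m ∉ L.carrier y) :
    ∃ m' : L.quot.obj x, (L.quot.pathMap p m').1 = M.pathMap p m := by
  suffices H : ∃ hm : m ∉ L.carrier x,
      (L.quot.pathMap p ⟨m, Or.inr hm⟩).1 = M.pathMap p m from ⟨_, H.2⟩
  induction p with
  | nil => exact ⟨h, rfl⟩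
  | cons a p ih =>
    obtain ⟨hm, hh⟩ := ih (fun h' => h (L.map_mem a _ h'))
    refine ⟨hm, ?_⟩
    simp only [pathMap] at h ⊢
    rw [Sub.quot_map_of_not_mem _ _ _ (by rw [hh]; exact h), hh]

/-- Extensions of nilpotent representations are nilpotent. -/
lemma IsNilpotent.of_sub_quot {M : Rep Q} (L : Sub M) (h1 : L.toRep.IsNilpotent)
    (h2 : L.quot.IsNilpotent) : M.IsNilpotent := by
  obtain ⟨n1, h1⟩ := h1
  obtain ⟨n2, h2⟩ := h2
  refine ⟨n2 + n1, fun x y p hp m => ?_⟩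
  obtain ⟨z, q, r, hq, hr, hpq⟩ := exists_split p n2 (by omega)
  have hmem : M.pathMap q m ∈ L.carrier z := by
    by_contra hcon
    obtain ⟨m', hm'⟩ := pathMap_quot L q m hcon
    rw [h2 _ _ q hq.ge] at hm'
    exact hcon (hm' ▸ L.zero_mem z)
  rw [hpq]
  have := pathMap_toRep L r ⟨_, hmem⟩
  exact this.symm.trans (congrArg Subtype.val (h1 _ _ r (by omega) _))

end Rep

/-! ### The Hall algebra -/

section Hall

variable {V : Type u} {A : Type v}

/-- Isomorphism classes of representations. -/
def IsoClass (Q : FinQuiver V A) : Type _ := Quotient (Rep.isoSetoid Q)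

/-- The isomorphism class of a representation. -/
def cls {Q : FinQuiver V A} (M : Rep Q) : IsoClass Q := Quotient.mk _ M

lemma cls_eq_iff {Q : FinQuiver V A} {M N : Rep Q} : cls M = cls N ↔ Rep.Iso M N :=
  Quotient.eq (r := Rep.isoSetoid Q)

lemma cls_surj {Q : FinQuiver V A} (c : IsoClass Q) : ∃ M, cls M = c := Quotient.exists_rep c

/-- The Hall algebra as a vector space: finitely supported functions on isomorphism classes. -/
def Hall (Q : FinQuiver V A) : Type _ := IsoClass Q →₀ ℂ

instance (Q : FinQuiver V A) : AddCommGroup (Hall Q) := inferInstanceAs (AddCommGroup (_ →₀ ℂ))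

instance (Q : FinQuiver V A) : Module ℂ (Hall Q) := inferInstanceAs (Module ℂ (_ →₀ ℂ))

instance (Q : FinQuiver V A) : FunLike (Hall Q) (IsoClass Q) ℂ :=
  inferInstanceAs (FunLike (_ →₀ ℂ) _ _)

/-- The delta function of the isomorphism class of `M`. -/
def delta {Q : FinQuiver V A} (M : Rep Q) : Hall Q := Finsupp.single (cls M) (1 : ℂ)

namespace Hall

variable {Q : FinQuiver V A}

@[ext]
lemma ext {f g : Hall Q} (h : ∀ M, f (cls M) = g (cls M)) : f = g :=
  Finsupp.ext fun c => by obtain ⟨M, rfl⟩ := cls_surj c; exact h M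

@[simp] lemma add_apply (f g : Hall Q) (c : IsoClass Q) : (f + g) c = f c + g c := rfl
@[simp] lemma sub_apply (f g : Hall Q) (c : IsoClass Q) : (f - g) c = f c - g c := rfl
@[simp] lemma neg_apply (f : Hall Q) (c : IsoClass Q) : (-f) c = - f c := rfl
@[simp] lemma zero_apply (c : IsoClass Q) : (0 : Hall Q) c = 0 := rfl
@[simp] lemma smul_apply (r : ℂ) (f : Hall Q) (c : IsoClass Q) : (r • f) c = r * f c := rfl

open Classical in
lemma delta_apply (M N : Rep Q) : delta M (cls N) = if Rep.Iso M N then 1 else 0 := by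
  change (Finsupp.single (cls M) (1 : ℂ)) (cls N) = _
  rw [Finsupp.single_apply]
  simp only [cls_eq_iff]

/-- There are finitely many isomorphism classes of bounded dimension. -/
lemma finite_bounded [Finite V] [Finite A] (Q : FinQuiver V A) (d : ℕ) :
    {c : IsoClass Q | ∃ M, cls M = c ∧ ∀ x, Nat.card (M.obj x) ≤ d}.Finite := by
  let X := Σ n : V → Fin d, {f : ∀ a, Fin (n (Q.src a) + 1) → Fin (n (Q.tgt a) + 1) //
    ∀ a, IsLinear (f a)}
  let F : X → IsoClass Q := fun t => cls
    { obj := fun x => Fin (t.1 x + 1)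
      map := t.2.1
      isLinear := t.2.2 }
  refine (Set.finite_range F).subset ?_
  rintro c ⟨M, rfl, hM⟩
  have hpos : ∀ x, 0 < Nat.card (M.obj x) := fun x =>
    haveI : Nonempty (M.obj x) := ⟨0⟩
    Nat.card_pos
  let n : V → Fin d := fun x => ⟨Nat.card (M.obj x) - 1, by have := hM x; have := hpos x; omega⟩
  have hn : ∀ x, Nat.card (M.obj x) = (n x : ℕ) + 1 := fun x => by
    have := hpos x
    simp only [n]; omega
  have hex : ∀ x, ∃ e : M.obj x ≃ Fin (n x + 1), e 0 = 0 := fun x => by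
    let e := Finite.equivFinOfCardEq (hn x)
    exact ⟨e.trans (Equiv.swap (e 0) 0), by simp⟩
  choose e he using hex
  have he' : ∀ x, (e x).symm 0 = 0 := fun x => by rw [Equiv.symm_apply_eq, he]
  have hlin : ∀ a, IsLinear (fun k => e _ (M.map a ((e _).symm k))) := by
    intro a
    have hne : ∀ m, e _ (M.map a m) ≠ 0 → M.map a m ≠ 0 := fun m h h0 => h (by rw [h0, he])
    refine ⟨by simp only [he', M.map_zero, he], ?_⟩
    intro k hk l hl hkl
    exact (e _).symm.injective ((M.isLinear a).2 (hne _ hk) (hne _ hl) ((e _).injective hkl))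
  refine ⟨⟨n, fun a k => e _ (M.map a ((e _).symm k)), hlin⟩, ?_⟩
  refine cls_eq_iff.2 (Rep.Iso.symm ⟨e, he, fun a m => ?_⟩)
  simp

variable [Finite V]

/-- The Hall product at a representation `R`: the sum over all subrepresentations `L` of
`f [R / L] * g [L]`. -/
def mulFun (f g : Hall Q) (R : Rep Q) : ℂ :=
  ∑ L : Rep.Sub R, f (cls L.quot) * g (cls L.toRep)

lemma mulFun_congr (f g : Hall Q) {R R' : Rep Q} (h : Rep.Iso R R') :
    mulFun f g R = mulFun f g R' := by
  obtain ⟨e, he⟩ := Rep.Sub.exists_equiv_of_iso h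
  refine Fintype.sum_equiv e _ _ (fun L => ?_)
  rw [cls_eq_iff.2 (he L).1, cls_eq_iff.2 (he L).2]

lemma card_le_of_sub {R : Rep Q} (L : Rep.Sub R) (x : V) :
    Nat.card (R.obj x) ≤ Nat.card (L.quot.obj x) + Nat.card (L.toRep.obj x) := by
  classical
  rw [← Nat.card_sum]
  refine Nat.card_le_card_of_injective
    (fun m => if h : m ∈ L.carrier x then Sum.inr ⟨m, h⟩ else Sum.inl ⟨m, Or.inr h⟩) ?_
  intro m n h
  dsimp only at h
  split_ifs at h with h1 h2 h2
  · exact congrArg Subtype.val (Sum.inr.inj h)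
  · exact congrArg Subtype.val (Sum.inl.inj h)

lemma exists_bound (f : Hall Q) : ∃ d : ℕ, ∀ M, f (cls M) ≠ 0 → ∀ x, Nat.card (M.obj x) ≤ d := by
  classical
  have hfin : (Function.support (f : IsoClass Q → ℂ)).Finite :=
    Finsupp.hasFiniteSupport (show IsoClass Q →₀ ℂ from f)
  have key : ∀ S : Set (IsoClass Q), S.Finite →
      ∃ d : ℕ, ∀ M, cls M ∈ S → ∀ x, Nat.card (M.obj x) ≤ d := by
    intro S hS
    induction S, hS using Set.Finite.induction_on with
    | empty => exact ⟨0, fun M h => h.elim⟩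
    | @insert c S _ _ ih =>
      obtain ⟨d, hd⟩ := ih
      obtain ⟨N, rfl⟩ := cls_surj c
      have : Fintype V := Fintype.ofFinite V
      refine ⟨d + ∑ x, Nat.card (N.obj x), fun M hM x => ?_⟩
      rcases hM with hM | hM
      · obtain ⟨e, -, -⟩ := cls_eq_iff.1 hM
        rw [Nat.card_congr (e x)]
        have := Finset.single_le_sum (f := fun x => Nat.card (N.obj x))
          (fun _ _ => Nat.zero_le _) (Finset.mem_univ x)
        omega
      · have := hd M hM x
        omega
  obtain ⟨d, hd⟩ := key _ hfin
  exact ⟨d, fun M hM => hd M hM⟩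

variable [Finite A]

lemma mulFun_finite (f g : Hall Q) :
    (Function.support (fun c : IsoClass Q =>
      Quotient.lift (mulFun f g) (fun _ _ h => mulFun_congr f g h) c)).Finite := by
  obtain ⟨d, hd⟩ := exists_bound f
  obtain ⟨d', hd'⟩ := exists_bound g
  refine (finite_bounded Q (d + d')).subset ?_
  intro c hc
  obtain ⟨R, rfl⟩ := cls_surj c
  obtain ⟨L, -, hL⟩ := Finset.exists_ne_zero_of_sum_ne_zero hc
  exact ⟨R, rfl, fun x => (card_le_of_sub L x).trans
    (add_le_add (hd _ (left_ne_zero_of_mul hL) x) (hd' _ (right_ne_zero_of_mul hL) x))⟩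

/-- The Hall product. -/
instance : Mul (Hall Q) where
  mul f g := Finsupp.ofSupportFinite _ (mulFun_finite f g)

/-- The unit is the class of the zero representation. -/
instance : One (Hall Q) where
  one := delta (Rep.zeroRep Q)

lemma mul_apply (f g : Hall Q) (R : Rep Q) :
    (f * g) (cls R) = ∑ L : Rep.Sub R, f (cls L.quot) * g (cls L.toRep) := rfl

open Classical in
lemma one_apply (M : Rep Q) : (1 : Hall Q) (cls M) = if M.IsZero then 1 else 0 := by
  change delta (Rep.zeroRep Q) (cls M) = _
  rw [delta_apply]
  congr 1
  exact propext ⟨fun h => .of_iso h (Rep.isZero_zeroRep Q), fun h => (Rep.isZero_zeroRep Q).iso h⟩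

/-- The structure constants: the coefficient of `[R]` in `[M] * [N]` is the number of
subrepresentations `L` of `R` with `L ≅ N` and `R / L ≅ M`. -/
lemma delta_mul_delta (M N R : Rep Q) :
    (delta M * delta N) (cls R) =
      (Nat.card {L : Rep.Sub R // Rep.Iso L.toRep N ∧ Rep.Iso L.quot M} : ℂ) := by
  classical
  rw [mul_apply, Nat.card_eq_fintype_card, Fintype.card_subtype, Finset.card_filter]
  push_cast
  refine Finset.sum_congr rfl (fun L _ => ?_)
  rw [delta_apply, delta_apply]
  have h1 : Rep.Iso M L.quot ↔ Rep.Iso L.quot M := ⟨Rep.Iso.symm, Rep.Iso.symm⟩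
  have h2 : Rep.Iso N L.toRep ↔ Rep.Iso L.toRep N := ⟨Rep.Iso.symm, Rep.Iso.symm⟩
  simp only [h1, h2, ← ite_and, mul_ite, mul_one, mul_zero]

protected lemma mul_assoc (f g h : Hall Q) : f * g * h = f * (g * h) := by
  classical
  ext R
  let F : Rep.Sub R → Rep.Sub R → ℂ := fun L K =>
    f (cls K.quot) * g (cls (L.restrict K).quot) * h (cls L.toRep)
  have h1 : (f * g * h) (cls R) = ∑ L : Rep.Sub R, ∑ K : Rep.Sub R, if L ≤ K then F L K else 0 := by
    rw [mul_apply]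
    refine Finset.sum_congr rfl (fun L _ => ?_)
    rw [mul_apply, Finset.sum_mul, ← Finset.sum_filter,
      ← Finset.sum_subtype_eq_sum_filter, Finset.subtype_univ]
    refine (Fintype.sum_equiv L.pushEquiv _ _ (fun K => ?_)).symm
    change _ = f (cls (L.push K.1).quot) * g (cls (L.push K.1).toRep) * h (cls L.toRep)
    rw [cls_eq_iff.2 (Rep.Sub.quot_push_iso L K.1 K.2), cls_eq_iff.2 (Rep.Sub.push_iso L K.1)]
  have h2 : (f * (g * h)) (cls R) =
      ∑ K : Rep.Sub R, ∑ L : Rep.Sub R, if L ≤ K then F L K else 0 := by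
    rw [mul_apply]
    refine Finset.sum_congr rfl (fun K _ => ?_)
    rw [mul_apply, Finset.mul_sum, ← Finset.sum_filter,
      ← Finset.sum_subtype_eq_sum_filter, Finset.subtype_univ]
    refine (Fintype.sum_equiv K.restrictEquiv _ _ (fun L => ?_)).symm
    change _ = f (cls K.quot) * (g (cls (L.1.restrict K).quot) * h (cls (L.1.restrict K).toRep))
    rw [cls_eq_iff.2 (Rep.Sub.restrict_iso L.1 K L.2), ← mul_assoc]
  rw [h1, h2, Finset.sum_comm]

protected lemma one_mul (f : Hall Q) : 1 * f = f := by
  classical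
  ext R
  rw [mul_apply, Finset.sum_eq_single (Rep.Sub.fullSub R)]
  · rw [one_apply, if_pos ((Rep.Sub.quot_isZero_iff _).2 rfl), one_mul,
      cls_eq_iff.2 (Rep.Sub.fullSub_iso R)]
  · intro L _ hL
    rw [one_apply, if_neg (fun h => hL ((Rep.Sub.quot_isZero_iff _).1 h)), zero_mul]
  · intro h; exact absurd (Finset.mem_univ _) h

protected lemma mul_one (f : Hall Q) : f * 1 = f := by
  classical
  ext R
  rw [mul_apply, Finset.sum_eq_single (Rep.Sub.zeroSub R)]
  · rw [one_apply, if_pos ((Rep.Sub.toRep_isZero_iff _).2 rfl), mul_one,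
      cls_eq_iff.2 (Rep.Sub.quot_zeroSub_iso R)]
  · intro L _ hL
    rw [one_apply, if_neg (fun h => hL ((Rep.Sub.toRep_isZero_iff _).1 h)), mul_zero]
  · intro h; exact absurd (Finset.mem_univ _) h

instance : Ring (Hall Q) where
  __ := (inferInstance : AddCommGroup (Hall Q))
  mul_assoc := Hall.mul_assoc
  one_mul := Hall.one_mul
  mul_one := Hall.mul_one
  left_distrib f g h := by
    ext R; simp [mul_apply, mul_add, Finset.sum_add_distrib]
  right_distrib f g h := by
    ext R; simp [mul_apply, add_mul, Finset.sum_add_distrib]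
  zero_mul f := by ext R; simp [mul_apply]
  mul_zero f := by ext R; simp [mul_apply]

instance : LieRing (Hall Q) := LieRing.ofAssociativeRing

instance : Algebra ℂ (Hall Q) :=
  Algebra.ofModule
    (fun r f g => by ext R; simp [mul_apply, Finset.mul_sum, mul_assoc])
    (fun r f g => by ext R; simp [mul_apply, Finset.mul_sum, mul_left_comm])

/-- The coproduct `Δ(f)([M], [N]) = f([M ⊕ N])`, with values in functions on pairs of
isomorphism classes. -/
def coproduct (f : Hall Q) : IsoClass Q → IsoClass Q → ℂ := fun c d =>
  f (Quotient.map₂ Rep.sum (fun _ _ h _ _ h' => Rep.sum_congr h h') c d)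

/-- Primitive elements: `Δ(f) = f ⊗ 1 + 1 ⊗ f`. -/
def IsPrimitive (f : Hall Q) : Prop :=
  ∀ c d, f.coproduct c d = f c * (1 : Hall Q) d + (1 : Hall Q) c * f d

lemma isPrimitive_iff (f : Hall Q) : f.IsPrimitive ↔ ∀ M N : Rep Q,
    f (cls (M.sum N)) = f (cls M) * (1 : Hall Q) (cls N) + (1 : Hall Q) (cls M) * f (cls N) :=
  ⟨fun h M N => h (cls M) (cls N), fun h c d => by
    obtain ⟨M, rfl⟩ := cls_surj c
    obtain ⟨N, rfl⟩ := cls_surj d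
    exact h M N⟩

/-- The primitive elements are the functions supported on indecomposable representations. -/
lemma isPrimitive_iff_support (f : Hall Q) :
    f.IsPrimitive ↔ ∀ M : Rep Q, f (cls M) ≠ 0 → M.IsIndecomposable := by
  classical
  rw [isPrimitive_iff]
  constructor
  · intro h M hM
    have h0 : ∀ Z : Rep Q, Z.IsZero → f (cls Z) = 0 := by
      intro Z hZ
      have := h Z Z
      rw [cls_eq_iff.2 (Rep.sum_iso_left hZ), one_apply, if_pos hZ] at this
      simpa using this
    refine ⟨fun hz => hM (h0 M hz), fun N P hNP => ?_⟩
    by_contra hcon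
    push Not at hcon
    apply hM
    rw [cls_eq_iff.2 hNP, h, one_apply, one_apply, if_neg hcon.1, if_neg hcon.2]
    simp
  · intro h M N
    have h0 : ∀ Z : Rep Q, Z.IsZero → f (cls Z) = 0 := by
      intro Z hZ
      by_contra hcon
      exact (h Z hcon).1 hZ
    by_cases hM : M.IsZero
    · rw [cls_eq_iff.2 (Rep.sum_iso_right hM), h0 M hM, one_apply M, if_pos hM]
      simp
    · by_cases hN : N.IsZero
      · rw [cls_eq_iff.2 (Rep.sum_iso_left hN), h0 N hN, one_apply N, if_pos hN]
        simp
      · rw [one_apply, one_apply, if_neg hM, if_neg hN]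
        simp only [mul_zero, zero_mul, add_zero]
        by_contra hcon
        rcases (h _ hcon).2 M N (Rep.Iso.refl _) with h' | h'
        · exact hM h'
        · exact hN h'

lemma mul_sum_apply {f g : Hall Q} (hf : f.IsPrimitive) (hg : g.IsPrimitive) (M N : Rep Q) :
    (f * g) (cls (M.sum N)) = (f * g) (cls M) * (1 : Hall Q) (cls N) + f (cls M) * g (cls N) +
      g (cls M) * f (cls N) + (1 : Hall Q) (cls M) * (f * g) (cls N) := by
  rw [isPrimitive_iff] at hf hg
  have key : ∀ a b c d : Hall Q,
      ∑ P : Rep.Sub M × Rep.Sub N, (a (cls P.1.quot) * b (cls P.1.toRep)) *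
        (c (cls P.2.quot) * d (cls P.2.toRep)) = (a * b) (cls M) * (c * d) (cls N) := by
    intro a b c d
    rw [mul_apply, mul_apply, Fintype.sum_mul_sum, Fintype.sum_prod_type]
  rw [mul_apply, ← Fintype.sum_equiv (Rep.Sub.sumSubEquiv M N) (fun P =>
    (f (cls P.1.quot) * g (cls P.1.toRep)) *
        ((1 : Hall Q) (cls P.2.quot) * (1 : Hall Q) (cls P.2.toRep)) +
    (f (cls P.1.quot) * (1 : Hall Q) (cls P.1.toRep)) *
        ((1 : Hall Q) (cls P.2.quot) * g (cls P.2.toRep)) +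
    ((1 : Hall Q) (cls P.1.quot) * g (cls P.1.toRep)) *
        (f (cls P.2.quot) * (1 : Hall Q) (cls P.2.toRep)) +
    ((1 : Hall Q) (cls P.1.quot) * (1 : Hall Q) (cls P.1.toRep)) *
        (f (cls P.2.quot) * g (cls P.2.toRep)))]
  · rw [Finset.sum_add_distrib, Finset.sum_add_distrib, Finset.sum_add_distrib,
      key, key, key, key]
    simp only [mul_one, one_mul]
  · rintro ⟨L, K⟩
    change _ = f (cls (Rep.Sub.sumSub L K).quot) * g (cls (Rep.Sub.sumSub L K).toRep)
    rw [cls_eq_iff.2 (Rep.Sub.sumSub_iso L K), cls_eq_iff.2 (Rep.Sub.quot_sumSub_iso L K), hf, hg]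
    ring

lemma mul_nilpotent {f g : Hall Q} (hf : ∀ M, f (cls M) ≠ 0 → M.IsNilpotent)
    (hg : ∀ M, g (cls M) ≠ 0 → M.IsNilpotent) (M : Rep Q) (h : (f * g) (cls M) ≠ 0) :
    M.IsNilpotent := by
  rw [mul_apply] at h
  obtain ⟨L, -, hL⟩ := Finset.exists_ne_zero_of_sum_ne_zero h
  exact .of_sub_quot L (hg _ (right_ne_zero_of_mul hL)) (hf _ (left_ne_zero_of_mul hL))

end Hall

variable [Finite V] [Finite A]

/-- The Lie algebra of nilpotent indecomposable representations: the primitive elements of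
the Hall algebra (with the commutator bracket) that are supported on nilpotent representations. -/
def nilLie (Q : FinQuiver V A) : LieSubalgebra ℂ (Hall Q) where
  carrier := {f | f.IsPrimitive ∧ ∀ M, f (cls M) ≠ 0 → M.IsNilpotent}
  add_mem' := by
    rintro f g ⟨hf, hf'⟩ ⟨hg, hg'⟩
    refine ⟨?_, fun M hM => ?_⟩
    · rw [Hall.isPrimitive_iff] at *
      intro M N
      simp only [Hall.add_apply, hf M N, hg M N]
      ring
    · by_cases h : f (cls M) = 0
      · exact hg' M (fun h' => hM (by simp [h, h']))
      · exact hf' M h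
  zero_mem' := ⟨(Hall.isPrimitive_iff _).2 (fun M N => by simp), fun M h => absurd rfl h⟩
  smul_mem' := by
    rintro r f ⟨hf, hf'⟩
    refine ⟨?_, fun M hM => hf' M (right_ne_zero_of_mul hM)⟩
    rw [Hall.isPrimitive_iff] at *
    intro M N
    simp only [Hall.smul_apply, hf M N]
    ring
  lie_mem' := by
    rintro f g ⟨hf, hf'⟩ ⟨hg, hg'⟩
    rw [LieRing.of_associative_ring_bracket]
    refine ⟨(Hall.isPrimitive_iff _).2 fun M N => ?_, fun M hM => ?_⟩
    · simp only [Hall.sub_apply, Hall.mul_sum_apply hf hg, Hall.mul_sum_apply hg hf]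
      ring
    · by_cases h : (f * g) (cls M) = 0
      · exact Hall.mul_nilpotent hg' hf' M (fun h' => hM (by simp [h, h']))
      · exact Hall.mul_nilpotent hf' hg' M h

lemma delta_mem_nilLie {Q : FinQuiver V A} {M : Rep Q}
    (h : M.IsNilpotent ∧ M.IsIndecomposable) : delta M ∈ nilLie Q := by
  classical
  have hiso : ∀ N, delta M (cls N) ≠ 0 → Rep.Iso M N := by
    intro N hN
    rw [Hall.delta_apply] at hN
    by_contra hcon
    exact hN (if_neg hcon)
  refine ⟨(Hall.isPrimitive_iff_support _).2 fun N hN => ?_, fun N hN => h.1.of_iso (hiso N hN)⟩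
  exact ⟨fun hz => h.2.1 (.of_iso (hiso N hN).symm hz),
    fun P R hPR => h.2.2 P R ((hiso N hN).trans hPR)⟩

/-- The class of a nilpotent indecomposable representation, as an element of the Lie algebra. -/
def nilClass {Q : FinQuiver V A} (M : Rep Q) (h : M.IsNilpotent ∧ M.IsIndecomposable) :
    nilLie Q := ⟨delta M, delta_mem_nilLie h⟩

/-- The classes of the tree representations. -/
def treeClasses (Q : FinQuiver V A) : Set (nilLie Q) :=
  {t | ∃ (M : Rep Q) (h : M.IsTreeRep), t = nilClass M h.1}

/-- The linear span of the classes of the proper pseudotree representations. -/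
def pseudotreeSpan (Q : FinQuiver V A) : Submodule ℂ (nilLie Q) :=
  Submodule.span ℂ {t | ∃ (M : Rep Q) (h : M.IsProperPseudotreeRep), t = nilClass M h.1}

end Hall

end F1

end

/-! A representation is encoded by its coefficient quiver, a `Winding` of `Q`. Indecomposable means
connected, and subrepresentations are successor-closed sets of vertices, so the value of a bracket
is a signed sum over the cuts of a winding into a set `S` and its complement
(`Hall.lie_apply_winding`).

The hypothesis on `Q` enters through one combinatorial fact: by Hall's marriage theorem one can
choose an end of every arrow of `Q` so that no vertex is chosen twice
(`FinQuiver.exists_endpoint_injective`). Such a choice lifts to every winding, which therefore has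
at most as many arrows as vertices. Hence every nilpotent indecomposable is a tree or a proper
pseudotree, and the span of the proper pseudotrees consists of the elements that vanish on all trees
(`mem_pseudotreeSpan_iff`).

Quotient: a tree that is cut into two connected parts is cut along a single arrow, and both parts
are trees. So the value of a bracket at a tree depends only on the values of the factors at trees,
which makes the span an ideal. The sign of a cut records the direction of the crossing arrow;
reversing that arrow flips it, and the factor `(-1) ^ (number of reversed arrows)` compensates
exactly (`Winding.treeSign_mul_cutSign_twist`). Signed reversal on trees, extended by zero, is thus
a surjective homomorphism modulo the target ideal, with the source ideal as kernel.

Generation: if a proper pseudotree `M` exists, the graph of `Q` has a cycle, and turning the chosen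
ends round that cycle gives a second injective choice. Nilpotency forces the cycle of `M` to contain
arrows `e` and `f` of opposite sense. Cutting both leaves two trees, with `e` and `f` pointing to
the same one (`Winding.exists_cut`). In a proper pseudotree every vertex is a chosen end, for either
choice; this forces the colours and positions of the gluing arrows. Consequently `M` is the only
non-tree in the product of the two trees in one order (`Winding.equivalent_of_cut`), and the other
order contains no non-tree at all (`Winding.not_isClosed_of_equivalent`). The class of `M` is
therefore a multiple of a bracket of trees minus a combination of trees. -/

noncomputable section

namespace F1

namespace FinQuiver

/-! ### Euler characteristic and orientations of quivers with small first homology -/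

section Rank

variable {V A : Type*} [Finite V] [Finite A]

/-- The augmentation `C₀ → ℤ`. -/
def augmentation (V : Type*) : (V →₀ ℤ) →ₗ[ℤ] ℤ := Finsupp.linearCombination ℤ (fun _ => 1)

@[simp] lemma augmentation_single (x : V) (n : ℤ) :
    augmentation V (Finsupp.single x n) = n := by
  simp [augmentation]

lemma boundary_single (Q : FinQuiver V A) (a : A) (n : ℤ) :
    Q.boundary (Finsupp.single a n) =
      Finsupp.single (Q.tgt a) n - Finsupp.single (Q.src a) n := by
  simp [boundary, smul_sub]

lemma augmentation_comp_boundary (Q : FinQuiver V A) : augmentation V ∘ₗ Q.boundary = 0 := by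
  ext a
  simp [boundary_single]

lemma range_boundary_le (Q : FinQuiver V A) :
    LinearMap.range Q.boundary ≤ LinearMap.ker (augmentation V) :=
  LinearMap.range_le_ker_iff.2 Q.augmentation_comp_boundary

lemma finrank_range_add_ker {R M N : Type*} [CommRing R] [IsDomain R] [AddCommGroup M]
    [AddCommGroup N] [Module R M] [Module R N] [Module.Finite R M] (f : M →ₗ[R] N) :
    Module.finrank R (LinearMap.range f) + Module.finrank R (LinearMap.ker f) =
      Module.finrank R M := by
  rw [← f.quotKerEquivRange.finrank_eq]
  exact Submodule.finrank_quotient_add_finrank _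

lemma finrank_ker_augmentation [Nonempty V] :
    Module.finrank ℤ (LinearMap.ker (augmentation V)) + 1 = Nat.card V := by
  have : Fintype V := Fintype.ofFinite V
  have hs : LinearMap.range (augmentation V) = ⊤ := by
    rw [LinearMap.range_eq_top]
    intro n
    exact ⟨Finsupp.single (Classical.arbitrary V) n, by simp⟩
  have := finrank_range_add_ker (augmentation V)
  rw [hs, finrank_top] at this
  simp at this
  rw [Nat.card_eq_fintype_card]
  omega

lemma finrank_range_boundary (Q : FinQuiver V A) :
    Module.finrank ℤ (LinearMap.range Q.boundary) + Module.finrank ℤ Q.H1 = Nat.card A := by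
  have : Fintype A := Fintype.ofFinite A
  have := finrank_range_add_ker Q.boundary
  simp at this
  rw [Nat.card_eq_fintype_card]
  exact this

/-- Without connectedness boundaries still have augmentation zero, which gives one half of the Euler
formula. This half applies to arbitrary subgraphs, as Hall's condition requires. -/
lemma card_add_one_le (Q : FinQuiver V A) [Nonempty V] :
    Nat.card A + 1 ≤ Nat.card V + Module.finrank ℤ Q.H1 := by
  have h1 := Q.finrank_range_boundary
  have h2 := finrank_ker_augmentation (V := V)
  have h3 := Submodule.finrank_mono Q.range_boundary_le
  omega

/-- A difference of two vertices telescopes along a walk between them, and such differences span the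
kernel of the augmentation. -/
lemma ker_augmentation_le (Q : FinQuiver V A) (h : Q.Connected) :
    LinearMap.ker (augmentation V) ≤ LinearMap.range Q.boundary := by
  obtain ⟨⟨x₀⟩, hc⟩ := h
  have hxy : ∀ x y : V, Finsupp.single x (1 : ℤ) - Finsupp.single y 1 ∈
      LinearMap.range Q.boundary := by
    intro x y
    induction hc x y with
    | rel x y h =>
      obtain ⟨a, rfl, rfl⟩ := h
      exact ⟨-Finsupp.single a 1, by rw [map_neg, boundary_single, neg_sub]⟩
    | refl x => simp
    | symm x y _ ih => simpa using neg_mem ih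
    | trans x y z _ _ h1 h2 => simpa using add_mem h1 h2
  intro f hf
  have key : ∀ f : V →₀ ℤ,
      f - Finsupp.single x₀ (augmentation V f) ∈ LinearMap.range Q.boundary := by
    intro f
    induction f using Finsupp.induction_linear with
    | zero => simp
    | add f g hf hg =>
      have := add_mem hf hg
      rw [map_add, Finsupp.single_add]
      convert this using 1
      abel
    | single x n =>
      have := (LinearMap.range Q.boundary).smul_mem n (hxy x x₀)
      simpa [smul_sub] using this
  simpa [LinearMap.mem_ker.1 hf] using key f

lemma Connected.card_add_finrank {Q : FinQuiver V A} (h : Q.Connected) :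
    Nat.card V + Module.finrank ℤ Q.H1 = Nat.card A + 1 := by
  have := h.1
  have h1 := Q.finrank_range_boundary
  have h2 := finrank_ker_augmentation (V := V)
  rw [le_antisymm Q.range_boundary_le (Q.ker_augmentation_le h)] at h1
  omega

lemma Connected.card_le {Q : FinQuiver V A} (h : Q.Connected) :
    Nat.card V ≤ Nat.card A + 1 := by
  have := h.card_add_finrank
  omega

/-- The Euler formula turns the homological conditions into counts, which are all that the cutting
arguments use. -/
lemma isTree_iff {Q : FinQuiver V A} :
    Q.IsTree ↔ Q.Connected ∧ Nat.card V = Nat.card A + 1 := by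
  refine and_congr_right fun h => ?_
  have := h.card_add_finrank
  rw [← Submodule.finrank_eq_zero (R := ℤ)]
  omega

lemma isPseudotree_iff {Q : FinQuiver V A} :
    Q.IsPseudotree ↔ Q.Connected ∧ Nat.card A ≤ Nat.card V := by
  refine and_congr_right fun h => ?_
  have := h.card_add_finrank
  rw [← Module.finrank_eq_rank]
  norm_cast
  omega

/-- In a one-dimensional complex `H₁` is the group of cycles, with nothing to divide out, so
injectivity on arrows suffices and `f₀` may identify vertices. -/
lemma finrank_H1_le_of_injective {X Y : Type*} [Finite X] [Finite Y] (Q : FinQuiver V A)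
    (G : FinQuiver X Y) (f₀ : X → V) (f₁ : Y → A) (h₁ : Function.Injective f₁)
    (hs : ∀ y, Q.src (f₁ y) = f₀ (G.src y)) (ht : ∀ y, Q.tgt (f₁ y) = f₀ (G.tgt y)) :
    Module.finrank ℤ G.H1 ≤ Module.finrank ℤ Q.H1 := by
  have hcomm : Q.boundary ∘ₗ Finsupp.lmapDomain ℤ ℤ f₁ =
      Finsupp.lmapDomain ℤ ℤ f₀ ∘ₗ G.boundary := by
    ext y : 2
    simp only [LinearMap.comp_apply, Finsupp.lsingle_apply, boundary_single, map_sub,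
      Finsupp.lmapDomain_apply, Finsupp.mapDomain_single, hs, ht]
  have hmem : ∀ z ∈ G.H1, Finsupp.lmapDomain ℤ ℤ f₁ z ∈ Q.H1 := by
    intro z hz
    have := congrArg (fun φ => φ z) hcomm
    simp only [LinearMap.comp_apply] at this
    rw [H1, LinearMap.mem_ker, this, LinearMap.mem_ker.1 hz, map_zero]
  refine LinearMap.finrank_le_finrank_of_injective
    (f := (Finsupp.lmapDomain ℤ ℤ f₁).restrict hmem) ?_
  intro x y hxy
  exact Subtype.ext (Finsupp.mapDomain_injective h₁ (congrArg Subtype.val hxy))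

/-- The end of the arrow `a` on the side chosen by `s`: the source if `s a` is true. -/
def endpoint (Q : FinQuiver V A) (s : A → Bool) (a : A) : V :=
  if s a then Q.src a else Q.tgt a

/-- An orientation of a quiver with small first homology in which each vertex is the chosen end
of at most one arrow. -/
lemma exists_endpoint_injective (Q : FinQuiver V A) (Z : Finset V)
    (h : Z.card + Module.finrank ℤ Q.H1 ≤ 1) :
    ∃ s : A → Bool, Function.Injective (Q.endpoint s) ∧ ∀ a, Q.endpoint s a ∉ Z := by
  classical
  have : Fintype V := Fintype.ofFinite V
  have : Fintype A := Fintype.ofFinite A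
  -- The chosen ends are a system of distinct representatives for these sets, supplied by Hall's
  -- marriage theorem.
  let t : A → Finset V := fun a => {Q.src a, Q.tgt a} \ Z
  have hall : ∀ S : Finset A, S.card ≤ (S.biUnion t).card := by
    intro S
    rcases S.eq_empty_or_nonempty with rfl | ⟨a₀, ha₀⟩
    · simp
    -- Hall's condition: for the subgraph `G` spanned by `S`, `|S| + 1 ≤ |W| + rank H₁(G) ≤ |W| +
    -- rank H₁(Q)`, and removing `Z` costs at most `|Z|`, where `|Z| + rank H₁(Q) ≤ 1`.
    let W : Finset V := S.biUnion fun a => {Q.src a, Q.tgt a}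
    have hW : S.biUnion t = W \ Z := by
      ext x
      simp only [t, W, Finset.mem_biUnion, Finset.mem_sdiff]
      tauto
    have hsW : ∀ a : S, Q.src a ∈ W := fun a => Finset.mem_biUnion.2 ⟨a, a.2, by simp⟩
    have htW : ∀ a : S, Q.tgt a ∈ W := fun a => Finset.mem_biUnion.2 ⟨a, a.2, by simp⟩
    let G : FinQuiver W S := ⟨fun a => ⟨_, hsW a⟩, fun a => ⟨_, htW a⟩⟩
    have : Nonempty W := ⟨⟨_, hsW ⟨a₀, ha₀⟩⟩⟩
    have h1 := G.card_add_one_le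
    have h2 := Q.finrank_H1_le_of_injective G Subtype.val Subtype.val Subtype.val_injective
      (fun _ => rfl) (fun _ => rfl)
    rw [hW]
    have h3 := Finset.le_card_sdiff Z W
    simp only [Nat.card_eq_fintype_card, Fintype.card_coe] at h1
    omega
  obtain ⟨f, hf, hft⟩ := (Finset.all_card_le_biUnion_card_iff_exists_injective t).1 hall
  have hend : ∀ a, Q.endpoint (fun a => decide (f a = Q.src a)) a = f a := by
    intro a
    have := hft a
    simp only [t, Finset.mem_sdiff, Finset.mem_insert, Finset.mem_singleton] at this
    simp only [endpoint, decide_eq_true_eq]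
    split_ifs with h'
    · exact h'.symm
    · exact (this.1.resolve_left h').symm
  refine ⟨fun a => decide (f a = Q.src a), fun a b hab => ?_, fun a => ?_⟩
  · rw [hend, hend] at hab
    exact hf hab
  · rw [hend]
    exact (Finset.mem_sdiff.1 (hft a)).2

end Rank

end FinQuiver

/-! ### Connectedness through invariant sets of vertices. -/

namespace FinQuiver

lemma connected_iff {V : Type*} {A : Type*} {Q : FinQuiver V A} :
    Q.Connected ↔ Nonempty V ∧ ∀ S : Set V, S.Nonempty →
      (∀ a, Q.src a ∈ S ↔ Q.tgt a ∈ S) → ∀ x, x ∈ S := by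
  refine and_congr_right fun _ => ⟨fun h S ⟨x, hx⟩ hS y => ?_, fun h x y => ?_⟩
  · have key : ∀ x y, Relation.EqvGen (fun s t => ∃ a, Q.src a = s ∧ Q.tgt a = t) x y →
        (x ∈ S ↔ y ∈ S) := by
      intro x y hxy
      induction hxy with
      | rel x y h => obtain ⟨a, rfl, rfl⟩ := h; exact hS a
      | refl x => rfl
      | symm x y _ ih => exact ih.symm
      | trans x y z _ _ h1 h2 => exact h1.trans h2
    exact (key x y (h x y)).1 hx
  · refine h {y | Relation.EqvGen (fun s t => ∃ a, Q.src a = s ∧ Q.tgt a = t) x y}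
      ⟨x, .refl x⟩ (fun a => ?_) y
    exact ⟨fun h => h.trans _ _ _ (.rel _ _ ⟨a, rfl, rfl⟩),
      fun h => h.trans _ _ _ (.symm _ _ (.rel _ _ ⟨a, rfl, rfl⟩))⟩

end FinQuiver

/-! ### Windings -/

/-- A winding of a quiver `Q`: a quiver with vertex set `X` whose vertices and arrows are coloured
by those of `Q`, such that every vertex is the source, and the target, of at most one arrow of each
colour. -/
structure Winding {V : Type u} {A : Type v} (Q : FinQuiver V A) (X : Type*) where
  color : X → V
  Edge : A → X → X → Prop
  color_src : ∀ {a x y}, Edge a x y → color x = Q.src a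
  color_tgt : ∀ {a x y}, Edge a x y → color y = Q.tgt a
  eq_right : ∀ {a x y y'}, Edge a x y → Edge a x y' → y = y'
  eq_left : ∀ {a x x' y}, Edge a x y → Edge a x' y → x = x'

namespace Winding

variable {V : Type u} {A : Type v} {Q : FinQuiver V A} {X Y Z : Type*}

/-- The arrows of a winding. -/
def Arrow (W : Winding Q X) : Type _ := {t : A × X × X // W.Edge t.1 t.2.1 t.2.2}

instance (W : Winding Q X) [Finite X] [Finite A] : Finite W.Arrow :=
  inferInstanceAs (Finite {t : A × X × X // W.Edge t.1 t.2.1 t.2.2})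

/-- The quiver of a winding. -/
def quiver (W : Winding Q X) : FinQuiver X W.Arrow := ⟨fun b => b.1.2.1, fun b => b.1.2.2⟩

def arrowColor (W : Winding Q X) (b : W.Arrow) : A := b.1.1

def mkArrow (W : Winding Q X) {a : A} {x y : X} (h : W.Edge a x y) : W.Arrow := ⟨(a, x, y), h⟩

@[simp] lemma src_mkArrow (W : Winding Q X) {a : A} {x y : X} (h : W.Edge a x y) :
    W.quiver.src (W.mkArrow h) = x := rfl
@[simp] lemma tgt_mkArrow (W : Winding Q X) {a : A} {x y : X} (h : W.Edge a x y) :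
    W.quiver.tgt (W.mkArrow h) = y := rfl
lemma Arrow.edge {W : Winding Q X} (b : W.Arrow) :
    W.Edge (W.arrowColor b) (W.quiver.src b) (W.quiver.tgt b) := b.2

lemma Arrow.ext {W : Winding Q X} {b b' : W.Arrow} (h : W.arrowColor b = W.arrowColor b')
    (hs : W.quiver.src b = W.quiver.src b') (ht : W.quiver.tgt b = W.quiver.tgt b') : b = b' :=
  Subtype.ext (Prod.ext h (Prod.ext hs ht))

def IsConnected (W : Winding Q X) : Prop := W.quiver.Connected

/-- For finite `X` and `A` this agrees with vanishing of `H₁`, by `FinQuiver.isTree_iff`; the count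
is the form that adds up over a cut. -/
def IsTree (W : Winding Q X) : Prop := W.IsConnected ∧ Nat.card X = Nat.card W.Arrow + 1

/-- There are no walks of length `n` along the arrows. -/
def IsNilpotent (W : Winding Q X) : Prop :=
  ∃ n : ℕ, ∀ x : ℕ → X, ¬ ∀ i < n, ∃ a, W.Edge a (x i) (x (i + 1))

/-- Successor-closed sets of vertices. -/
def IsClosed (W : Winding Q X) (S : Set X) : Prop := ∀ a x y, W.Edge a x y → x ∈ S → y ∈ S

/-- The full subwinding on a set of vertices. -/
def restrict (W : Winding Q X) (S : Set X) : Winding Q S where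
  color x := W.color x
  Edge a x y := W.Edge a x y
  color_src h := W.color_src h
  color_tgt h := W.color_tgt h
  eq_right h h' := Subtype.ext (W.eq_right h h')
  eq_left h h' := Subtype.ext (W.eq_left h h')

lemma isConnected_iff {W : Winding Q X} :
    W.IsConnected ↔ Nonempty X ∧ ∀ S : Set X, S.Nonempty →
      (∀ a x y, W.Edge a x y → (x ∈ S ↔ y ∈ S)) → ∀ x, x ∈ S := by
  rw [IsConnected, FinQuiver.connected_iff]
  refine and_congr_right fun _ => forall_congr' fun S => imp_congr_right fun _ => ?_
  refine imp_congr_left ⟨fun h a x y hxy => h ⟨(a, x, y), hxy⟩, fun h b => h _ _ _ b.2⟩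

/-- Isomorphism of windings. -/
def Equivalent (W : Winding Q X) (W' : Winding Q Y) : Prop :=
  ∃ e : X ≃ Y, (∀ x, W'.color (e x) = W.color x) ∧
    ∀ a x y, W'.Edge a (e x) (e y) ↔ W.Edge a x y

namespace Equivalent

variable {W : Winding Q X} {W' : Winding Q Y} {W'' : Winding Q Z}

lemma refl (W : Winding Q X) : W.Equivalent W := ⟨Equiv.refl _, fun _ => rfl, fun _ _ _ => Iff.rfl⟩

lemma symm : W.Equivalent W' → W'.Equivalent W := by
  rintro ⟨e, hc, he⟩
  exact ⟨e.symm, fun x => by rw [← hc, e.apply_symm_apply],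
    fun a x y => by rw [← he, e.apply_symm_apply, e.apply_symm_apply]⟩

lemma trans : W.Equivalent W' → W'.Equivalent W'' → W.Equivalent W'' := by
  rintro ⟨e, hc, he⟩ ⟨e', hc', he'⟩
  exact ⟨e.trans e', fun x => by simp [hc, hc'], fun a x y => by simp [he, he']⟩

/-- The bijection on arrows. -/
lemma exists_arrow_equiv (e : X ≃ Y) (he : ∀ a x y, W'.Edge a (e x) (e y) ↔ W.Edge a x y) :
    ∃ e₁ : W.Arrow ≃ W'.Arrow, ∀ b, W'.arrowColor (e₁ b) = W.arrowColor b ∧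
      W'.quiver.src (e₁ b) = e (W.quiver.src b) ∧ W'.quiver.tgt (e₁ b) = e (W.quiver.tgt b) :=
  ⟨((Equiv.refl A).prodCongr (e.prodCongr e)).subtypeEquiv (fun t => (he _ _ _).symm),
    fun b => ⟨rfl, rfl, rfl⟩⟩

lemma isConnected (h : W.Equivalent W') (hW : W.IsConnected) : W'.IsConnected := by
  obtain ⟨e, -, he⟩ := h
  rw [isConnected_iff] at *
  refine ⟨hW.1.map e, fun S ⟨y, hy⟩ hS z => ?_⟩
  have := hW.2 (e ⁻¹' S) ⟨e.symm y, by simpa using hy⟩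
    (fun a x y hxy => hS a _ _ ((he a x y).2 hxy)) (e.symm z)
  simpa using this

lemma card_colored (h : W.Equivalent W') (P : A → Prop) :
    Nat.card {b : W.Arrow // P (W.arrowColor b)} =
      Nat.card {b : W'.Arrow // P (W'.arrowColor b)} := by
  obtain ⟨e, -, he⟩ := h
  obtain ⟨e₁, he₁⟩ := exists_arrow_equiv e he
  exact Nat.card_congr (e₁.subtypeEquiv fun b => by rw [(he₁ b).1])

lemma card_arrow (h : W.Equivalent W') : Nat.card W.Arrow = Nat.card W'.Arrow := by
  obtain ⟨e, -, he⟩ := h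
  obtain ⟨e₁, he₁⟩ := exists_arrow_equiv e he
  exact Nat.card_congr e₁

lemma card_vertex (h : W.Equivalent W') : Nat.card X = Nat.card Y := by
  obtain ⟨e, -, he⟩ := h
  exact Nat.card_congr e

lemma isTree (h : W.Equivalent W') (hW : W.IsTree) : W'.IsTree :=
  ⟨h.isConnected hW.1, by rw [← h.card_vertex, ← h.card_arrow, hW.2]⟩

lemma restrict {e : X ≃ Y} (hc : ∀ x, W'.color (e x) = W.color x)
    (he : ∀ a x y, W'.Edge a (e x) (e y) ↔ W.Edge a x y) (S : Set X) (S' : Set Y)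
    (hS : ∀ x, x ∈ S ↔ e x ∈ S') : (W.restrict S).Equivalent (W'.restrict S') :=
  ⟨e.subtypeEquiv hS, fun x => hc x, fun a x y => he a x y⟩

end Equivalent

/-- Windings whose quiver is a tree have no oriented cycles. -/
lemma IsTree.isNilpotent [Finite X] [Finite A] {W : Winding Q X} (h : W.IsTree) :
    W.IsNilpotent := by
  have hH : W.quiver.H1 = ⊥ := (FinQuiver.isTree_iff.2 h).2
  -- A walk of this length visits `Nat.card X + 1` positions, so it repeats a vertex.
  refine ⟨Nat.card X, fun x hx => ?_⟩
  obtain ⟨i, j, hij, hxij⟩ : ∃ i j : Fin (Nat.card X + 1), i < j ∧ x i = x j := by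
    have : ¬ Function.Injective (fun i : Fin (Nat.card X + 1) => x i) := fun hinj => by
      have := Nat.card_le_card_of_injective _ hinj
      simp at this
    simp only [Function.Injective, not_forall] at this
    obtain ⟨i, j, hx, hne⟩ := this
    rcases lt_or_gt_of_ne hne with h | h
    · exact ⟨i, j, h, hx⟩
    · exact ⟨j, i, h, hx.symm⟩
  have hij' : (i : ℕ) < j := hij
  have hj : (j : ℕ) < Nat.card X + 1 := j.2
  -- The chain `z k` is the `k`-th arrow of the walk. The sum over the closed stretch is a cycle,
  -- hence zero, but its coefficients add up to `j - i > 0`.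
  have hex : ∀ k : ℕ, ∃ z : W.Arrow →₀ ℤ, k < j →
      W.quiver.boundary z = Finsupp.single (x (k + 1)) 1 - Finsupp.single (x k) 1 ∧
      FinQuiver.augmentation _ z = 1 := by
    intro k
    by_cases hk : k < j
    · obtain ⟨a, ha⟩ := hx k (by omega)
      refine ⟨Finsupp.single (W.mkArrow ha) 1, fun _ => ⟨?_, by simp⟩⟩
      rw [FinQuiver.boundary_single, W.tgt_mkArrow, W.src_mkArrow]
    · exact ⟨0, fun h => absurd h hk⟩
  choose z hz using hex
  have h0 : ∑ k ∈ Finset.Ico (i : ℕ) j, z k ∈ W.quiver.H1 := by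
    rw [FinQuiver.H1, LinearMap.mem_ker, map_sum,
      Finset.sum_congr rfl (fun k hk => (hz k (Finset.mem_Ico.1 hk).2).1),
      Finset.sum_Ico_eq_sub _ hij'.le, Finset.sum_range_sub (fun k => Finsupp.single (x k) (1 : ℤ)),
      Finset.sum_range_sub (fun k => Finsupp.single (x k) (1 : ℤ)), hxij]
    simp
  rw [hH, Submodule.mem_bot] at h0
  have h1 := congrArg (FinQuiver.augmentation _) h0
  rw [map_sum, Finset.sum_congr rfl (fun k hk => (hz k (Finset.mem_Ico.1 hk).2).2)] at h1
  simp at h1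
  omega

end Winding

/-! ### Representations and windings -/

namespace Rep

variable {V : Type u} {A : Type v} {Q : FinQuiver V A}

lemma ne_zero_of_map_ne_zero {M : Rep Q} {a : A} {m : M.obj (Q.src a)} (h : M.map a m ≠ 0) :
    m ≠ 0 := fun h0 => h (h0 ▸ M.map_zero a)

instance (M : Rep Q) [Finite V] : Finite M.Vert :=
  inferInstanceAs (Finite (Σ x : V, {m : M.obj x // m ≠ 0}))

instance (M : Rep Q) [Finite A] : Finite M.Arr :=
  inferInstanceAs (Finite (Σ a : A, {m : M.obj (Q.src a) // M.map a m ≠ 0}))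

/-- A nonzero element, as a vertex of the coefficient quiver. -/
def vert (M : Rep Q) (x : V) (m : M.obj x) (h : m ≠ 0) : M.Vert := ⟨x, m, h⟩

lemma vert_inj {M : Rep Q} {x : V} {m m' : M.obj x} {h : m ≠ 0} {h' : m' ≠ 0} :
    M.vert x m h = M.vert x m' h' ↔ m = m' := by
  constructor
  · intro he
    have he' : (⟨x, m, h⟩ : Σ x : V, {m : M.obj x // m ≠ 0}) = ⟨x, m', h'⟩ := he
    simpa using he'
  · rintro rfl
    rfl

lemma exists_vert (M : Rep Q) (p : M.Vert) : ∃ x m h, p = M.vert x m h := ⟨p.1, p.2.1, p.2.2, rfl⟩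

lemma exists_vert_of_color {M : Rep Q} {p : M.Vert} {x : V} (hx : M.vertColor p = x) :
    ∃ m h, p = M.vert x m h := by
  subst hx
  exact ⟨p.2.1, p.2.2, rfl⟩

/-- The coefficient quiver, as a winding. -/
def winding (M : Rep Q) : Winding Q M.Vert where
  color := M.vertColor
  Edge a p q := ∃ (m : M.obj (Q.src a)) (h : M.map a m ≠ 0),
    p = M.vert _ m (ne_zero_of_map_ne_zero h) ∧ q = M.vert _ (M.map a m) h
  color_src := by rintro a _ _ ⟨m, h, rfl, rfl⟩; rfl
  color_tgt := by rintro a _ _ ⟨m, h, rfl, rfl⟩; rfl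
  eq_right := by
    rintro a _ _ _ ⟨m, h, rfl, rfl⟩ ⟨m', h', he, rfl⟩
    rw [vert_inj] at he ⊢
    rw [he]
  eq_left := by
    rintro a _ _ _ ⟨m, h, rfl, rfl⟩ ⟨m', h', rfl, he⟩
    rw [vert_inj] at he ⊢
    exact (M.isLinear a).2 h h' he

lemma edge_of_map_ne_zero (M : Rep Q) {a : A} {m : M.obj (Q.src a)} (h : M.map a m ≠ 0) :
    M.winding.Edge a (M.vert _ m (ne_zero_of_map_ne_zero h)) (M.vert _ (M.map a m) h) :=
  ⟨m, h, rfl, rfl⟩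

lemma edge_iff (M : Rep Q) {a : A} {m : M.obj (Q.src a)} {hm : m ≠ 0} {n : M.obj (Q.tgt a)}
    {hn : n ≠ 0} : M.winding.Edge a (M.vert _ m hm) (M.vert _ n hn) ↔ M.map a m = n := by
  constructor
  · rintro ⟨m', h', he, he'⟩
    rw [vert_inj] at he he'
    rw [he, he']
  · rintro rfl
    exact M.edge_of_map_ne_zero hn

lemma exists_arr_equiv (M : Rep Q) : ∃ e : M.Arr ≃ M.winding.Arrow,
    ∀ b, M.winding.arrowColor (e b) = M.arrColor b ∧
      M.winding.quiver.src (e b) = M.coeffQuiver.src b ∧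
      M.winding.quiver.tgt (e b) = M.coeffQuiver.tgt b := by
  refine ⟨Equiv.ofBijective
    (fun b => M.winding.mkArrow (M.edge_of_map_ne_zero b.2.2)) ⟨?_, ?_⟩, fun b => ⟨rfl, rfl, rfl⟩⟩
  · rintro ⟨a, m, h⟩ ⟨a', m', h'⟩ he
    have h1 : a = a' := congrArg M.winding.arrowColor he
    subst h1
    have h2 : M.vert _ m (ne_zero_of_map_ne_zero h) = M.vert _ m' (ne_zero_of_map_ne_zero h') :=
      congrArg M.winding.quiver.src he
    rw [vert_inj] at h2
    subst h2
    rfl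
  · rintro ⟨⟨a, p, q⟩, hpq⟩
    obtain ⟨m, h, h1, h2⟩ := id hpq
    dsimp only at m h h1 h2
    exact ⟨⟨a, m, h⟩, Winding.Arrow.ext rfl h1.symm h2.symm⟩

lemma coeffQuiver_connected_iff (M : Rep Q) : M.coeffQuiver.Connected ↔ M.winding.IsConnected := by
  obtain ⟨e, he⟩ := M.exists_arr_equiv
  rw [Winding.IsConnected, FinQuiver.connected_iff, FinQuiver.connected_iff]
  refine and_congr_right fun _ => forall_congr' fun S => imp_congr_right fun _ =>
    imp_congr_left ?_
  rw [← e.forall_congr_right]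
  exact forall_congr' fun b => by rw [(he b).2.1, (he b).2.2]

lemma card_arr_colored (M : Rep Q) (P : A → Prop) :
    Nat.card {b : M.Arr // P (M.arrColor b)} =
      Nat.card {b : M.winding.Arrow // P (M.winding.arrowColor b)} := by
  obtain ⟨e, he⟩ := M.exists_arr_equiv
  exact Nat.card_congr (e.subtypeEquiv fun b => by rw [(he b).1])

lemma card_arr (M : Rep Q) : Nat.card M.Arr = Nat.card M.winding.Arrow := by
  obtain ⟨e, he⟩ := M.exists_arr_equiv
  exact Nat.card_congr e

lemma coeffQuiver_isTree_iff [Finite V] [Finite A] (M : Rep Q) :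
    M.coeffQuiver.IsTree ↔ M.winding.IsTree := by
  rw [FinQuiver.isTree_iff, Winding.IsTree, coeffQuiver_connected_iff, card_arr]

lemma coeffQuiver_isPseudotree_iff [Finite V] [Finite A] (M : Rep Q) :
    M.coeffQuiver.IsPseudotree ↔
      M.winding.IsConnected ∧ Nat.card M.winding.Arrow ≤ Nat.card M.Vert := by
  rw [FinQuiver.isPseudotree_iff, coeffQuiver_connected_iff, card_arr]

/-- A path of `Q` together with an element that it does not kill is the same as a walk in the
coefficient quiver. -/
lemma isNilpotent_iff (M : Rep Q) : M.IsNilpotent ↔ M.winding.IsNilpotent := by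
  constructor
  · rintro ⟨n, hn⟩
    refine ⟨n, fun p hp => ?_⟩
    obtain ⟨x, m, hm, h0⟩ := M.exists_vert (p 0)
    have key : ∀ k ≤ n, ∃ (y : V) (w : Q.Path x y) (h : M.pathMap w m ≠ 0),
        w.length = k ∧ p k = M.vert y (M.pathMap w m) h := by
      intro k hk
      induction k with
      | zero => exact ⟨_, .nil, hm, rfl, h0⟩
      | succ k ih =>
        obtain ⟨y, w, h, hw, hpk⟩ := ih (by omega)
        obtain ⟨a, m', hm', h1, h2⟩ := hp k (by omega)
        rw [hpk] at h1
        have hy : y = Q.src a := congrArg M.vertColor h1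
        subst hy
        rw [vert_inj] at h1
        subst h1
        exact ⟨_, .cons a w, hm', by simp [FinQuiver.Path.length, hw], h2⟩
    obtain ⟨y, w, h, hw, -⟩ := key n le_rfl
    exact h (hn _ _ w hw.ge _)
  · rintro ⟨n, hn⟩
    have key : ∀ {x y : V} (w : Q.Path x y) (m : M.obj x) (h : M.pathMap w m ≠ 0),
        ∃ p : ℕ → M.Vert, p w.length = M.vert y (M.pathMap w m) h ∧
          ∀ i < w.length, ∃ a, M.winding.Edge a (p i) (p (i + 1)) := by
      intro x y w m h
      induction w with
      | nil =>
        refine ⟨fun _ => M.vert x m h, rfl, fun i hi => ?_⟩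
        simp [FinQuiver.Path.length] at hi
      | cons a w ih =>
        have h' : M.pathMap w m ≠ 0 := ne_zero_of_map_ne_zero h
        obtain ⟨p, hp, hp'⟩ := ih h'
        -- The old walk, continued by the new vertex; of the constant tail only the value at
        -- `w.length + 1` matters.
        refine ⟨fun i => if i ≤ w.length then p i else M.vert (Q.tgt a) _ h, ?_, fun i hi => ?_⟩
        · exact if_neg (by simp only [FinQuiver.Path.length]; omega)
        · simp only [FinQuiver.Path.length] at hi
          rcases Nat.lt_or_ge i w.length with hlt | hge
          · dsimp only
            rw [if_pos hlt.le, if_pos (by omega)]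
            exact hp' i hlt
          · obtain rfl : i = w.length := by omega
            dsimp only
            rw [if_pos le_rfl, if_neg (by omega), hp]
            exact ⟨a, M.edge_of_map_ne_zero (m := M.pathMap w m) h⟩
    refine ⟨n, fun x y w hw m => ?_⟩
    by_contra h
    obtain ⟨p, -, hp⟩ := key w m h
    exact hn p fun i hi => hp i (by omega)

lemma Iso.winding {M N : Rep Q} (h : Iso M N) : M.winding.Equivalent N.winding := by
  obtain ⟨e, h0, he⟩ := h
  have hne : ∀ x (m : M.obj x), m ≠ 0 ↔ e x m ≠ 0 := fun x m => by
    rw [not_iff_not, ← h0 x, (e x).apply_eq_iff_eq]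
  let F : M.Vert ≃ N.Vert := Equiv.sigmaCongrRight fun x => (e x).subtypeEquiv (hne x)
  have hF : ∀ x m h, F (M.vert x m h) = N.vert x (e x m) ((hne x m).1 h) := fun _ _ _ => rfl
  refine ⟨F, fun _ => rfl, fun a p q => ?_⟩
  by_cases hx : M.vertColor p = Q.src a
  · by_cases hy : M.vertColor q = Q.tgt a
    · obtain ⟨m, hm, rfl⟩ := exists_vert_of_color hx
      obtain ⟨n, hn, rfl⟩ := exists_vert_of_color hy
      rw [hF, hF, edge_iff, edge_iff, ← he, (e _).apply_eq_iff_eq]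
    · exact ⟨fun h => absurd (N.winding.color_tgt h) hy, fun h => absurd (M.winding.color_tgt h) hy⟩
  · exact ⟨fun h => absurd (N.winding.color_src h) hx, fun h => absurd (M.winding.color_src h) hx⟩

lemma iso_of_winding {M N : Rep Q} (h : M.winding.Equivalent N.winding) : Iso M N := by
  classical
  obtain ⟨e, hc, he⟩ := h
  have hex : ∀ x (m : M.obj x), ∃ n : N.obj x, (m = 0 → n = 0) ∧
      ∀ hm : m ≠ 0, ∃ hn : n ≠ 0, e (M.vert x m hm) = N.vert x n hn := by
    intro x m
    by_cases hm : m = 0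
    · exact ⟨0, fun _ => rfl, fun h => absurd hm h⟩
    · obtain ⟨n, hn, h⟩ := exists_vert_of_color (hc (M.vert x m hm))
      exact ⟨n, fun h => absurd h hm, fun _ => ⟨hn, h⟩⟩
  choose f hf0 hf using hex
  have hbij : ∀ x, Function.Bijective (f x) := by
    intro x
    constructor
    · intro m m' hmm
      by_cases hm : m = 0 <;> by_cases hm' : m' = 0
      · rw [hm, hm']
      · obtain ⟨hn, -⟩ := hf x m' hm'
        exact absurd (hmm ▸ hf0 x m hm) hn
      · obtain ⟨hn, -⟩ := hf x m hm
        exact absurd (hmm.trans (hf0 x m' hm')) hn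
      · obtain ⟨hn, h1⟩ := hf x m hm
        obtain ⟨hn', h2⟩ := hf x m' hm'
        have : e (M.vert x m hm) = e (M.vert x m' hm') := by
          rw [h1, h2, vert_inj, hmm]
        exact vert_inj.1 (e.injective this)
    · intro n
      by_cases hn : n = 0
      · exact ⟨0, (hf0 x 0 rfl).trans hn.symm⟩
      · obtain ⟨p, hp⟩ := e.surjective (N.vert x n hn)
        obtain ⟨m, hm, rfl⟩ : ∃ m h, p = M.vert x m h :=
          exists_vert_of_color ((hc p).symm.trans (congrArg N.vertColor hp))
        obtain ⟨hn', h1⟩ := hf x m hm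
        rw [hp, vert_inj] at h1
        exact ⟨m, h1.symm⟩
  refine ⟨fun x => Equiv.ofBijective (f x) (hbij x), fun x => hf0 x 0 rfl, fun a m => ?_⟩
  change f _ (M.map a m) = N.map a (f _ m)
  by_cases hm : m = 0
  · subst hm
    rw [M.map_zero, hf0 _ _ rfl, hf0 _ _ rfl, N.map_zero]
  obtain ⟨hn, h1⟩ := hf _ m hm
  by_cases hM : M.map a m = 0
  -- If `N` did not kill the image, its arrow would pull back along `e` to an arrow of `M` that
  -- starts at `m`.
  · rw [hf0 _ _ hM]
    by_contra hN
    have hN' : N.map a (f _ m) ≠ 0 := fun h => hN h.symm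
    obtain ⟨p, hp⟩ := e.surjective (N.vert (Q.tgt a) _ hN')
    obtain ⟨m', hm', rfl⟩ : ∃ m h, p = M.vert (Q.tgt a) m h :=
      exists_vert_of_color ((hc p).symm.trans (congrArg N.vertColor hp))
    have h2 : N.winding.Edge a (e (M.vert _ m hm)) (e (M.vert _ m' hm')) := by
      rw [h1, hp]
      exact N.edge_of_map_ne_zero hN'
    rw [he, edge_iff] at h2
    exact hm' (h2.symm.trans hM)
  · have h2 := (he a _ _).2 (M.edge_of_map_ne_zero hM)
    obtain ⟨hn', h3⟩ := hf _ _ hM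
    rw [h3, h1, edge_iff] at h2
    exact h2.symm

lemma iso_iff {M N : Rep Q} : Iso M N ↔ M.winding.Equivalent N.winding :=
  ⟨Iso.winding, iso_of_winding⟩

/-- Edges need only be compared between vertices of the right colours; otherwise there is no edge on
either side. -/
lemma equivalent_of_edge_iff {M : Rep Q} {X : Type*} {W : Winding Q X} (e : M.Vert ≃ X)
    (hc : ∀ p, W.color (e p) = M.vertColor p)
    (he : ∀ a m hm n hn, W.Edge a (e (M.vert (Q.src a) m hm)) (e (M.vert (Q.tgt a) n hn)) ↔
      M.map a m = n) : M.winding.Equivalent W := by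
  refine ⟨e, hc, fun a p q => ?_⟩
  by_cases hx : M.vertColor p = Q.src a
  · by_cases hy : M.vertColor q = Q.tgt a
    · obtain ⟨m, hm, rfl⟩ := exists_vert_of_color hx
      obtain ⟨n, hn, rfl⟩ := exists_vert_of_color hy
      rw [he, edge_iff]
    · exact ⟨fun h => absurd ((hc q).symm.trans (W.color_tgt h)) hy,
        fun h => absurd (M.winding.color_tgt h) hy⟩
  · exact ⟨fun h => absurd ((hc p).symm.trans (W.color_src h)) hx,
      fun h => absurd (M.winding.color_src h) hx⟩

lemma isZero_iff (M : Rep Q) : M.IsZero ↔ IsEmpty M.Vert :=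
  ⟨fun h => ⟨fun p => p.2.2 (h _ _)⟩, fun h x m => by_contra fun hm => h.false ⟨x, m, hm⟩⟩

end Rep

/-! ### Every finite winding is a coefficient quiver. -/

namespace Winding

variable {V : Type u} {A : Type v} {Q : FinQuiver V A} {X : Type*} [Finite X]

/-- The vertices of a given colour, with a base point added, as a type in `Type`. -/
abbrev Fiber (W : Winding Q X) (v : V) : Type :=
  Option {i : Fin (Nat.card X) // W.color ((Finite.equivFin X).symm i) = v}

def ofFiber (W : Winding Q X) {v : V}
    (i : {i : Fin (Nat.card X) // W.color ((Finite.equivFin X).symm i) = v}) : X :=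
  (Finite.equivFin X).symm i.1

lemma ofFiber_injective (W : Winding Q X) (v : V) : Function.Injective (W.ofFiber (v := v)) :=
  fun _ _ h => Subtype.ext ((Finite.equivFin X).symm.injective h)

lemma color_ofFiber (W : Winding Q X) {v : V}
    (i : {i : Fin (Nat.card X) // W.color ((Finite.equivFin X).symm i) = v}) :
    W.color (W.ofFiber i) = v := i.2

lemma exists_ofFiber (W : Winding Q X) {v : V} {x : X} (h : W.color x = v) :
    ∃ i : {i : Fin (Nat.card X) // W.color ((Finite.equivFin X).symm i) = v}, W.ofFiber i = x :=
  ⟨⟨Finite.equivFin X x, by rw [Equiv.symm_apply_apply, h]⟩, Equiv.symm_apply_apply _ _⟩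

open Classical in
/-- The structure maps of the representation attached to a winding. -/
def fiberMap (W : Winding Q X) (a : A) (m : W.Fiber (Q.src a)) : W.Fiber (Q.tgt a) :=
  if h : ∃ i j, m = some i ∧ W.Edge a (W.ofFiber i) (W.ofFiber j) then
    some h.choose_spec.choose else none

lemma fiberMap_eq_some_iff (W : Winding Q X) {a : A} {m : W.Fiber (Q.src a)}
    {j : {i : Fin (Nat.card X) // W.color ((Finite.equivFin X).symm i) = Q.tgt a}} :
    W.fiberMap a m = some j ↔ ∃ i, m = some i ∧ W.Edge a (W.ofFiber i) (W.ofFiber j) := by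
  rw [fiberMap]
  split_ifs with h
  · have hs := h.choose_spec.choose_spec
    refine ⟨fun hj => ⟨_, hs.1, Option.some.inj hj ▸ hs.2⟩, ?_⟩
    rintro ⟨i, hi, hij⟩
    have h1 := Option.some.inj (hs.1.symm.trans hi)
    exact congrArg some (W.ofFiber_injective _ (W.eq_right hs.2 (h1 ▸ hij)))
  · refine ⟨fun hj => False.elim hj, ?_⟩
    rintro ⟨i, hi, hij⟩
    exact absurd ⟨i, j, hi, hij⟩ h

/-- The representation with a given coefficient quiver. -/
def toRep (W : Winding Q X) : Rep Q where
  obj := W.Fiber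
  zero v := ⟨none⟩
  map := W.fiberMap
  isLinear a := by
    refine ⟨?_, fun m hm n hn hmn => ?_⟩
    · refine Option.eq_none_iff_forall_ne_some.2 fun j hj => ?_
      obtain ⟨i, hi, -⟩ := W.fiberMap_eq_some_iff.1 hj
      cases hi
    · obtain ⟨j, hj⟩ := Option.ne_none_iff_exists'.1 hm
      obtain ⟨i, rfl, hi⟩ := W.fiberMap_eq_some_iff.1 hj
      obtain ⟨i', rfl, hi'⟩ := W.fiberMap_eq_some_iff.1 (hmn ▸ hj)
      exact congrArg some (W.ofFiber_injective _ (W.eq_left hi hi'))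

/-- This makes pieces of windings available as classes in the Hall algebra. -/
lemma equivalent_toRep (W : Winding Q X) : W.toRep.winding.Equivalent W := by
  have hsome : ∀ v (m : W.toRep.obj v), m ≠ 0 → ∃ i, m = (some i : W.Fiber v) := fun v m hm =>
    Option.ne_none_iff_exists'.1 hm
  choose g hg using hsome
  have hne : ∀ v i, @Ne (W.toRep.obj v) (some i : W.Fiber v) 0 := fun v i h =>
    Option.some_ne_none i h
  let F : W.toRep.Vert → X := fun p => W.ofFiber (g p.1 p.2.1 p.2.2)
  have hF : ∀ v i, F (W.toRep.vert v (some i : W.Fiber v) (hne v i)) = W.ofFiber i := fun v i =>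
    congrArg W.ofFiber (Option.some.inj (hg v _ (hne v i))).symm
  have hex : ∀ p : W.toRep.Vert, ∃ v i, p = W.toRep.vert v (some i : W.Fiber v) (hne v i) :=
    fun p => by
      obtain ⟨v, m, hm, rfl⟩ := Rep.exists_vert _ p
      exact ⟨v, g v m hm, Rep.vert_inj.2 (hg v m hm)⟩
  have hcol : ∀ p, W.color (F p) = W.toRep.vertColor p := fun p => by
    obtain ⟨v, i, rfl⟩ := hex p
    rw [hF]
    exact W.color_ofFiber i
  have hbij : Function.Bijective F := by
    constructor
    · intro p q hpq
      have hc := congrArg W.color hpq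
      rw [hcol, hcol] at hc
      obtain ⟨v, i, rfl⟩ := hex p
      obtain ⟨w, j, rfl⟩ := hex q
      obtain rfl : v = w := hc
      rw [hF, hF] at hpq
      exact Rep.vert_inj.2 (congrArg some (W.ofFiber_injective _ hpq))
    · intro x
      obtain ⟨i, hi⟩ := W.exists_ofFiber (rfl : W.color x = _)
      exact ⟨_, (hF _ i).trans hi⟩
  refine ⟨Equiv.ofBijective F hbij, hcol, fun a p q => ?_⟩
  change W.Edge a (F p) (F q) ↔ _
  by_cases hx : W.toRep.vertColor p = Q.src a
  · by_cases hy : W.toRep.vertColor q = Q.tgt a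
    · obtain ⟨v, i, rfl⟩ := hex p
      obtain ⟨w, j, rfl⟩ := hex q
      obtain rfl : v = _ := hx
      obtain rfl : w = _ := hy
      rw [hF, hF]
      refine Iff.trans ?_ (W.toRep.edge_iff.trans W.fiberMap_eq_some_iff).symm
      exact ⟨fun h => ⟨i, rfl, h⟩, fun ⟨i', h', h⟩ => Option.some.inj h' ▸ h⟩
    · exact ⟨fun h => absurd ((hcol q).symm.trans (W.color_tgt h)) hy,
        fun h => absurd (W.toRep.winding.color_tgt h) hy⟩
  · exact ⟨fun h => absurd ((hcol p).symm.trans (W.color_src h)) hx,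
      fun h => absurd (W.toRep.winding.color_src h) hx⟩

end Winding

/-! ### Subrepresentations as closed sets of vertices -/

namespace Rep

variable {V : Type u} {A : Type v} {Q : FinQuiver V A} {M : Rep Q}

namespace Sub

/-- The nonzero elements of a subrepresentation. -/
def vertSet (L : Sub M) : Set M.Vert := {p | p.2.1 ∈ L.carrier p.1}

lemma isClosed_vertSet (L : Sub M) : M.winding.IsClosed L.vertSet := by
  rintro a _ _ ⟨m, h, rfl, rfl⟩ hm
  exact L.map_mem a m hm

/-- The subrepresentation with a given set of nonzero elements. -/
def ofVertSet (S : Set M.Vert) (hS : M.winding.IsClosed S) : Sub M where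
  carrier x := {m | ∀ h : m ≠ 0, M.vert x m h ∈ S}
  zero_mem x h := absurd rfl h
  map_mem a m hm h := hS _ _ _ (M.edge_of_map_ne_zero h) (hm _)

/-- Subrepresentations are the successor-closed sets of vertices of the coefficient quiver. -/
def closedSetEquiv (M : Rep Q) : Sub M ≃ {S : Set M.Vert // M.winding.IsClosed S} where
  toFun L := ⟨L.vertSet, L.isClosed_vertSet⟩
  invFun S := ofVertSet S.1 S.2
  left_inv L := by
    ext x m
    refine ⟨fun h => ?_, fun h _ => h⟩
    by_cases hm : m = 0
    · rw [hm]; exact L.zero_mem x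
    · exact h hm
  right_inv S := by
    refine Subtype.ext (Set.ext fun p => ?_)
    exact ⟨fun h => h p.2.2, fun h _ => h⟩

lemma toRep_winding (L : Sub M) :
    L.toRep.winding.Equivalent (M.winding.restrict L.vertSet) := by
  let e : L.toRep.Vert ≃ L.vertSet :=
    { toFun := fun p => ⟨M.vert p.1 p.2.1.1 (fun h => p.2.2 (Subtype.ext h)), p.2.1.2⟩
      invFun := fun p => L.toRep.vert p.1.1 ⟨p.1.2.1, p.2⟩
        (fun h => p.1.2.2 (congrArg Subtype.val h))
      left_inv := fun _ => rfl
      right_inv := fun _ => rfl }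
  refine equivalent_of_edge_iff e (fun _ => rfl) fun a m hm n hn => ?_
  refine Iff.trans M.edge_iff ⟨fun h => Subtype.ext h, fun h => congrArg Subtype.val h⟩

lemma quot_winding (L : Sub M) :
    L.quot.winding.Equivalent (M.winding.restrict L.vertSetᶜ) := by
  let e : L.quot.Vert ≃ (L.vertSetᶜ : Set M.Vert) :=
    { toFun := fun p => ⟨M.vert p.1 p.2.1.1 (fun h => p.2.2 (Subtype.ext h)),
        p.2.1.2.resolve_left (fun h => p.2.2 (Subtype.ext h))⟩
      invFun := fun p => L.quot.vert p.1.1 ⟨p.1.2.1, Or.inr p.2⟩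
        (fun h => p.1.2.2 (congrArg Subtype.val h))
      left_inv := fun _ => rfl
      right_inv := fun _ => rfl }
  refine equivalent_of_edge_iff e (fun _ => rfl) fun a m hm n hn => ?_
  refine Iff.trans M.edge_iff ?_
  have hn' : n.1 ∉ L.carrier _ := n.2.resolve_left (fun h => hn (Subtype.ext h))
  constructor
  · intro h
    have h' : M.map a m.1 = n.1 := h
    exact Subtype.ext ((quot_map_of_not_mem L a m (fun h0 => hn' (h' ▸ h0))).trans h')
  · rintro rfl
    by_cases h : M.map a m.1 ∈ L.carrier _
    · exact absurd (Subtype.ext (quot_map_of_mem L a m h)) hn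
    · exact (quot_map_of_not_mem L a m h).symm

/-- A representation is the direct sum of complementary subrepresentations. -/
lemma iso_sum (L K : Sub M) (h1 : ∀ x m, m ∈ L.carrier x ∨ m ∈ K.carrier x)
    (h2 : ∀ x m, m ∈ L.carrier x → m ∈ K.carrier x → m = 0) :
    Iso M (L.toRep.sum K.toRep) := by
  classical
  let F : ∀ x, (L.toRep.sum K.toRep).obj x → M.obj x := fun x p =>
    if p.1.1.1 = 0 then p.1.2.1 else p.1.1.1
  have hF0 : ∀ x (p : (L.toRep.sum K.toRep).obj x), p.1.1.1 = 0 → F x p = p.1.2.1 :=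
    fun x p h => if_pos h
  have hF1 : ∀ x (p : (L.toRep.sum K.toRep).obj x), p.1.1.1 ≠ 0 → F x p = p.1.1.1 :=
    fun x p h => if_neg h
  have hor : ∀ x (p : (L.toRep.sum K.toRep).obj x), p.1.1.1 = 0 ∨ p.1.2.1 = 0 := fun x p =>
    p.2.imp (congrArg Subtype.val) (congrArg Subtype.val)
  have hbij : ∀ x, Function.Bijective (F x) := by
    intro x
    constructor
    · intro p q hpq
      by_cases hp : p.1.1.1 = 0 <;> by_cases hq : q.1.1.1 = 0
      · rw [hF0 _ _ hp, hF0 _ _ hq] at hpq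
        exact Subtype.ext (Prod.ext (Subtype.ext (hp.trans hq.symm)) (Subtype.ext hpq))
      · rw [hF0 _ _ hp, hF1 _ _ hq] at hpq
        exact absurd (h2 x _ q.1.1.2 (hpq ▸ p.1.2.2)) hq
      · rw [hF1 _ _ hp, hF0 _ _ hq] at hpq
        exact absurd (h2 x _ p.1.1.2 (hpq ▸ q.1.2.2)) hp
      · rw [hF1 _ _ hp, hF1 _ _ hq] at hpq
        exact Subtype.ext (Prod.ext (Subtype.ext hpq) (Subtype.ext
          (((hor x p).resolve_left hp).trans ((hor x q).resolve_left hq).symm)))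
    · intro m
      by_cases hm : m = 0
      · subst hm
        exact ⟨0, hF0 _ _ rfl⟩
      · rcases h1 x m with h | h
        · exact ⟨⟨(⟨m, h⟩, 0), Or.inr rfl⟩, hF1 _ _ hm⟩
        · exact ⟨⟨(0, ⟨m, h⟩), Or.inl rfl⟩, hF0 _ _ rfl⟩
  refine Iso.symm ⟨fun x => Equiv.ofBijective (F x) (hbij x), fun x => hF0 _ _ rfl, fun a p => ?_⟩
  change F _ _ = M.map a (F _ p)
  by_cases hp : p.1.1.1 = 0
  · have h3 : M.map a p.1.1.1 = 0 := by rw [hp, M.map_zero]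
    rw [hF0 _ _ hp]
    exact hF0 _ _ h3
  · rw [hF1 _ _ hp]
    by_cases h3 : M.map a p.1.1.1 = 0
    · rw [h3]
      refine (hF0 _ _ h3).trans ?_
      change M.map a p.1.2.1 = 0
      rw [(hor _ p).resolve_left hp, M.map_zero]
    · exact hF1 _ _ h3

end Sub

/-- A set of vertices that no arrow enters or leaves is closed, and so is its complement; the two
subrepresentations split `M`. -/
lemma isConnected_of_isIndecomposable (h : M.IsIndecomposable) : M.winding.IsConnected := by
  refine Winding.isConnected_iff.2 ⟨?_, fun S hne hS => ?_⟩
  · by_contra hcon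
    exact h.1 (M.isZero_iff.2 (not_nonempty_iff.1 hcon))
  have hS1 : M.winding.IsClosed S := fun a x y hxy hx => (hS a x y hxy).1 hx
  have hS2 : M.winding.IsClosed Sᶜ := fun a x y hxy hx hy => hx ((hS a x y hxy).2 hy)
  have hsum := Sub.iso_sum (Sub.ofVertSet S hS1) (Sub.ofVertSet Sᶜ hS2)
    (fun x m => by
      by_cases hm : m = 0
      · exact Or.inl fun h => absurd hm h
      · exact (em (M.vert x m hm ∈ S)).imp (fun h _ => h) (fun h _ => h))
    (fun x m h1 h2 => by
      by_contra hm
      exact h2 hm (h1 hm))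
  rcases h.2 _ _ hsum with h0 | h0
  · obtain ⟨p, hp⟩ := hne
    exact absurd (congrArg Subtype.val (h0 p.1 ⟨p.2.1, fun _ => hp⟩)) p.2.2
  · intro p
    by_contra hp
    exact absurd (congrArg Subtype.val (h0 p.1 ⟨p.2.1, fun _ => hp⟩)) p.2.2

lemma isIndecomposable_of_isConnected (h : M.winding.IsConnected) : M.IsIndecomposable := by
  refine ⟨fun h0 => ?_, fun N P hNP => ?_⟩
  · exact not_isEmpty_iff.2 (Winding.isConnected_iff.1 h).1 (M.isZero_iff.1 h0)
  have h' := Winding.isConnected_iff.1 (hNP.winding.isConnected h)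
  by_contra hcon
  rw [not_or] at hcon
  simp only [IsZero, not_forall] at hcon
  obtain ⟨⟨x, n, hn⟩, ⟨y, q, hq⟩⟩ := hcon
  -- The vertices from the summand `N`; no arrow joins them to those from `P`.
  let S : Set (N.sum P).Vert := {p | p.2.1.1.1 ≠ 0}
  have hx : (N.sum P).vert x ⟨(n, 0), Or.inr rfl⟩
      (fun h => hn (congrArg (fun p => p.1.1) h)) ∈ S := hn
  refine h'.2 S ⟨_, hx⟩ ?_ ((N.sum P).vert y ⟨(0, q), Or.inl rfl⟩
      (fun h => hq (congrArg (fun p => p.1.2) h))) rfl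
  rintro a _ _ ⟨m, h, rfl, rfl⟩
  change m.1.1 ≠ 0 ↔ N.map a m.1.1 ≠ 0
  refine ⟨fun hm h0 => ?_, ne_zero_of_map_ne_zero⟩
  have h1 : P.map a m.1.2 = 0 := by rw [m.2.resolve_left hm, P.map_zero]
  exact h (Subtype.ext (Prod.ext h0 h1))

lemma isIndecomposable_iff : M.IsIndecomposable ↔ M.winding.IsConnected :=
  ⟨isConnected_of_isIndecomposable, isIndecomposable_of_isConnected⟩

/-- Nilpotency and indecomposability are automatic once the coefficient quiver is a tree. -/
lemma isTreeRep_iff [Finite V] [Finite A] : M.IsTreeRep ↔ M.winding.IsTree := by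
  rw [IsTreeRep, coeffQuiver_isTree_iff, isNilpotent_iff, isIndecomposable_iff]
  exact ⟨fun h => h.2, fun h => ⟨⟨h.isNilpotent, h.1⟩, h⟩⟩

end Rep

/-! ### The product and the bracket in terms of windings -/

namespace Winding

variable {V : Type u} {A : Type v} {Q : FinQuiver V A} {X Y : Type*} [Finite X] [Finite Y]

lemma cls_toRep_eq_iff {W : Winding Q X} {M : Rep Q} :
    cls W.toRep = cls M ↔ W.Equivalent M.winding := by
  rw [cls_eq_iff, Rep.iso_iff]
  exact ⟨fun h => W.equivalent_toRep.symm.trans h, fun h => W.equivalent_toRep.trans h⟩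

lemma cls_toRep_congr {W : Winding Q X} {W' : Winding Q Y} (h : W.Equivalent W') :
    cls W.toRep = cls W'.toRep :=
  cls_toRep_eq_iff.2 (h.trans W'.equivalent_toRep.symm)

open Classical in
/-- The sign with which a cut of a winding into two parts contributes to a commutator. -/
def cutSign (W : Winding Q X) (S : Set X) : ℂ :=
  (if W.IsClosed S then 1 else 0) - (if W.IsClosed Sᶜ then 1 else 0)

end Winding

namespace Hall

variable {V : Type u} {A : Type v} {Q : FinQuiver V A} {X : Type*} [Finite V] [Finite A]
  [Finite X]

open Classical in
lemma mul_apply_winding [Fintype (Set X)] (f g : Hall Q) {M : Rep Q} {W : Winding Q X}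
    (h : M.winding.Equivalent W) :
    (f * g) (cls M) = ∑ S : Set X, if W.IsClosed S then
      f (cls (W.restrict Sᶜ).toRep) * g (cls (W.restrict S).toRep) else 0 := by
  obtain ⟨e, hc, he⟩ := h
  have hcl : ∀ S : Set M.Vert, M.winding.IsClosed S ↔ W.IsClosed (e.symm ⁻¹' S) := by
    intro S
    constructor
    · intro h a x y hxy hx
      refine h a _ _ ?_ hx
      rw [← he]
      simpa using hxy
    · intro h a x y hxy hx
      have := h a (e x) (e y) ((he a x y).2 hxy) (by simpa using hx)
      simpa using this
  let E : Rep.Sub M ≃ {S : Set X // W.IsClosed S} :=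
    (Rep.Sub.closedSetEquiv M).trans
      ((Equiv.Set.congr e).subtypeEquiv fun S => by
        rw [hcl S, Equiv.Set.congr_apply, Equiv.image_eq_preimage_symm])
  have hE : ∀ L, (E L).1 = e '' L.vertSet := fun L => rfl
  rw [mul_apply, ← Finset.sum_filter, ← Finset.sum_subtype_eq_sum_filter, Finset.subtype_univ]
  refine Fintype.sum_equiv E _ _ fun L => ?_
  congr 2
  · refine cls_eq_iff.2 (Rep.iso_iff.2 (Winding.Equivalent.trans ?_
      (Winding.equivalent_toRep _).symm))
    exact L.quot_winding.trans (Winding.Equivalent.restrict hc he _ _ fun p => by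
      rw [hE, Set.mem_compl_iff, Set.mem_compl_iff, e.injective.mem_set_image])
  · refine cls_eq_iff.2 (Rep.iso_iff.2 (Winding.Equivalent.trans ?_
      (Winding.equivalent_toRep _).symm))
    exact L.toRep_winding.trans (Winding.Equivalent.restrict hc he _ _ fun p => by
      rw [hE, e.injective.mem_set_image])

/-- Reindexing the product `g * f` by complements puts both products over the same cuts, so their
difference is carried by `cutSign`. -/
lemma lie_apply_winding [Fintype (Set X)] (f g : Hall Q) {M : Rep Q} {W : Winding Q X}
    (h : M.winding.Equivalent W) :
    ⁅f, g⁆ (cls M) = ∑ S : Set X, W.cutSign S *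
      (f (cls (W.restrict Sᶜ).toRep) * g (cls (W.restrict S).toRep)) := by
  classical
  rw [LieRing.of_associative_ring_bracket, sub_apply, mul_apply_winding f g h,
    mul_apply_winding g f h, ← Equiv.sum_comp (Equiv.mk compl compl compl_compl compl_compl)
    (fun S : Set X => if W.IsClosed S then
      g (cls (W.restrict Sᶜ).toRep) * f (cls (W.restrict S).toRep) else 0),
    ← Finset.sum_sub_distrib]
  refine Finset.sum_congr rfl fun S _ => ?_
  have hS : ∀ T, T = S → cls (W.restrict T).toRep = cls (W.restrict S).toRep := by
    rintro _ rfl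
    rfl
  simp only [Equiv.coe_fn_mk, hS _ (compl_compl S), Winding.cutSign]
  split_ifs <;> ring

end Hall

/-! ### Counting arrows of windings -/

namespace Winding

variable {V : Type u} {A : Type v} {Q : FinQuiver V A} {X : Type*}

/-- The lift to a winding of a choice of an end of each arrow. -/
def endpoint (W : Winding Q X) (s : A → Bool) (b : W.Arrow) : X :=
  if s (W.arrowColor b) then W.quiver.src b else W.quiver.tgt b

lemma color_endpoint (W : Winding Q X) (s : A → Bool) (b : W.Arrow) :
    W.color (W.endpoint s b) = Q.endpoint s (W.arrowColor b) := by
  rw [endpoint, FinQuiver.endpoint]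
  split_ifs
  · exact W.color_src b.edge
  · exact W.color_tgt b.edge

/-- The colour of the chosen end determines the colour of the arrow, and in a winding an arrow is
determined by its colour and one end on a known side. -/
lemma endpoint_injective (W : Winding Q X) {s : A → Bool}
    (hs : Function.Injective (Q.endpoint s)) : Function.Injective (W.endpoint s) := by
  intro b b' h
  have hc : W.arrowColor b = W.arrowColor b' := hs (by rw [← color_endpoint, h, color_endpoint])
  have hb := b.edge
  have hb' := b'.edge
  rw [endpoint, endpoint, hc] at h
  rw [hc] at hb
  split_ifs at h
  · exact Arrow.ext hc h (W.eq_right (h ▸ hb) hb')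
  · exact Arrow.ext hc (W.eq_left (h ▸ hb) hb') h

variable [Finite X]

/-- This bound makes every connected winding a pseudotree; equality means that every vertex is a
chosen end. -/
lemma card_arrow_le (W : Winding Q X) {s : A → Bool}
    (hs : Function.Injective (Q.endpoint s)) : Nat.card W.Arrow ≤ Nat.card X :=
  Nat.card_le_card_of_injective _ (W.endpoint_injective hs)

/-- The arrows with exactly one end in `S`. -/
def crossing (W : Winding Q X) (S : Set X) : Set W.Arrow :=
  {b | ¬(W.quiver.src b ∈ S ↔ W.quiver.tgt b ∈ S)}

lemma card_restrict_colored (W : Winding Q X) (S : Set X) (P : A → Prop) :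
    Nat.card {b : (W.restrict S).Arrow // P ((W.restrict S).arrowColor b)} =
      {b : W.Arrow | (W.quiver.src b ∈ S ∧ W.quiver.tgt b ∈ S) ∧ P (W.arrowColor b)}.ncard := by
  rw [← Nat.card_coe_set_eq]
  exact Nat.card_congr
    { toFun := fun b => ⟨W.mkArrow b.1.edge, ⟨b.1.1.2.1.2, b.1.1.2.2.2⟩, b.2⟩
      invFun := fun b => ⟨(W.restrict S).mkArrow (a := W.arrowColor b.1)
        (x := ⟨_, b.2.1.1⟩) (y := ⟨_, b.2.1.2⟩) b.1.edge, b.2.2⟩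
      left_inv := fun _ => rfl
      right_inv := fun _ => rfl }

lemma card_colored_eq [Finite A] (W : Winding Q X) (S : Set X) (P : A → Prop) :
    Nat.card {b : W.Arrow // P (W.arrowColor b)} =
      Nat.card {b : (W.restrict S).Arrow // P ((W.restrict S).arrowColor b)} +
      Nat.card {b : (W.restrict Sᶜ).Arrow // P ((W.restrict Sᶜ).arrowColor b)} +
      {b ∈ W.crossing S | P (W.arrowColor b)}.ncard := by
  rw [card_restrict_colored, card_restrict_colored, ← Set.ncard_union_eq, ← Set.ncard_union_eq]
  · change Nat.card ({b : W.Arrow | P (W.arrowColor b)} : Set W.Arrow) = _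
    rw [Nat.card_coe_set_eq]
    congr 1
    ext b
    simp only [crossing, Set.mem_union, Set.mem_ofPred_eq, Set.mem_compl_iff]
    tauto
  · rw [Set.disjoint_left]
    intro b
    simp only [crossing, Set.mem_union, Set.mem_ofPred_eq, Set.mem_compl_iff]
    tauto
  · rw [Set.disjoint_left]
    intro b
    simp only [Set.mem_ofPred_eq, Set.mem_compl_iff]
    tauto

lemma card_arrow_eq [Finite A] (W : Winding Q X) (S : Set X) :
    Nat.card W.Arrow = Nat.card (W.restrict S).Arrow + Nat.card (W.restrict Sᶜ).Arrow +
      (W.crossing S).ncard := by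
  have h := W.card_colored_eq S (fun _ => True)
  simp only [and_true, Set.ofPred_mem_eq] at h
  rwa [Nat.card_congr (Equiv.subtypeUnivEquiv fun _ => trivial),
    Nat.card_congr (Equiv.subtypeUnivEquiv fun _ => trivial),
    Nat.card_congr (Equiv.subtypeUnivEquiv fun _ => trivial)] at h

lemma card_vertex_eq (S : Set X) : Nat.card X = Nat.card S + Nat.card (Sᶜ : Set X) := by
  rw [Nat.card_coe_set_eq, Nat.card_coe_set_eq, Set.ncard_add_ncard_compl]

lemma IsConnected.card_le [Finite A] {W : Winding Q X} (h : W.IsConnected) :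
    Nat.card X ≤ Nat.card W.Arrow + 1 := FinQuiver.Connected.card_le h

lemma IsConnected.crossing_nonempty {W : Winding Q X} (h : W.IsConnected) {S : Set X}
    (hS : S.Nonempty) (hS' : Sᶜ.Nonempty) : (W.crossing S).Nonempty := by
  by_contra hcon
  obtain ⟨x, hx⟩ := hS'
  refine hx ((isConnected_iff.1 h).2 S hS (fun a x y hxy => ?_) x)
  by_contra hne
  exact hcon ⟨W.mkArrow hxy, hne⟩

/-- A cut of a tree into two connected parts. -/
lemma IsTree.cut [Finite A] {W : Winding Q X} (h : W.IsTree) {S : Set X}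
    (h1 : (W.restrict S).IsConnected) (h2 : (W.restrict Sᶜ).IsConnected) :
    (W.restrict S).IsTree ∧ (W.restrict Sᶜ).IsTree ∧ (W.crossing S).ncard = 1 := by
  -- Each part has at most one vertex more than arrows, and at least one arrow crosses; the count
  -- for the whole tree forces equality throughout.
  have c1 := h1.card_le
  have c2 := h2.card_le
  have c3 := W.card_arrow_eq S
  have c4 := card_vertex_eq S
  have c5 := h.2
  obtain ⟨x⟩ := h1.1
  obtain ⟨y⟩ := h2.1
  have c6 := (Set.ncard_pos (Set.toFinite _)).2 (h.1.crossing_nonempty ⟨x, x.2⟩ ⟨y, y.2⟩)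
  exact ⟨⟨h1, by omega⟩, ⟨h2, by omega⟩, by omega⟩

lemma isClosed_iff_arrow {W : Winding Q X} {S : Set X} :
    W.IsClosed S ↔ ∀ b : W.Arrow, W.quiver.src b ∈ S → W.quiver.tgt b ∈ S :=
  ⟨fun h b => h _ _ _ b.edge, fun h a x y hxy => h (W.mkArrow hxy)⟩

-- With a single crossing arrow exactly one side is closed, namely the one that it points to.
open Classical in
lemma cutSign_of_crossing_eq {W : Winding Q X} {S : Set X} {b : W.Arrow}
    (h : W.crossing S = {b}) : W.cutSign S = if W.quiver.tgt b ∈ S then 1 else -1 := by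
  have hb : ¬(W.quiver.src b ∈ S ↔ W.quiver.tgt b ∈ S) := h.ge rfl
  have huniq : ∀ b', b' ≠ b → (W.quiver.src b' ∈ S ↔ W.quiver.tgt b' ∈ S) := fun b' hne => by
    by_contra hcon
    exact hne (h.le hcon)
  have h1 : W.IsClosed S ↔ W.quiver.tgt b ∈ S := by
    rw [isClosed_iff_arrow]
    refine ⟨fun hc => by_contra fun ht => ht (hc b (by tauto)), fun ht b' hb' => ?_⟩
    by_cases hbb : b' = b
    · rwa [hbb]
    · exact (huniq b' hbb).1 hb'
  have h2 : W.IsClosed Sᶜ ↔ W.quiver.tgt b ∉ S := by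
    rw [isClosed_iff_arrow]
    refine ⟨fun hc ht => hc b (fun hs => hb ⟨fun _ => ht, fun _ => hs⟩) ht, fun ht b' hb' => ?_⟩
    by_cases hbb : b' = b
    · rwa [hbb]
    · exact fun ht' => hb' ((huniq b' hbb).2 ht')
  rw [cutSign]
  simp only [h1, h2]
  split_ifs <;> simp

end Winding

/-! ### Twists: reversing and renaming arrows -/

/-- An isomorphism of `R` with the quiver obtained from `Q` by reversing the arrows in `D`. -/
structure Twist {V W : Type u} {A B : Type v} (Q : FinQuiver V A) (R : FinQuiver W B) where
  vertexEquiv : V ≃ W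
  arrowEquiv : A ≃ B
  reversed : Set A
  src_eq : ∀ a, R.src (arrowEquiv a) = vertexEquiv ((Q.reverse reversed).src a)
  tgt_eq : ∀ a, R.tgt (arrowEquiv a) = vertexEquiv ((Q.reverse reversed).tgt a)

namespace Twist

variable {V W : Type u} {A B : Type v} {Q : FinQuiver V A} {R : FinQuiver W B}

def symm (t : Twist Q R) : Twist R Q where
  vertexEquiv := t.vertexEquiv.symm
  arrowEquiv := t.arrowEquiv.symm
  reversed := t.arrowEquiv.symm ⁻¹' t.reversed
  src_eq b := by
    obtain ⟨a, rfl⟩ := t.arrowEquiv.surjective b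
    have h1 := t.src_eq a
    have h2 := t.tgt_eq a
    simp only [FinQuiver.reverse, Set.mem_preimage, Equiv.symm_apply_apply] at *
    rw [Equiv.eq_symm_apply]
    split_ifs at * <;> simp_all
  tgt_eq b := by
    obtain ⟨a, rfl⟩ := t.arrowEquiv.surjective b
    have h1 := t.src_eq a
    have h2 := t.tgt_eq a
    simp only [FinQuiver.reverse, Set.mem_preimage, Equiv.symm_apply_apply] at *
    rw [Equiv.eq_symm_apply]
    split_ifs at * <;> simp_all

-- On reversed arrows the choice is negated, so the chosen end stays the same vertex of the
-- underlying graph.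
open Classical in
lemma exists_endpoint_injective (t : Twist Q R) {s : A → Bool}
    (hs : Function.Injective (Q.endpoint s)) :
    ∃ s' : B → Bool, Function.Injective (R.endpoint s') := by
  let s' : B → Bool := fun b =>
    if t.arrowEquiv.symm b ∈ t.reversed then !(s (t.arrowEquiv.symm b)) else s (t.arrowEquiv.symm b)
  have key : ∀ a, R.endpoint s' (t.arrowEquiv a) = t.vertexEquiv (Q.endpoint s a) := by
    intro a
    have h1 := t.src_eq a
    have h2 := t.tgt_eq a
    simp only [FinQuiver.endpoint, s', FinQuiver.reverse, Equiv.symm_apply_apply] at *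
    cases s a <;> split_ifs at * <;> simp_all
  refine ⟨s', fun b b' h => ?_⟩
  obtain ⟨a, rfl⟩ := t.arrowEquiv.surjective b
  obtain ⟨a', rfl⟩ := t.arrowEquiv.surjective b'
  rw [key, key] at h
  rw [hs (t.vertexEquiv.injective h)]

/-- The reversal of a set of arrows. -/
def ofReverse (Q : FinQuiver V A) (D : Set A) : Twist Q (Q.reverse D) where
  vertexEquiv := Equiv.refl V
  arrowEquiv := Equiv.refl A
  reversed := D
  src_eq _ := rfl
  tgt_eq _ := rfl

lemma nonempty_of_sameUnderlyingGraph (h : Q.SameUnderlyingGraph R) : Nonempty (Twist Q R) := by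
  classical
  obtain ⟨e₀, e₁, h⟩ := h
  -- Only arrows that must be reversed belong to `D`; loops never do.
  let D : Set A := {a | ¬(R.src (e₁ a) = e₀ (Q.src a) ∧ R.tgt (e₁ a) = e₀ (Q.tgt a))}
  refine ⟨⟨e₀, e₁, D, fun a => ?_, fun a => ?_⟩⟩
  · have := Sym2.eq_iff.1 (h a)
    simp only [FinQuiver.reverse]
    by_cases ha : a ∈ D
    · rw [if_pos ha]
      exact (this.resolve_left ha).1
    · rw [if_neg ha]
      exact (not_not.1 ha).1
  · have := Sym2.eq_iff.1 (h a)
    simp only [FinQuiver.reverse]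
    by_cases ha : a ∈ D
    · rw [if_pos ha]
      exact (this.resolve_left ha).2
    · rw [if_neg ha]
      exact (not_not.1 ha).2

end Twist

/-! ### Twisted windings and the sign of a tree. -/

namespace Winding

variable {V V' : Type u} {A A' : Type v} {Q : FinQuiver V A} {R : FinQuiver V' A'} {X Y : Type*}

open Classical in
/-- The winding of `R` obtained from a winding of `Q` by a twist. -/
def twist (W : Winding Q X) (t : Twist Q R) : Winding R X where
  color x := t.vertexEquiv (W.color x)
  Edge b x y := if t.arrowEquiv.symm b ∈ t.reversed then W.Edge (t.arrowEquiv.symm b) y x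
    else W.Edge (t.arrowEquiv.symm b) x y
  color_src {b x y} h := by
    have h1 := t.src_eq (t.arrowEquiv.symm b)
    rw [Equiv.apply_symm_apply] at h1
    rw [h1, FinQuiver.reverse]
    dsimp only
    split_ifs at *
    · rw [W.color_tgt h]
    · rw [W.color_src h]
  color_tgt {b x y} h := by
    have h1 := t.tgt_eq (t.arrowEquiv.symm b)
    rw [Equiv.apply_symm_apply] at h1
    rw [h1, FinQuiver.reverse]
    dsimp only
    split_ifs at *
    · rw [W.color_src h]
    · rw [W.color_tgt h]
  eq_right h h' := by
    split_ifs at *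
    · exact W.eq_left h h'
    · exact W.eq_right h h'
  eq_left h h' := by
    split_ifs at *
    · exact W.eq_right h h'
    · exact W.eq_left h h'

open Classical in
lemma twist_edge {W : Winding Q X} {t : Twist Q R} {a : A} {x y : X} :
    (W.twist t).Edge (t.arrowEquiv a) x y ↔
      if a ∈ t.reversed then W.Edge a y x else W.Edge a x y := by
  simp only [twist, Equiv.symm_apply_apply]

lemma restrict_twist (W : Winding Q X) (t : Twist Q R) (S : Set X) :
    (W.twist t).restrict S = (W.restrict S).twist t := rfl

lemma Equivalent.twist {W : Winding Q X} {W' : Winding Q Y} (h : W.Equivalent W')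
    (t : Twist Q R) : (W.twist t).Equivalent (W'.twist t) := by
  obtain ⟨e, hc, he⟩ := h
  refine ⟨e, fun x => congrArg t.vertexEquiv (hc x), fun a x y => ?_⟩
  obtain ⟨a, rfl⟩ := t.arrowEquiv.surjective a
  rw [twist_edge, twist_edge, he, he]

lemma twist_twist_symm (W : Winding Q X) (t : Twist Q R) :
    ((W.twist t).twist t.symm).Equivalent W := by
  refine ⟨Equiv.refl X, fun x => (t.vertexEquiv.symm_apply_apply _).symm, fun a x y => ?_⟩
  obtain ⟨b, rfl⟩ := t.symm.arrowEquiv.surjective a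
  obtain ⟨a, rfl⟩ := t.arrowEquiv.surjective b
  have ha : t.symm.arrowEquiv (t.arrowEquiv a) = a := t.arrowEquiv.symm_apply_apply a
  have hr : t.arrowEquiv a ∈ t.symm.reversed ↔ a ∈ t.reversed := by
    change t.arrowEquiv.symm _ ∈ t.reversed ↔ _
    rw [Equiv.symm_apply_apply]
  rw [twist_edge, twist_edge, twist_edge, hr, ha]
  split_ifs <;> rfl

/-- Since `t.symm.symm` is not definitionally `t`, this is obtained by inserting a twist by `t.symm`
followed by one by `t.symm.symm`. -/
lemma twist_symm_twist (W : Winding R X) (t : Twist Q R) :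
    ((W.twist t.symm).twist t).Equivalent W :=
  (twist_twist_symm _ t.symm).symm.trans
    ((((W.twist t.symm).twist_twist_symm t).twist t.symm.symm).trans (W.twist_twist_symm t.symm))

lemma exists_twist_arrow_equiv (W : Winding Q X) (t : Twist Q R) :
    ∃ e : W.Arrow ≃ (W.twist t).Arrow, ∀ b,
      (W.twist t).arrowColor (e b) = t.arrowEquiv (W.arrowColor b) ∧
      (W.twist t).quiver.src (e b) =
        (W.quiver.reverse (W.arrowColor ⁻¹' t.reversed)).src b ∧
      (W.twist t).quiver.tgt (e b) =
        (W.quiver.reverse (W.arrowColor ⁻¹' t.reversed)).tgt b := by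
  classical
  let G : FinQuiver X W.Arrow := W.quiver.reverse (W.arrowColor ⁻¹' t.reversed)
  have hG : ∀ b, (W.twist t).Edge (t.arrowEquiv (W.arrowColor b)) (G.src b) (G.tgt b) := by
    intro b
    rw [twist_edge]
    simp only [G, FinQuiver.reverse, Set.mem_preimage]
    split_ifs
    · exact b.edge
    · exact b.edge
  refine ⟨Equiv.ofBijective (fun b => (W.twist t).mkArrow (hG b)) ⟨fun b b' h => ?_, fun b => ?_⟩,
    fun b => ⟨rfl, rfl, rfl⟩⟩
  · have hc : W.arrowColor b = W.arrowColor b' :=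
      t.arrowEquiv.injective (congrArg (W.twist t).arrowColor h)
    have h1 : G.src b = G.src b' := congrArg (W.twist t).quiver.src h
    have h2 : G.tgt b = G.tgt b' := congrArg (W.twist t).quiver.tgt h
    simp only [G, FinQuiver.reverse, Set.mem_preimage, hc] at h1 h2
    split_ifs at h1 h2
    · exact Arrow.ext hc h2 h1
    · exact Arrow.ext hc h1 h2
  · have hb := b.edge
    obtain ⟨a, ha⟩ := t.arrowEquiv.surjective ((W.twist t).arrowColor b)
    rw [← ha, twist_edge] at hb
    split_ifs at hb with hr
    · refine ⟨W.mkArrow hb, Arrow.ext ha ?_ ?_⟩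
      · change G.src (W.mkArrow hb) = _
        exact if_pos hr
      · change G.tgt (W.mkArrow hb) = _
        exact if_pos hr
    · refine ⟨W.mkArrow hb, Arrow.ext ha ?_ ?_⟩
      · change G.src (W.mkArrow hb) = _
        exact if_neg hr
      · change G.tgt (W.mkArrow hb) = _
        exact if_neg hr

lemma IsConnected.twist {W : Winding Q X} (h : W.IsConnected) (t : Twist Q R) :
    (W.twist t).IsConnected := by
  rw [isConnected_iff] at *
  refine ⟨h.1, fun S hne hS => h.2 S hne fun a x y hxy => ?_⟩
  by_cases ha : a ∈ t.reversed
  · exact (hS (t.arrowEquiv a) y x (by rwa [twist_edge, if_pos ha])).symm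
  · exact hS (t.arrowEquiv a) x y (by rwa [twist_edge, if_neg ha])

lemma IsConnected.of_twist [Finite X] {W : Winding Q X} {t : Twist Q R}
    (h : (W.twist t).IsConnected) : W.IsConnected :=
  (W.twist_twist_symm t).isConnected (h.twist t.symm)

lemma IsTree.twist {W : Winding Q X} (h : W.IsTree) (t : Twist Q R) : (W.twist t).IsTree := by
  obtain ⟨e, -⟩ := W.exists_twist_arrow_equiv t
  exact ⟨h.1.twist t, by rw [← Nat.card_congr e, h.2]⟩

open Classical in
/-- The sign `(-1) ^ (number of arrows with colour in D)` of a tree, and zero otherwise. -/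
def treeSign (W : Winding Q X) (D : Set A) : ℂ :=
  if W.IsTree then (-1) ^ Nat.card {b : W.Arrow // W.arrowColor b ∈ D} else 0

lemma Equivalent.treeSign {W : Winding Q X} {W' : Winding Q Y} (h : W.Equivalent W')
    (D : Set A) : W.treeSign D = W'.treeSign D := by
  have h1 : W.IsTree ↔ W'.IsTree := ⟨h.isTree, h.symm.isTree⟩
  rw [Winding.treeSign, Winding.treeSign, h.card_colored (· ∈ D)]
  by_cases h2 : W.IsTree
  · rw [if_pos h2, if_pos (h1.1 h2)]
  · rw [if_neg h2, if_neg fun h3 => h2 (h1.2 h3)]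

lemma treeSign_ne_zero_iff {W : Winding Q X} {D : Set A} : W.treeSign D ≠ 0 ↔ W.IsTree := by
  rw [treeSign]
  split_ifs with h <;> simp [h]

lemma treeSign_twist (W : Winding Q X) (t : Twist Q R) :
    (W.twist t).treeSign t.symm.reversed = W.treeSign t.reversed := by
  by_cases h : W.IsTree
  · obtain ⟨e, he⟩ := W.exists_twist_arrow_equiv t
    rw [treeSign, treeSign, if_pos h, if_pos (h.twist t)]
    congr 1
    refine (Nat.card_congr (e.subtypeEquiv fun b => ?_)).symm
    rw [(he b).1]
    change _ ↔ t.arrowEquiv.symm _ ∈ t.reversed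
    rw [Equiv.symm_apply_apply]
  · have h' : ¬(W.twist t).IsTree := fun h' =>
      h ((W.twist_twist_symm t).isTree (h'.twist t.symm))
    rw [treeSign, treeSign, if_neg h, if_neg h']

lemma treeSign_mul_self {W : Winding Q X} (h : W.IsTree) (D : Set A) :
    W.treeSign D * W.treeSign D = 1 := by
  rw [treeSign, if_pos h, ← pow_add, Even.neg_one_pow ⟨_, rfl⟩]

/-- The key sign identity. The reversed arrows of a tree are those of the two parts, plus the
crossing arrow if it is reversed; in that case the tree sign acquires a factor `-1`, and so does the
sign of the cut. -/
lemma treeSign_mul_cutSign_twist [Finite X] [Finite A] {W : Winding Q X} (h : W.IsTree)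
    (t : Twist Q R) {S : Set X} (h1 : (W.restrict S).IsConnected)
    (h2 : (W.restrict Sᶜ).IsConnected) :
    W.treeSign t.reversed * (W.twist t).cutSign S =
      W.cutSign S * ((W.restrict Sᶜ).treeSign t.reversed * (W.restrict S).treeSign t.reversed) := by
  classical
  obtain ⟨t1, t2, hcr⟩ := h.cut h1 h2
  obtain ⟨b, hb⟩ := Set.ncard_eq_one.1 hcr
  obtain ⟨e, he⟩ := W.exists_twist_arrow_equiv t
  have hb' : (W.twist t).crossing S = {e b} := by
    ext b'
    obtain ⟨c, rfl⟩ := e.surjective b'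
    have : e c ∈ (W.twist t).crossing S ↔ c ∈ W.crossing S := by
      simp only [crossing, Set.mem_ofPred_eq, (he c).2.1, (he c).2.2, FinQuiver.reverse]
      split_ifs
      · exact not_congr Iff.comm
      · rfl
    rw [this, hb, Set.mem_singleton_iff, Set.mem_singleton_iff, e.apply_eq_iff_eq]
  have hbc : ¬(W.quiver.src b ∈ S ↔ W.quiver.tgt b ∈ S) := hb.ge rfl
  rw [cutSign_of_crossing_eq hb, cutSign_of_crossing_eq hb', treeSign, treeSign, treeSign,
    if_pos h, if_pos t1, if_pos t2, W.card_colored_eq S (· ∈ t.reversed), hb, (he b).2.2,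
    pow_add, pow_add]
  simp only [FinQuiver.reverse, Set.mem_preimage]
  by_cases hD : W.arrowColor b ∈ t.reversed
  · have : {c ∈ ({b} : Set W.Arrow) | W.arrowColor c ∈ t.reversed} = {b} := by
      ext c
      simp only [Set.mem_ofPred_eq, Set.mem_singleton_iff, and_iff_left_iff_imp]
      rintro rfl
      exact hD
    rw [this, Set.ncard_singleton, if_pos hD]
    by_cases ht : W.quiver.tgt b ∈ S
    · rw [if_pos ht, if_neg (by tauto)]
      ring
    · rw [if_neg ht, if_pos (by tauto)]
      ring
  · have : {c ∈ ({b} : Set W.Arrow) | W.arrowColor c ∈ t.reversed} = ∅ := by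
      ext c
      simp only [Set.mem_ofPred_eq, Set.mem_singleton_iff, Set.mem_empty_iff_false, iff_false,
        not_and]
      rintro rfl
      exact hD
    rw [this, Set.ncard_empty, if_neg hD]
    ring

end Winding

/-! ### The ideal of proper pseudotrees -/

section Ideal

variable {V : Type u} {A : Type v} [Finite V] [Finite A] {Q : FinQuiver V A}

lemma nilpotent_indecomposable_of_apply_ne_zero {f : Hall Q} (hf : f ∈ nilLie Q) {M : Rep Q}
    (h : f (cls M) ≠ 0) : M.IsNilpotent ∧ M.IsIndecomposable :=
  ⟨hf.2 M h, (Hall.isPrimitive_iff_support f).1 hf.1 M h⟩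

lemma isConnected_of_apply_ne_zero {f : Hall Q} (hf : f ∈ nilLie Q) {X : Type*} [Finite X]
    {W : Winding Q X} (h : f (cls W.toRep) ≠ 0) : W.IsConnected :=
  W.equivalent_toRep.isConnected
    (Rep.isIndecomposable_iff.1 (nilpotent_indecomposable_of_apply_ne_zero hf h).2)

lemma Winding.IsTree.isTreeRep_toRep {X : Type*} [Finite X] {W : Winding Q X} (h : W.IsTree) :
    W.toRep.IsTreeRep :=
  Rep.isTreeRep_iff.2 (W.equivalent_toRep.symm.isTree h)

/-- The dichotomy for nilpotent indecomposables; this is where the injective choice of ends replaces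
the hypothesis on `Q`. -/
lemma Rep.isProperPseudotreeRep_of_not_isTreeRep {s : A → Bool}
    (hs : Function.Injective (Q.endpoint s)) {M : Rep Q}
    (h : M.IsNilpotent ∧ M.IsIndecomposable) (hM : ¬M.IsTreeRep) : M.IsProperPseudotreeRep :=
  ⟨h, M.coeffQuiver_isPseudotree_iff.2 ⟨Rep.isIndecomposable_iff.1 h.2,
    M.winding.card_arrow_le hs⟩, fun ht => hM ⟨h, ht⟩⟩

/-- An element of the Lie algebra is a combination of the classes in its support. -/
lemma mem_of_support (N : Submodule ℂ (nilLie Q)) (f : nilLie Q)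
    (h : ∀ (M : Rep Q) (hM : M.IsNilpotent ∧ M.IsIndecomposable), f.1 (cls M) ≠ 0 →
      nilClass M hM ∈ N) : f ∈ N := by
  classical
  let F : IsoClass Q →₀ ℂ := f.1
  -- The class of a chosen representative; the default value `0` is never met on the support of `F`.
  let n : IsoClass Q → nilLie Q := fun c =>
    if hc : (Quotient.out c).IsNilpotent ∧ (Quotient.out c).IsIndecomposable then
      nilClass (Quotient.out c) hc else 0
  have hout : ∀ c : IsoClass Q, cls (Quotient.out c) = c := fun c => Quotient.out_eq c
  have hn : ∀ c ∈ F.support, (n c).1 = (Finsupp.single c 1 : IsoClass Q →₀ ℂ) ∧ n c ∈ N := by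
    intro c hc
    have hne : f.1 (cls (Quotient.out c)) ≠ 0 := by
      rw [hout]
      exact Finsupp.mem_support_iff.1 hc
    have hM := nilpotent_indecomposable_of_apply_ne_zero f.2 hne
    simp only [n, dif_pos hM]
    refine ⟨?_, h _ hM hne⟩
    change (Finsupp.single (cls (Quotient.out c)) (1 : ℂ)) = _
    rw [hout]
  have hsum : f = ∑ c ∈ F.support, F c • n c := by
    refine Subtype.ext ?_
    have h1 : ((∑ c ∈ F.support, F c • n c : nilLie Q) : Hall Q) =
        ∑ c ∈ F.support, F c • (n c : Hall Q) := by
      simp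
    rw [h1]
    change F = ∑ c ∈ F.support, F c • ((n c).1 : IsoClass Q →₀ ℂ)
    rw [Finset.sum_congr rfl fun c hc => by rw [(hn c hc).1]]
    conv_lhs => rw [← Finsupp.sum_single F]
    exact Finset.sum_congr rfl fun c _ => (Finsupp.smul_single_one c (F c)).symm
  rw [hsum]
  exact Submodule.sum_mem _ fun c hc => N.smul_mem _ (hn c hc).2

/-- By the dichotomy, an element that vanishes on trees is supported on proper pseudotrees. All work
modulo the span is thereby reduced to evaluation at trees. -/
lemma mem_pseudotreeSpan_iff {s : A → Bool} (hs : Function.Injective (Q.endpoint s))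
    {f : nilLie Q} : f ∈ pseudotreeSpan Q ↔ ∀ T : Rep Q, T.winding.IsTree → f.1 (cls T) = 0 := by
  classical
  constructor
  · intro hf T hT
    induction hf using Submodule.span_induction with
    | mem x hx =>
      obtain ⟨M, hM, rfl⟩ := hx
      change delta M (cls T) = 0
      rw [Hall.delta_apply, if_neg]
      intro hMT
      exact hM.2.2 (M.coeffQuiver_isTree_iff.2 (hMT.winding.symm.isTree hT))
    | zero => rfl
    | add x y _ _ hx hy =>
      change x.1 (cls T) + y.1 (cls T) = 0
      rw [hx, hy, add_zero]
    | smul r x _ hx =>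
      change r * x.1 (cls T) = 0
      rw [hx, mul_zero]
  · intro hf
    refine mem_of_support _ f fun M hM hne => Submodule.subset_span ⟨M, ?_, rfl⟩
    exact Rep.isProperPseudotreeRep_of_not_isTreeRep hs hM fun hT =>
      hne (hf M (Rep.isTreeRep_iff.1 hT))

/-- The ideal spanned by the proper pseudotrees. -/
def pseudotreeIdeal {s : A → Bool} (hs : Function.Injective (Q.endpoint s)) :
    LieIdeal ℂ (nilLie Q) where
  __ := pseudotreeSpan Q
  lie_mem := by
    intro x m hm
    change ⁅x, m⁆ ∈ pseudotreeSpan Q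
    have hm' := (mem_pseudotreeSpan_iff hs).1 hm
    refine (mem_pseudotreeSpan_iff hs).2 fun T hT => ?_
    have : Fintype (Set T.Vert) := Fintype.ofFinite _
    change ⁅x.1, m.1⁆ (cls T) = 0
    rw [Hall.lie_apply_winding x.1 m.1 (Winding.Equivalent.refl T.winding)]
    refine Finset.sum_eq_zero fun S _ => ?_
    -- A nonzero term would need both parts of the tree `T` to be connected, hence trees, and `m`
    -- vanishes on trees.
    by_cases h1 : x.1 (cls (T.winding.restrict Sᶜ).toRep) = 0
    · rw [h1, zero_mul, mul_zero]
    · by_cases h2 : m.1 (cls (T.winding.restrict S).toRep) = 0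
      · rw [h2, mul_zero, mul_zero]
      · have hcut := hT.cut (isConnected_of_apply_ne_zero m.2 h2)
          (isConnected_of_apply_ne_zero x.2 h1)
        exact absurd (hm' _ (Rep.isTreeRep_iff.1 hcut.1.isTreeRep_toRep)) h2

end Ideal

/-! ### Twisting the Hall algebra -/

namespace Twist

variable {V W : Type u} {A B : Type v} {Q : FinQuiver V A} {R : FinQuiver W B}
  [Finite V] [Finite A] [Finite W] [Finite B]

/-- Ensures that `hallMap` preserves finite support. -/
lemma cls_twist_injective (t : Twist Q R) :
    Function.Injective fun c : IsoClass R => cls ((Quotient.out c).winding.twist t.symm).toRep := by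
  intro c d h
  have h1 := Winding.cls_toRep_eq_iff.1 h
  have h2 := (h1.trans (Winding.equivalent_toRep _)).twist t.symm.symm
  have h3 := ((Winding.twist_twist_symm _ t.symm).symm.trans h2).trans
    (Winding.twist_twist_symm _ t.symm)
  have h4 := cls_eq_iff.2 (Rep.iso_iff.2 h3)
  have hout : ∀ c : IsoClass R, cls (Quotient.out c) = c := fun c => Quotient.out_eq c
  rwa [hout, hout] at h4

/-- The map of Hall algebras induced by a twist: the class of a tree is sent to the class of the
twisted tree up to sign, and the other classes to zero. -/
def hallMap (t : Twist Q R) : Hall Q →ₗ[ℂ] Hall R where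
  toFun f := Finsupp.ofSupportFinite
    (fun c => (Quotient.out c).winding.treeSign t.symm.reversed *
      f (cls ((Quotient.out c).winding.twist t.symm).toRep)) (by
    have hfin : (Function.support (f : IsoClass Q → ℂ)).Finite :=
      Finsupp.hasFiniteSupport (show IsoClass Q →₀ ℂ from f)
    refine (hfin.preimage t.cls_twist_injective.injOn).subset ?_
    intro c hc
    exact right_ne_zero_of_mul hc)
  map_add' f g := Finsupp.ext fun c => by
    change _ * (f + g) _ = _ * f _ + _ * g _
    rw [Hall.add_apply, mul_add]
  map_smul' r f := Finsupp.ext fun c => by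
    change _ * (r • f) _ = r * (_ * f _)
    rw [Hall.smul_apply, mul_left_comm]

lemma hallMap_apply (t : Twist Q R) (f : Hall Q) {X : Type*} [Finite X] {N : Rep R}
    {U : Winding R X} (h : N.winding.Equivalent U) :
    t.hallMap f (cls N) = U.treeSign t.symm.reversed * f (cls (U.twist t.symm).toRep) := by
  have hN : (Quotient.out (cls N)).winding.Equivalent U :=
    (Rep.iso_iff.1 (cls_eq_iff.1 (Quotient.out_eq (cls N)))).trans h
  change (Quotient.out (cls N)).winding.treeSign t.symm.reversed *
    f (cls ((Quotient.out (cls N)).winding.twist t.symm).toRep) = _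
  rw [hN.treeSign, Winding.cls_toRep_congr (hN.twist t.symm)]

lemma isTree_of_hallMap_apply_ne_zero {t : Twist Q R} {f : Hall Q} {N : Rep R}
    (h : t.hallMap f (cls N) ≠ 0) : N.winding.IsTree := by
  rw [t.hallMap_apply f (Winding.Equivalent.refl _)] at h
  exact Winding.treeSign_ne_zero_iff.1 (left_ne_zero_of_mul h)

lemma hallMap_mem_nilLie (t : Twist Q R) (f : Hall Q) : t.hallMap f ∈ nilLie R := by
  have key : ∀ N, t.hallMap f (cls N) ≠ 0 → N.IsNilpotent ∧ N.IsIndecomposable := fun N hN =>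
    (Rep.isTreeRep_iff.2 (isTree_of_hallMap_apply_ne_zero hN)).1
  exact ⟨(Hall.isPrimitive_iff_support _).2 fun N hN => (key N hN).2, fun N hN => (key N hN).1⟩

/-- The two sums over cuts agree term by term: if both values are nonzero the two parts are
connected and the sign identity applies. Agreement at trees is all that the quotient sees. -/
lemma hallMap_lie (t : Twist Q R) {f g : Hall Q} (hf : f ∈ nilLie Q) (hg : g ∈ nilLie Q)
    {N : Rep R} (hN : N.winding.IsTree) :
    t.hallMap ⁅f, g⁆ (cls N) = ⁅t.hallMap f, t.hallMap g⁆ (cls N) := by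
  have : Fintype (Set N.Vert) := Fintype.ofFinite _
  rw [t.hallMap_apply _ (Winding.Equivalent.refl _),
    Hall.lie_apply_winding _ _ (Winding.equivalent_toRep _),
    Hall.lie_apply_winding _ _ (Winding.Equivalent.refl _), Finset.mul_sum]
  refine Finset.sum_congr rfl fun S _ => ?_
  rw [t.hallMap_apply f (Winding.equivalent_toRep _),
    t.hallMap_apply g (Winding.equivalent_toRep _), Winding.restrict_twist, Winding.restrict_twist]
  by_cases h1 : f (cls ((N.winding.restrict Sᶜ).twist t.symm).toRep) = 0
  · rw [h1]
    simp
  · by_cases h2 : g (cls ((N.winding.restrict S).twist t.symm).toRep) = 0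
    · rw [h2]
      simp
    · have hS := Winding.treeSign_mul_cutSign_twist hN t.symm
        (isConnected_of_apply_ne_zero hg h2).of_twist (isConnected_of_apply_ne_zero hf h1).of_twist
      rw [← mul_assoc, hS]
      ring

/-- The homomorphism to the quotient by the proper pseudotrees that is induced by a twist. -/
def lieHom (t : Twist Q R) {s : B → Bool} (hs : Function.Injective (R.endpoint s)) :
    nilLie Q →ₗ⁅ℂ⁆ nilLie R ⧸ pseudotreeIdeal hs where
  toLinearMap := (LieSubmodule.Quotient.mk' (pseudotreeIdeal hs) : nilLie R →ₗ[ℂ] _) ∘ₗ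
    LinearMap.codRestrict (nilLie R).toSubmodule
      (t.hallMap ∘ₗ (nilLie Q).toSubmodule.subtype) (fun f => t.hallMap_mem_nilLie f.1)
  map_lie' := by
    intro f g
    change LieSubmodule.Quotient.mk (N := pseudotreeIdeal hs)
        (⟨t.hallMap ⁅f.1, g.1⁆, _⟩ : nilLie R) =
      ⁅LieSubmodule.Quotient.mk (N := pseudotreeIdeal hs)
        (⟨t.hallMap f.1, t.hallMap_mem_nilLie f.1⟩ : nilLie R),
      LieSubmodule.Quotient.mk (N := pseudotreeIdeal hs)
        (⟨t.hallMap g.1, t.hallMap_mem_nilLie g.1⟩ : nilLie R)⁆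
    rw [← LieSubmodule.Quotient.mk_bracket]
    refine (Submodule.Quotient.eq _).2 ?_
    refine (mem_pseudotreeSpan_iff hs).2 fun N hN => ?_
    change t.hallMap ⁅f.1, g.1⁆ (cls N) - ⁅t.hallMap f.1, t.hallMap g.1⁆ (cls N) = 0
    rw [t.hallMap_lie f.2 g.2 hN, sub_self]

lemma lieHom_apply (t : Twist Q R) {s : B → Bool} (hs : Function.Injective (R.endpoint s))
    (f : nilLie Q) : t.lieHom hs f = LieSubmodule.Quotient.mk (N := pseudotreeIdeal hs)
      (⟨t.hallMap f.1, t.hallMap_mem_nilLie f.1⟩ : nilLie R) := rfl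

lemma hallMap_apply_twist (t : Twist Q R) (f : Hall Q) (T : Rep Q) :
    t.hallMap f (cls (T.winding.twist t).toRep) = T.winding.treeSign t.reversed * f (cls T) := by
  rw [t.hallMap_apply f (Winding.equivalent_toRep _), Winding.treeSign_twist,
    Winding.cls_toRep_eq_iff.2 (T.winding.twist_twist_symm t)]

/-- Twisting matches the trees of `Q` with those of `R`, and the signs are nonzero, so vanishing on
trees is preserved both ways. -/
lemma ker_lieHom (t : Twist Q R) {s : A → Bool} (hs : Function.Injective (Q.endpoint s))
    {s' : B → Bool} (hs' : Function.Injective (R.endpoint s')) :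
    (t.lieHom hs').ker = pseudotreeIdeal hs := by
  ext f
  rw [LieHom.mem_ker, lieHom_apply]
  refine (Submodule.Quotient.mk_eq_zero _).trans ?_
  refine Iff.trans (mem_pseudotreeSpan_iff hs') (Iff.trans ?_ (mem_pseudotreeSpan_iff hs).symm)
  change (∀ N : Rep R, N.winding.IsTree → t.hallMap f.1 (cls N) = 0) ↔ _
  constructor
  · intro h T hT
    have h1 := h (T.winding.twist t).toRep
      ((Winding.equivalent_toRep _).symm.isTree (hT.twist t))
    rw [t.hallMap_apply_twist] at h1
    exact (mul_eq_zero.1 h1).resolve_left (Winding.treeSign_ne_zero_iff.2 hT)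
  · intro h N hN
    rw [t.hallMap_apply f.1 (Winding.Equivalent.refl _), h _
      ((Winding.equivalent_toRep _).symm.isTree (hN.twist t.symm)), mul_zero]

lemma lieHom_surjective (t : Twist Q R) {s' : B → Bool}
    (hs' : Function.Injective (R.endpoint s')) : Function.Surjective (t.lieHom hs') := by
  intro y
  obtain ⟨g, rfl⟩ := LieSubmodule.Quotient.surjective_mk' (pseudotreeIdeal hs') y
  -- Twisting back and forth multiplies the value at a tree by the square of its sign, which is `1`.
  refine ⟨⟨t.symm.hallMap g.1, t.symm.hallMap_mem_nilLie g.1⟩, ?_⟩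
  rw [lieHom_apply]
  refine (Submodule.Quotient.eq _).2 ?_
  refine (mem_pseudotreeSpan_iff hs').2 fun N hN => ?_
  change t.hallMap (t.symm.hallMap g.1) (cls N) - g.1 (cls N) = 0
  rw [t.hallMap_apply _ (Winding.Equivalent.refl _), t.symm.hallMap_apply_twist, ← mul_assoc,
    Winding.treeSign_mul_self hN, one_mul, sub_self]

lemma hallMap_delta (t : Twist Q R) {T : Rep Q} (hT : T.winding.IsTree) :
    t.hallMap (delta T) =
      T.winding.treeSign t.reversed • delta (T.winding.twist t).toRep := by
  classical
  ext N
  rw [Hall.smul_apply, Hall.delta_apply, t.hallMap_apply _ (Winding.Equivalent.refl _),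
    Hall.delta_apply]
  have hiff : Rep.Iso T (N.winding.twist t.symm).toRep ↔
      Rep.Iso (T.winding.twist t).toRep N := by
    rw [Rep.iso_iff, Rep.iso_iff]
    constructor
    · intro h
      refine (Winding.equivalent_toRep _).trans ((Winding.Equivalent.twist
        (h.trans (Winding.equivalent_toRep _)) t).trans (N.winding.twist_symm_twist t))
    · intro h
      refine Winding.Equivalent.trans ?_ (Winding.equivalent_toRep _).symm
      exact (T.winding.twist_twist_symm t).symm.trans (Winding.Equivalent.twist
        ((Winding.equivalent_toRep _).symm.trans h) t.symm)
  rw [hiff]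
  split_ifs with h
  · have h1 := (Winding.equivalent_toRep _).symm.trans (Rep.iso_iff.1 h)
    rw [← h1.treeSign, Winding.treeSign_twist]
  · simp

end Twist

/-- The isomorphism induced on the quotient by the kernel of a surjective homomorphism. -/
lemma exists_quotient_lieEquiv {L L' : Type*} [LieRing L] [LieAlgebra ℂ L] [LieRing L']
    [LieAlgebra ℂ L'] (F : L →ₗ⁅ℂ⁆ L') (hF : Function.Surjective F) (I : LieIdeal ℂ L)
    (hI : F.ker = I) :
    ∃ φ : (L ⧸ I) ≃ₗ⁅ℂ⁆ L', ∀ x, φ (LieSubmodule.Quotient.mk x) = F x := by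
  subst hI
  have hr : F.range = ⊤ := (LieHom.range_eq_top F).2 hF
  refine ⟨F.quotKerEquivRange.trans
    ((LieEquiv.ofEq F.range ⊤ (congrArg _ hr)).trans LieSubalgebra.topEquiv), fun x => rfl⟩

/-! ### Cutting a proper pseudotree into two trees -/

namespace FinQuiver

variable {V : Type u} {A : Type v} [Finite V] [Finite A]

lemma endpoint_congr (Q : FinQuiver V A) {s s' : A → Bool} {a : A} (h : s a = s' a) :
    Q.endpoint s a = Q.endpoint s' a := by
  rw [endpoint, endpoint, h]

/-- Reversing an orientation along the cycle of the underlying graph: the second choice of ends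
differs from the first one exactly on the arrows whose chosen end lies on the cycle. -/
lemma exists_second_endpoint (Q : FinQuiver V A) {s : A → Bool}
    (hs : Function.Injective (Q.endpoint s)) (hcard : Nat.card A = Nat.card V) :
    ∃ s' : A → Bool, Function.Injective (Q.endpoint s') ∧ ∃ (F : V → V) (P : Set V),
      (∀ a, F (Q.endpoint s a) = Q.endpoint (fun a => !s a) a) ∧
      (∀ v, ∃ n, ∀ i, F^[n + i] v ∈ P) ∧ ∀ a, Q.endpoint s a ∈ P → s' a = !s a := by
  classical
  have hbij : Function.Bijective (Q.endpoint s) :=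
    (Nat.bijective_iff_injective_and_card _).2 ⟨hs, hcard⟩
  let u : A ≃ V := Equiv.ofBijective _ hbij
  -- `F` crosses the arrow chosen at `v` to its other end. Its periodic points form the cycle, on
  -- which `F` is a bijection, so exchanging the chosen ends there keeps them distinct.
  let F : V → V := fun v => Q.endpoint (fun a => !s a) (u.symm v)
  have hF : ∀ a, F (Q.endpoint s a) = Q.endpoint (fun a => !s a) a := fun a => by
    change Q.endpoint _ (u.symm (u a)) = _
    rw [Equiv.symm_apply_apply]
  let P : Set V := Function.periodicPts F
  have hP : Set.BijOn F P P := Function.bijOn_periodicPts F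
  let s' : A → Bool := fun a => if Q.endpoint s a ∈ P then !s a else s a
  have hs'1 : ∀ a, Q.endpoint s a ∈ P → Q.endpoint s' a = F (Q.endpoint s a) := fun a ha => by
    rw [hF]
    exact Q.endpoint_congr (if_pos ha)
  have hs'2 : ∀ a, Q.endpoint s a ∉ P → Q.endpoint s' a = Q.endpoint s a := fun a ha =>
    Q.endpoint_congr (if_neg ha)
  refine ⟨s', fun a b hab => ?_, F, P, hF, fun v => ?_, fun a ha => if_pos ha⟩
  · by_cases ha : Q.endpoint s a ∈ P <;> by_cases hb : Q.endpoint s b ∈ P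
    · rw [hs'1 a ha, hs'1 b hb] at hab
      exact hs (hP.injOn ha hb hab)
    · rw [hs'1 a ha, hs'2 b hb] at hab
      exact absurd (hab ▸ hP.mapsTo ha) hb
    · rw [hs'2 a ha, hs'1 b hb] at hab
      exact absurd (hab ▸ hP.mapsTo hb) ha
    · rw [hs'2 a ha, hs'2 b hb] at hab
      exact hs hab
  · obtain ⟨i, j, hne, hij⟩ := Finite.exists_ne_map_eq_of_infinite fun n : ℕ => F^[n] v
    have key : ∀ i j : ℕ, i < j → F^[i] v = F^[j] v → F^[i] v ∈ P := by
      intro i j hlt h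
      refine Function.mk_mem_periodicPts (n := j - i) (by omega) ?_
      rw [Function.IsPeriodicPt, Function.IsFixedPt, ← Function.iterate_add_apply,
        Nat.sub_add_cancel hlt.le, h]
    have hex : ∃ n, F^[n] v ∈ P := by
      rcases lt_or_gt_of_ne hne with h | h
      · exact ⟨i, key i j h hij⟩
      · exact ⟨j, key j i h hij.symm⟩
    obtain ⟨n, hn⟩ := hex
    refine ⟨n, fun i => ?_⟩
    rw [add_comm, Function.iterate_add_apply]
    exact hP.mapsTo.iterate i hn

end FinQuiver

/-! ### Arrows on the cycle of a proper pseudotree. -/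

namespace Winding

variable {V : Type u} {A : Type v} {Q : FinQuiver V A} {X Y : Type*} [Finite X] [Finite Y]
  [Finite A] [Finite V]

lemma endpoint_bijective (W : Winding Q X) {s : A → Bool}
    (hs : Function.Injective (Q.endpoint s)) (hW : Nat.card W.Arrow = Nat.card X) :
    Function.Bijective (W.endpoint s) :=
  (Nat.bijective_iff_injective_and_card _).2 ⟨W.endpoint_injective hs, hW⟩

/-- A winding of a tree has fewer arrows than vertices. -/
lemma card_arrow_ne_of_isTree (hQ : Q.IsTree) (W : Winding Q X) [Nonempty X] :
    Nat.card W.Arrow ≠ Nat.card X := by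
  intro hW
  obtain ⟨x⟩ := ‹Nonempty X›
  -- Over a tree the choice can avoid one vertex of `Q`; then no arrow of `W` has `x` as its chosen
  -- end, although equal counts would make every vertex a chosen end.
  obtain ⟨s, hs, hr⟩ := Q.exists_endpoint_injective {W.color x} (by
    rw [hQ.2]
    simp)
  obtain ⟨b, hb⟩ := (W.endpoint_bijective hs hW).2 x
  refine hr (W.arrowColor b) ?_
  rw [← W.color_endpoint, hb, Finset.mem_singleton]

/-- The cycle of a nilpotent winding has arrows in both directions. -/
lemma exists_arrows_of_isNilpotent (hcard : Nat.card A = Nat.card V) {s : A → Bool}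
    (hs : Function.Injective (Q.endpoint s)) :
    ∃ s' : A → Bool, Function.Injective (Q.endpoint s') ∧
      ∀ {X : Type u} [Finite X] [Nonempty X] (W : Winding Q X), Nat.card W.Arrow = Nat.card X →
        W.IsNilpotent → ∃ e f : W.Arrow,
          (s (W.arrowColor e) = true ∧ s' (W.arrowColor e) = false) ∧
          (s (W.arrowColor f) = false ∧ s' (W.arrowColor f) = true) := by
  obtain ⟨s', hs', F, P, hF, hP, hPs⟩ := Q.exists_second_endpoint hs hcard
  refine ⟨s', hs', fun {X} _ _ W hW hnil => ?_⟩
  let U : W.Arrow ≃ X := Equiv.ofBijective _ (W.endpoint_bijective hs hW)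
  -- The lift of `F` to `W`. Its orbits eventually lie over `P`, and there the arrows traversed have
  -- different chosen ends under `s` and `s'`.
  let G : X → X := fun x => W.endpoint (fun a => !s a) (U.symm x)
  have hcol : ∀ x, Q.endpoint s (W.arrowColor (U.symm x)) = W.color x := fun x => by
    rw [← W.color_endpoint]
    exact congrArg W.color (U.apply_symm_apply x)
  have hG : ∀ x, W.color (G x) = F (W.color x) := fun x => by
    rw [← hcol x, hF]
    exact W.color_endpoint _ _
  have hGi : ∀ n x, W.color (G^[n] x) = F^[n] (W.color x) := by
    intro n
    induction n with
    | zero => exact fun _ => rfl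
    | succ n ih =>
      intro x
      rw [Function.iterate_succ_apply, Function.iterate_succ_apply, ih, hG]
  obtain ⟨x⟩ := ‹Nonempty X›
  obtain ⟨n, hn⟩ := hP (W.color x)
  let y : ℕ → X := fun i => G^[n + i] x
  have hy : ∀ i, y (i + 1) = G (y i) := fun i => Function.iterate_succ_apply' _ _ _
  let b : ℕ → W.Arrow := fun i => U.symm (y i)
  have hb : ∀ i, W.endpoint s (b i) = y i := fun i => U.apply_symm_apply (y i)
  have hbs : ∀ i, s' (W.arrowColor (b i)) = !s (W.arrowColor (b i)) := fun i => by
    refine hPs _ ?_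
    rw [hcol]
    exact (hGi _ _).symm ▸ hn i
  have hb' : ∀ i, W.endpoint (fun a => !s a) (b i) = y (i + 1) := fun i => (hy i).symm
  obtain ⟨N, hN⟩ := hnil
  have hexe : ∃ e : W.Arrow, s (W.arrowColor e) = true ∧ s' (W.arrowColor e) = false := by
    by_contra hcon
    have hfalse : ∀ i, s (W.arrowColor (b i)) = false := fun i => by
      cases h : s (W.arrowColor (b i)) with
      | false => rfl
      | true => exact absurd ⟨b i, h, by rw [hbs, h]; rfl⟩ hcon
    -- If every chosen end is a target, the arrows run against the orbit, so the orbit read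
    -- backwards is a walk of the forbidden length `N`.
    refine hN (fun j => y (N - j)) fun j hj => ⟨W.arrowColor (b (N - (j + 1))), ?_⟩
    have h1 := hb (N - (j + 1))
    have h2 := hb' (N - (j + 1))
    simp only [endpoint, hfalse, Bool.not_false, if_true, Bool.false_eq_true, if_false] at h1 h2
    have h3 := (b (N - (j + 1))).edge
    rw [h1, h2, show N - (j + 1) + 1 = N - j by omega] at h3
    exact h3
  have hexf : ∃ f : W.Arrow, s (W.arrowColor f) = false ∧ s' (W.arrowColor f) = true := by
    by_contra hcon
    have htrue : ∀ i, s (W.arrowColor (b i)) = true := fun i => by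
      cases h : s (W.arrowColor (b i)) with
      | true => rfl
      | false => exact absurd ⟨b i, h, by rw [hbs, h]; rfl⟩ hcon
    refine hN y fun j hj => ⟨W.arrowColor (b j), ?_⟩
    have h1 := hb j
    have h2 := hb' j
    simp only [endpoint, htrue, Bool.not_true, if_true, Bool.false_eq_true, if_false] at h1 h2
    have h3 := (b j).edge
    rwa [h1, h2] at h3
  obtain ⟨e, he⟩ := hexe
  obtain ⟨f, hf⟩ := hexf
  exact ⟨e, f, he, hf⟩

/-! ### Components after deleting arrows, and cutting the cycle. -/

/-- The component of `x` after the arrows in `K` are deleted. -/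
def component (W : Winding Q X) (K : Set W.Arrow) (x : X) : Set X :=
  {y | Relation.EqvGen (fun p q => ∃ b : W.Arrow, b ∉ K ∧ W.quiver.src b = p ∧
    W.quiver.tgt b = q) x y}

lemma mem_component_self (W : Winding Q X) (K : Set W.Arrow) (x : X) : x ∈ W.component K x :=
  .refl x

lemma component_invariant (W : Winding Q X) {K : Set W.Arrow} {x : X} {b : W.Arrow} (hb : b ∉ K) :
    W.quiver.src b ∈ W.component K x ↔ W.quiver.tgt b ∈ W.component K x :=
  ⟨fun h => h.trans _ _ _ (.rel _ _ ⟨b, hb, rfl, rfl⟩),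
    fun h => h.trans _ _ _ (.symm _ _ (.rel _ _ ⟨b, hb, rfl, rfl⟩))⟩

lemma crossing_component_subset (W : Winding Q X) (K : Set W.Arrow) (x : X) :
    W.crossing (W.component K x) ⊆ K := fun b hb => by
  by_contra h
  exact hb (W.component_invariant h)

/-- The component is the smallest set containing `x` whose crossing arrows all lie in `K`. -/
lemma component_subset (W : Winding Q X) {K : Set W.Arrow} {x : X} {S : Set X} (hx : x ∈ S)
    (hS : W.crossing S ⊆ K) : W.component K x ⊆ S := by
  intro y hy
  have key : ∀ p q, Relation.EqvGen (fun p q => ∃ b : W.Arrow, b ∉ K ∧ W.quiver.src b = p ∧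
      W.quiver.tgt b = q) p q → (p ∈ S ↔ q ∈ S) := by
    intro p q h
    induction h with
    | rel p q h =>
      obtain ⟨b, hb, rfl, rfl⟩ := h
      by_contra hcon
      exact hb (hS hcon)
    | refl p => rfl
    | symm p q _ ih => exact ih.symm
    | trans p q r _ _ h1 h2 => exact h1.trans h2
  exact (key x y hy).1 hx

lemma component_isConnected (W : Winding Q X) (K : Set W.Arrow) (x : X) :
    (W.restrict (W.component K x)).IsConnected := by
  refine isConnected_iff.2 ⟨⟨⟨x, W.mem_component_self K x⟩⟩, fun T ⟨t, ht⟩ hT y => ?_⟩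
  have hcross : W.crossing (Subtype.val '' T) ⊆ K := by
    intro b hb
    by_contra hK
    have hinv := W.component_invariant (x := x) hK
    have hmem : ∀ p, p ∈ Subtype.val '' T ↔ ∃ h : p ∈ W.component K x, ⟨p, h⟩ ∈ T := by
      intro p
      constructor
      · rintro ⟨p, hp, rfl⟩
        exact ⟨p.2, hp⟩
      · rintro ⟨h, hp⟩
        exact ⟨_, hp, rfl⟩
    refine hb ?_
    rw [hmem, hmem]
    constructor
    · rintro ⟨h, hp⟩
      exact ⟨hinv.1 h, (hT (W.arrowColor b) ⟨_, h⟩ ⟨_, hinv.1 h⟩ b.edge).1 hp⟩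
    · rintro ⟨h, hp⟩
      exact ⟨hinv.2 h, (hT (W.arrowColor b) ⟨_, hinv.2 h⟩ ⟨_, h⟩ b.edge).2 hp⟩
  by_contra hy
  by_cases hx : x ∈ Subtype.val '' T
  · obtain ⟨y', hy', he⟩ := W.component_subset hx hcross y.2
    exact hy (Subtype.ext he ▸ hy')
  · have hcross' : W.crossing (Subtype.val '' T)ᶜ ⊆ K := fun b hb =>
      hcross fun h => hb (not_congr h)
    exact W.component_subset hx hcross' t.2 ⟨t, ht, rfl⟩

/-- The quiver is still connected without `K`, so it retains at least `Nat.card X - 1` arrows. -/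
lemma card_le_of_component_eq_univ (W : Winding Q X) {K : Set W.Arrow} {x : X}
    (h : W.component K x = Set.univ) : Nat.card X + K.ncard ≤ Nat.card W.Arrow + 1 := by
  let G : FinQuiver X (Kᶜ : Set W.Arrow) := ⟨fun b => W.quiver.src b, fun b => W.quiver.tgt b⟩
  have hG : G.Connected := by
    refine FinQuiver.connected_iff.2 ⟨⟨x⟩, fun S ⟨t, ht⟩ hS y => ?_⟩
    have hcross : W.crossing S ⊆ K := fun b hb => by
      by_contra hK
      exact hb (hS ⟨b, hK⟩)
    have hcross' : W.crossing Sᶜ ⊆ K := fun b hb => hcross fun h => hb (not_congr h)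
    by_contra hy
    by_cases hx : x ∈ S
    · exact hy (W.component_subset hx hcross (h ▸ Set.mem_univ y))
    · exact W.component_subset hx hcross' (h ▸ Set.mem_univ t) ht
  have h1 := hG.card_le
  rw [Nat.card_coe_set_eq] at h1
  have h2 := Set.ncard_add_ncard_compl K
  omega

/-- Vertices whose chosen arrow leaves `S` are not chosen by the arrows inside `S`. -/
lemma card_restrict_add_le (W : Winding Q X) {s : A → Bool}
    (hs : Function.Injective (Q.endpoint s)) {S : Set X} {K : Set W.Arrow}
    (hK : K ⊆ W.crossing S) (hKS : ∀ b ∈ K, W.endpoint s b ∈ S) :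
    Nat.card (W.restrict S).Arrow + K.ncard ≤ Nat.card S := by
  let I : Set W.Arrow := {b | W.quiver.src b ∈ S ∧ W.quiver.tgt b ∈ S}
  have hI : Nat.card (W.restrict S).Arrow = I.ncard := by
    have := W.card_restrict_colored S (fun _ => True)
    simp only [and_true] at this
    rwa [Nat.card_congr (Equiv.subtypeUnivEquiv fun _ => trivial)] at this
  have hdisj : Disjoint I K := by
    rw [Set.disjoint_left]
    exact fun b hb hbK => hK hbK ⟨fun _ => hb.2, fun _ => hb.1⟩
  rw [hI, ← Set.ncard_union_eq hdisj, Nat.card_coe_set_eq]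
  -- The chosen ends of the inner arrows and of those in `K` are distinct vertices of `S`.
  refine Set.ncard_le_ncard_of_injOn (W.endpoint s) ?_ (W.endpoint_injective hs).injOn
  rintro b (hb | hb)
  · rw [endpoint]
    split_ifs
    · exact hb.1
    · exact hb.2
  · exact hKS b hb

lemma crossing_compl (W : Winding Q X) (S : Set X) : W.crossing Sᶜ = W.crossing S :=
  Set.ext fun b => not_congr not_iff_not

/-- The arrows on the cycle of a proper pseudotree are not bridges. -/
lemma crossing_ne_singleton {W : Winding Q X} (hW : Nat.card W.Arrow = Nat.card X)
    {s s' : A → Bool} (hs : Function.Injective (Q.endpoint s))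
    (hs' : Function.Injective (Q.endpoint s')) {b : W.Arrow}
    (hb : s (W.arrowColor b) ≠ s' (W.arrowColor b)) (S : Set X) : W.crossing S ≠ {b} := by
  have key : ∀ S : Set X, W.endpoint s b ∈ S → W.crossing S ≠ {b} := by
    intro S hS hcr
    have hbc : ¬(W.quiver.src b ∈ S ↔ W.quiver.tgt b ∈ S) := hcr.ge rfl
    have hS' : W.endpoint s' b ∈ Sᶜ := by
      simp only [endpoint, Set.mem_compl_iff] at *
      revert hb hS
      cases s (W.arrowColor b) <;> cases s' (W.arrowColor b) <;> simp <;> tauto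
    -- The choices `s` and `s'` pick opposite ends of `b`, so each side of the bridge has a spare
    -- vertex; in total there would be fewer arrows than vertices.
    have c1 := W.card_restrict_add_le hs (K := {b}) hcr.ge (by rintro _ rfl; exact hS)
    have c2 := W.card_restrict_add_le hs' (S := Sᶜ) (K := {b}) (by rw [crossing_compl, hcr])
      (by rintro _ rfl; exact hS')
    have c3 := W.card_arrow_eq S
    have c4 := card_vertex_eq S
    rw [hcr] at c3
    rw [Set.ncard_singleton] at c1 c2 c3
    omega
  by_cases hS : W.endpoint s b ∈ S
  · exact key S hS
  · rw [← crossing_compl]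
    exact key Sᶜ hS

/-- A proper pseudotree is cut into two trees by two arrows of its cycle with opposite
directions around the cycle; both then point to the same part. -/
lemma exists_cut {W : Winding Q X} (hconn : W.IsConnected) (hW : Nat.card W.Arrow = Nat.card X)
    {s s' : A → Bool} (hs : Function.Injective (Q.endpoint s))
    (hs' : Function.Injective (Q.endpoint s')) {e f : W.Arrow}
    (he : s (W.arrowColor e) = true ∧ s' (W.arrowColor e) = false)
    (hf : s (W.arrowColor f) = false ∧ s' (W.arrowColor f) = true) :
    ∃ S : Set X, (W.restrict S).IsTree ∧ (W.restrict Sᶜ).IsTree ∧ W.crossing S = {e, f} ∧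
      (W.quiver.src e ∉ S ∧ W.quiver.tgt e ∈ S) ∧ (W.quiver.src f ∉ S ∧ W.quiver.tgt f ∈ S) := by
  have hef : e ≠ f := by
    rintro rfl
    rw [he.1] at hf
    exact absurd hf.1 (by simp)
  have hse : W.endpoint s e = W.quiver.src e := by rw [endpoint, he.1, if_pos rfl]
  have hsf : W.endpoint s f = W.quiver.tgt f := by
    rw [endpoint, hf.1, if_neg Bool.false_ne_true]
  have hsf' : W.endpoint s' f = W.quiver.src f := by rw [endpoint, hf.2, if_pos rfl]
  have hbridge : ∀ b ∈ ({e, f} : Set W.Arrow), ∀ S, W.crossing S ≠ {b} := by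
    rintro b (rfl | rfl) S
    · exact crossing_ne_singleton hW hs hs' (by rw [he.1, he.2]; simp) S
    · exact crossing_ne_singleton hW hs hs' (by rw [hf.1, hf.2]; simp) S
  have hpair : ∀ S, W.crossing S ⊆ {e, f} → (W.crossing S).Nonempty → W.crossing S = {e, f} := by
    intro S hS hne
    rcases Set.subset_pair_iff_eq.1 hS with h | h | h | h
    · exact absurd h hne.ne_empty
    · exact absurd h (hbridge e (by simp) S)
    · exact absurd h (hbridge f (by simp) S)
    · exact h
  -- The two components at the ends of `f` will be the two trees.
  let S := W.component {e, f} (W.quiver.tgt f)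
  let T := W.component {e, f} (W.quiver.src f)
  have htS : W.quiver.tgt f ∈ S := W.mem_component_self _ _
  have hsT : W.quiver.src f ∈ T := W.mem_component_self _ _
  have hSconn : (W.restrict S).IsConnected := W.component_isConnected _ _
  have hSne : Sᶜ.Nonempty := by
    rw [Set.nonempty_compl]
    intro hS
    have := W.card_le_of_component_eq_univ hS
    rw [Set.ncard_pair hef] at this
    omega
  have hcr : W.crossing S = {e, f} :=
    hpair S (W.crossing_component_subset _ _) (hconn.crossing_nonempty ⟨_, htS⟩ hSne)
  have hfc : ¬(W.quiver.src f ∈ S ↔ W.quiver.tgt f ∈ S) := hcr.ge (Or.inr rfl)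
  have hec : ¬(W.quiver.src e ∈ S ↔ W.quiver.tgt e ∈ S) := hcr.ge (Or.inl rfl)
  have hsS : W.quiver.src f ∉ S := fun h => hfc ⟨fun _ => htS, fun _ => h⟩
  have hTS : T ⊆ Sᶜ := W.component_subset hsS (by rw [crossing_compl, hcr])
  -- A proper union would be crossed by both `e` and `f`, since neither is a bridge, but both ends
  -- of `f` lie inside it.
  have hunion : S ∪ T = Set.univ := by
    by_contra hne
    have h1 : W.crossing (S ∪ T) ⊆ {e, f} := by
      intro b hb
      by_contra hK
      exact hb (or_congr (W.component_invariant hK) (W.component_invariant hK))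
    have h2 := hpair _ h1 (hconn.crossing_nonempty ⟨_, Or.inl htS⟩ (Set.nonempty_compl.2 hne))
    have h3 : f ∈ W.crossing (S ∪ T) := h2.ge (Or.inr rfl)
    exact h3 ⟨fun _ => Or.inl htS, fun _ => Or.inr hsT⟩
  have hTc : T = Sᶜ := Set.Subset.antisymm hTS fun x hx =>
    (hunion.ge (Set.mem_univ x)).resolve_left hx
  have hScconn : (W.restrict Sᶜ).IsConnected := by
    have := W.component_isConnected {e, f} (W.quiver.src f)
    change (W.restrict T).IsConnected at this
    rwa [hTc] at this
  have c1 := hSconn.card_le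
  have c2 := hScconn.card_le
  have c3 := W.card_arrow_eq S
  have c4 := card_vertex_eq S
  rw [hcr, Set.ncard_pair hef] at c3
  -- Otherwise `s` places the chosen ends of both `e` and `f` in `S`, leaving too few arrows there
  -- for connectedness. Hence both arrows point into `S`.
  have hse' : W.quiver.src e ∉ S := by
    intro h
    have c5 := W.card_restrict_add_le hs (S := S) (K := {e, f}) hcr.ge (by
      rintro b (rfl | rfl)
      · rwa [hse]
      · rwa [hsf])
    rw [Set.ncard_pair hef] at c5
    omega
  have c6 := W.card_restrict_add_le hs (S := S) (K := {f}) (by rw [hcr]; simp) (by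
    rintro _ rfl
    rwa [hsf])
  have c7 := W.card_restrict_add_le hs' (S := Sᶜ) (K := {f}) (by
    rw [crossing_compl, hcr]; simp) (by
    rintro _ rfl
    rw [hsf']
    exact hsS)
  rw [Set.ncard_singleton] at c6 c7
  exact ⟨S, ⟨hSconn, by omega⟩, ⟨hScconn, by omega⟩, hcr, ⟨hse', by tauto⟩, hsS, htS⟩

end Winding

/-! ### Gluing two trees to a proper pseudotree -/

namespace Winding

variable {V : Type u} {A : Type v} {Q : FinQuiver V A} {X Y : Type*} [Finite X] [Finite Y]
  [Finite A] [Finite V]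

/-- If all chosen arrows are present in `W'`, then an arrow of `W` that leaves `S` at its source is
matched by an arrow of `W'` that leaves the copy `T` of `S`. -/
lemma exists_arrow_of_src {W : Winding Q X} {W' : Winding Q Y}
    (hW' : Nat.card W'.Arrow = Nat.card Y) {s : A → Bool} (hs : Function.Injective (Q.endpoint s))
    {S : Set X} {T : Set Y} (e : S ≃ T) (hc : ∀ x, W'.color (e x) = W.color x)
    (he : ∀ a (x y : S), W'.Edge a (e x) (e y) ↔ W.Edge a x y) {b : W.Arrow}
    (hb : s (W.arrowColor b) = true) (h1 : W.quiver.src b ∈ S) (h2 : W.quiver.tgt b ∉ S) :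
    ∃ b' : W'.Arrow, W'.arrowColor b' = W.arrowColor b ∧ W'.quiver.src b' = e ⟨_, h1⟩ ∧
      W'.quiver.tgt b' ∉ T := by
  -- Equal counts make every vertex of `W'` a chosen end; the colour of the vertex then determines
  -- the colour of the arrow.
  obtain ⟨b', hb'⟩ := (W'.endpoint_bijective hs hW').2 (e ⟨_, h1⟩)
  have hcol : W'.arrowColor b' = W.arrowColor b := by
    refine hs ?_
    rw [← W'.color_endpoint, hb', hc, ← W.color_endpoint, endpoint, hb, if_pos rfl]
  rw [endpoint, hcol, hb, if_pos rfl] at hb'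
  refine ⟨b', hcol, hb', fun hT => h2 ?_⟩
  obtain ⟨y, hy⟩ := e.surjective ⟨_, hT⟩
  have h3 := b'.edge
  rw [hcol, hb', show W'.quiver.tgt b' = e y from (congrArg Subtype.val hy).symm, he] at h3
  rw [W.eq_right b.edge h3]
  exact y.2

/-- The mirror image of `exists_arrow_of_src`, for an arrow whose chosen end is its target. -/
lemma exists_arrow_of_tgt {W : Winding Q X} {W' : Winding Q Y}
    (hW' : Nat.card W'.Arrow = Nat.card Y) {s : A → Bool} (hs : Function.Injective (Q.endpoint s))
    {S : Set X} {T : Set Y} (e : S ≃ T) (hc : ∀ x, W'.color (e x) = W.color x)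
    (he : ∀ a (x y : S), W'.Edge a (e x) (e y) ↔ W.Edge a x y) {b : W.Arrow}
    (hb : s (W.arrowColor b) = false) (h1 : W.quiver.tgt b ∈ S) (h2 : W.quiver.src b ∉ S) :
    ∃ b' : W'.Arrow, W'.arrowColor b' = W.arrowColor b ∧ W'.quiver.tgt b' = e ⟨_, h1⟩ ∧
      W'.quiver.src b' ∉ T := by
  obtain ⟨b', hb'⟩ := (W'.endpoint_bijective hs hW').2 (e ⟨_, h1⟩)
  have hcol : W'.arrowColor b' = W.arrowColor b := by
    refine hs ?_
    rw [← W'.color_endpoint, hb', hc, ← W.color_endpoint, endpoint, hb,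
      if_neg Bool.false_ne_true]
  rw [endpoint, hcol, hb, if_neg Bool.false_ne_true] at hb'
  refine ⟨b', hcol, hb', fun hT => h2 ?_⟩
  obtain ⟨y, hy⟩ := e.surjective ⟨_, hT⟩
  have h3 := b'.edge
  rw [hcol, hb', show W'.quiver.src b' = e y from (congrArg Subtype.val hy).symm, he] at h3
  rw [W.eq_left b.edge h3]
  exact y.2

/-- The two parts of a cut cannot be glued with arrows in the opposite direction. -/
lemma not_isClosed_of_equivalent {W : Winding Q X} {W' : Winding Q Y}
    (hW' : Nat.card W'.Arrow = Nat.card Y) {s : A → Bool} (hs : Function.Injective (Q.endpoint s))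
    {S : Set X} {T : Set Y} {b : W.Arrow} (hb : s (W.arrowColor b) = true)
    (h1 : W.quiver.src b ∉ S) (h2 : W.quiver.tgt b ∈ S)
    (hS : (W'.restrict T).Equivalent (W.restrict Sᶜ)) : ¬W'.IsClosed T := by
  obtain ⟨e, hc, he⟩ := hS.symm
  obtain ⟨b', -, hb1, hb2⟩ := exists_arrow_of_src hW' hs e hc he hb h1 (fun h => h h2)
  intro hT
  exact hb2 (isClosed_iff_arrow.1 hT b' (hb1 ▸ (e _).2))

/-- The gluing of the two parts of a cut of a proper pseudotree to a proper pseudotree is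
unique. -/
lemma equivalent_of_cut {W : Winding Q X} {W' : Winding Q Y}
    (hW : Nat.card W.Arrow = Nat.card X) (hW' : Nat.card W'.Arrow = Nat.card Y)
    {s s' : A → Bool} (hs : Function.Injective (Q.endpoint s))
    (hs' : Function.Injective (Q.endpoint s')) {e f : W.Arrow}
    (he : s (W.arrowColor e) = true ∧ s' (W.arrowColor e) = false)
    (hf : s (W.arrowColor f) = false ∧ s' (W.arrowColor f) = true)
    {S : Set X} (hcr : W.crossing S = {e, f})
    (heS : W.quiver.src e ∉ S ∧ W.quiver.tgt e ∈ S)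
    (hfS : W.quiver.src f ∉ S ∧ W.quiver.tgt f ∈ S)
    {T : Set Y} (hT : W'.IsClosed T) (h1 : (W'.restrict T).Equivalent (W.restrict S))
    (h2 : (W'.restrict Tᶜ).Equivalent (W.restrict Sᶜ)) : W.Equivalent W' := by
  classical
  have hcolef : W.arrowColor e ≠ W.arrowColor f := fun h => by
    rw [h, hf.1] at he
    exact absurd he.1 (by simp)
  have hef : e ≠ f := fun h => hcolef (h ▸ rfl)
  -- Both windings have as many arrows as vertices and equivalent parts, so they have equally many
  -- crossing arrows.
  have hcard : (W'.crossing T).ncard = 2 := by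
    have c1 := W.card_arrow_eq S
    have c2 := card_vertex_eq S
    have c3 := W'.card_arrow_eq T
    have c4 := card_vertex_eq T
    rw [hcr, Set.ncard_pair hef] at c1
    rw [h1.card_arrow, h2.card_arrow] at c3
    rw [h1.card_vertex, h2.card_vertex] at c4
    omega
  obtain ⟨φ, hφc, hφ⟩ := h1.symm
  obtain ⟨ψ, hψc, hψ⟩ := h2.symm
  -- Between them `s` and `s'` choose both ends of `e` and both ends of `f`, so each of the four
  -- ends forces a crossing arrow of the same colour in `W'`. As only two arrows cross and the
  -- colours differ, the forced arrows coincide in pairs and join the right vertices.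
  obtain ⟨b₁, hb₁c, hb₁, hb₁'⟩ := exists_arrow_of_src hW' hs ψ hψc hψ he.1 heS.1 (fun h => h heS.2)
  obtain ⟨b₂, hb₂c, hb₂, hb₂'⟩ := exists_arrow_of_tgt hW' hs' φ hφc hφ he.2 heS.2 heS.1
  obtain ⟨c₁, hc₁c, hc₁, hc₁'⟩ := exists_arrow_of_src hW' hs' ψ hψc hψ hf.2 hfS.1 (fun h => h hfS.2)
  obtain ⟨c₂, hc₂c, hc₂, hc₂'⟩ := exists_arrow_of_tgt hW' hs φ hφc hφ hf.1 hfS.2 hfS.1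
  have hsrc : ∀ {b : W'.Arrow} {z : (Tᶜ : Set Y)}, W'.quiver.src b = z → W'.quiver.tgt b ∉ Tᶜ →
      b ∈ W'.crossing T := fun {b z} hz ht h => ht fun h0 => z.2 (hz ▸ h.2 h0)
  have htgt : ∀ {b : W'.Arrow} {z : T}, W'.quiver.tgt b = z → W'.quiver.src b ∉ T →
      b ∈ W'.crossing T := fun {b z} hz ht h => ht (h.2 (hz ▸ z.2))
  have hbc : b₁ ≠ c₁ := fun h => hcolef (by rw [← hb₁c, h, hc₁c])
  have hcr' : W'.crossing T = {b₁, c₁} := by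
    refine (Set.eq_of_subset_of_ncard_le ?_ ?_ (Set.toFinite _)).symm
    · rintro b (rfl | rfl)
      · exact hsrc hb₁ hb₁'
      · exact hsrc hc₁ hc₁'
    · rw [hcard, Set.ncard_pair hbc]
  have hb₂₁ : b₂ = b₁ := (hcr'.le (htgt hb₂ hb₂')).resolve_right fun h => hcolef (by
    rw [← hb₂c, ← hc₁c, show b₂ = c₁ from h])
  have hc₂₁ : c₂ = c₁ := (hcr'.le (htgt hc₂ hc₂')).resolve_left fun h => hcolef (by
    rw [← hb₁c, ← hc₂c, show c₂ = b₁ from h])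
  rw [hb₂₁] at hb₂
  rw [hc₂₁] at hc₂
  let F : X ≃ Y := (Equiv.Set.sumCompl S).symm.trans
    ((Equiv.sumCongr φ ψ).trans (Equiv.Set.sumCompl T))
  have hF1 : ∀ x (h : x ∈ S), F x = φ ⟨x, h⟩ := fun x h => by
    simp [F, Equiv.Set.sumCompl_symm_apply_of_mem h]
  have hF2 : ∀ x (h : x ∉ S), F x = ψ ⟨x, h⟩ := fun x h => by
    simp [F, Equiv.Set.sumCompl_symm_apply_of_notMem h]
  rw [← hF2] at hb₁ hc₁
  rw [← hF1] at hb₂ hc₂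
  have hclosed : W.IsClosed S := by
    refine isClosed_iff_arrow.2 fun b hb => by_contra fun hb' => ?_
    rcases hcr.le (show b ∈ W.crossing S from fun h => hb' (h.1 hb)) with rfl | rfl
    · exact heS.1 hb
    · exact hfS.1 hb
  refine ⟨F, fun x => ?_, fun a x y => ?_⟩
  · by_cases hx : x ∈ S
    · rw [hF1 x hx]
      exact hφc ⟨x, hx⟩
    · rw [hF2 x hx]
      exact hψc ⟨x, hx⟩
  by_cases hx : x ∈ S <;> by_cases hy : y ∈ S
  · rw [hF1 x hx, hF1 y hy]
    exact hφ a _ _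
  · refine ⟨fun h => ?_, fun h => absurd (hclosed a x y h hx) hy⟩
    rw [hF1 x hx, hF2 y hy] at h
    exact absurd (hT _ _ _ h (φ _).2) (ψ _).2
  · constructor
    · intro h
      have hmem : W'.mkArrow h ∈ W'.crossing T := by
        intro hiff
        rw [W'.src_mkArrow, W'.tgt_mkArrow, hF1 y hy, hF2 x hx] at hiff
        exact (ψ ⟨x, hx⟩).2 (hiff.2 (φ ⟨y, hy⟩).2)
      rcases hcr'.le hmem with h' | h'
      · have hac : a = W.arrowColor e := (congrArg W'.arrowColor h').trans hb₁c
        have hxe : F x = F (W.quiver.src e) := (congrArg W'.quiver.src h').trans hb₁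
        have hye : F y = F (W.quiver.tgt e) := (congrArg W'.quiver.tgt h').trans hb₂
        rw [hac, F.injective hxe, F.injective hye]
        exact e.edge
      · have hac : a = W.arrowColor f := (congrArg W'.arrowColor h').trans hc₁c
        have hxe : F x = F (W.quiver.src f) := (congrArg W'.quiver.src h').trans hc₁
        have hye : F y = F (W.quiver.tgt f) := (congrArg W'.quiver.tgt h').trans hc₂
        rw [hac, F.injective hxe, F.injective hye]
        exact f.edge
    · intro h
      rcases hcr.le (show W.mkArrow h ∈ W.crossing S from fun h' => hx (h'.2 hy)) with h' | h'
      · have h3 := b₁.edge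
        have hac : a = W.arrowColor e := congrArg W.arrowColor h'
        have hxe : x = W.quiver.src e := congrArg W.quiver.src h'
        have hye : y = W.quiver.tgt e := congrArg W.quiver.tgt h'
        rwa [hb₁c, hb₁, hb₂, ← hac, ← hxe, ← hye] at h3
      · have h3 := c₁.edge
        have hac : a = W.arrowColor f := congrArg W.arrowColor h'
        have hxe : x = W.quiver.src f := congrArg W.quiver.src h'
        have hye : y = W.quiver.tgt f := congrArg W.quiver.tgt h'
        rwa [hc₁c, hc₁, hc₂, ← hac, ← hxe, ← hye] at h3
  · rw [hF2 x hx, hF2 y hy]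
    exact hψ a _ _

end Winding

/-! ### Generation by trees -/

section Generation

variable {V : Type u} {A : Type v} [Finite V] [Finite A] {Q : FinQuiver V A}

lemma nilClass_mem_lieSpan_of_isTreeRep {M : Rep Q} (h : M.IsTreeRep) :
    nilClass M h.1 ∈ LieSubalgebra.lieSpan ℂ (nilLie Q) (treeClasses Q) :=
  LieSubalgebra.subset_lieSpan ⟨M, h, rfl⟩

/-- If the bracket of two trees contains a single class that is not a tree, then this class lies in
the Lie subalgebra generated by the trees. -/
lemma nilClass_mem_lieSpan_of_lie {M : Rep Q} (hM : M.IsNilpotent ∧ M.IsIndecomposable)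
    {g : nilLie Q} (hg : g ∈ LieSubalgebra.lieSpan ℂ (nilLie Q) (treeClasses Q))
    (hgM : g.1 (cls M) ≠ 0)
    (huniq : ∀ R : Rep Q, R.IsNilpotent ∧ R.IsIndecomposable → ¬R.IsTreeRep →
      g.1 (cls R) ≠ 0 → Rep.Iso M R) :
    nilClass M hM ∈ LieSubalgebra.lieSpan ℂ (nilLie Q) (treeClasses Q) := by
  classical
  let K := LieSubalgebra.lieSpan ℂ (nilLie Q) (treeClasses Q)
  -- After subtracting its multiple of `M`, the element `g` is supported on trees.
  have h : g - g.1 (cls M) • nilClass M hM ∈ K.toSubmodule := by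
    refine mem_of_support _ _ fun R hR hne => ?_
    by_cases hT : R.IsTreeRep
    · exact nilClass_mem_lieSpan_of_isTreeRep hT
    · refine absurd ?_ hne
      change g.1 (cls R) - g.1 (cls M) * delta M (cls R) = 0
      rw [Hall.delta_apply]
      split_ifs with hMR
      · rw [cls_eq_iff.2 hMR, mul_one, sub_self]
      · rw [mul_zero, sub_zero]
        by_contra hgR
        exact hMR (huniq R hR hT hgR)
  have h2 := K.toSubmodule.sub_mem hg h
  rw [sub_sub_cancel] at h2
  have h3 := K.toSubmodule.smul_mem (g.1 (cls M))⁻¹ h2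
  rwa [smul_smul, inv_mul_cancel₀ hgM, one_smul] at h3

lemma nilClass_mem_lieSpan (hQ : Q.IsPseudotree) {M : Rep Q}
    (hM : M.IsNilpotent ∧ M.IsIndecomposable) :
    nilClass M hM ∈ LieSubalgebra.lieSpan ℂ (nilLie Q) (treeClasses Q) := by
  classical
  have hrank : Module.finrank ℤ Q.H1 ≤ 1 := by
    have := hQ.2
    rw [← Module.finrank_eq_rank] at this
    exact_mod_cast this
  by_cases hT : M.IsTreeRep
  · exact nilClass_mem_lieSpan_of_isTreeRep hT
  obtain ⟨s, hs, -⟩ := Q.exists_endpoint_injective ∅ (by simpa using hrank)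
  have hcard : ∀ R : Rep Q, R.IsNilpotent ∧ R.IsIndecomposable → ¬R.IsTreeRep →
      Nat.card R.winding.Arrow = Nat.card R.Vert := by
    intro R hR hRT
    have hconn := Rep.isIndecomposable_iff.1 hR.2
    have c1 := hconn.card_le
    have c2 := R.winding.card_arrow_le hs
    rw [Rep.isTreeRep_iff, Winding.IsTree] at hRT
    have c3 : Nat.card R.Vert ≠ Nat.card R.winding.Arrow + 1 := fun h => hRT ⟨hconn, h⟩
    omega
  have hconn := Rep.isIndecomposable_iff.1 hM.2
  have hMcard := hcard M hM hT
  have : Nonempty M.Vert := hconn.1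
  -- A proper pseudotree cannot wind over a tree, so `H₁` of `Q` has rank exactly one.
  have hQcard : Nat.card A = Nat.card V := by
    have h1 := hQ.1.card_add_finrank
    have h2 : Module.finrank ℤ Q.H1 ≠ 0 := fun h0 =>
      M.winding.card_arrow_ne_of_isTree ⟨hQ.1, Submodule.finrank_eq_zero.1 h0⟩ hMcard
    omega
  obtain ⟨s', hs', hex⟩ := Winding.exists_arrows_of_isNilpotent hQcard hs
  obtain ⟨e, f, he, hf⟩ := hex M.winding hMcard (M.isNilpotent_iff.1 hM.1)
  obtain ⟨S, hS, hSc, hcr, heS, hfS⟩ := Winding.exists_cut hconn hMcard hs hs' he hf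
  have hclosed : M.winding.IsClosed S := by
    refine Winding.isClosed_iff_arrow.2 fun b hb => by_contra fun hb' => ?_
    rcases hcr.le (show b ∈ M.winding.crossing S from fun h => hb' (h.1 hb)) with rfl | rfl
    · exact heS.1 hb
    · exact hfS.1 hb
  have hN := hSc.isTreeRep_toRep
  have hP := hS.isTreeRep_toRep
  -- In this order the part containing the source of `e` would be a subrepresentation, but in a
  -- non-tree a copy of `e` must leave it.
  have hback : ∀ R : Rep Q, R.IsNilpotent ∧ R.IsIndecomposable → ¬R.IsTreeRep →
      (delta (M.winding.restrict S).toRep * delta (M.winding.restrict Sᶜ).toRep) (cls R) = 0 := by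
    intro R hR hRT
    rw [Hall.delta_mul_delta, Nat.cast_eq_zero, Nat.card_eq_zero]
    refine Or.inl ⟨fun L => ?_⟩
    refine Winding.not_isClosed_of_equivalent (hcard R hR hRT) hs he.1 heS.1 heS.2 ?_
      L.1.isClosed_vertSet
    exact L.1.toRep_winding.symm.trans
      ((Rep.iso_iff.1 L.2.1).trans (Winding.equivalent_toRep _))
  have hlie : ∀ R : Rep Q, R.IsNilpotent ∧ R.IsIndecomposable → ¬R.IsTreeRep →
      (⁅nilClass _ hN.1, nilClass _ hP.1⁆ : nilLie Q).1 (cls R) =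
        (delta (M.winding.restrict Sᶜ).toRep * delta (M.winding.restrict S).toRep) (cls R) := by
    intro R hR hRT
    change ⁅delta (M.winding.restrict Sᶜ).toRep, delta (M.winding.restrict S).toRep⁆ (cls R) = _
    rw [LieRing.of_associative_ring_bracket, Hall.sub_apply, hback R hR hRT, sub_zero]
  refine nilClass_mem_lieSpan_of_lie hM (g := ⁅nilClass _ hN.1, nilClass _ hP.1⁆)
    (LieSubalgebra.lie_mem _ (nilClass_mem_lieSpan_of_isTreeRep hN)
      (nilClass_mem_lieSpan_of_isTreeRep hP)) ?_ fun R hR hRT hne => ?_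
  -- The set `S` itself is one of the subrepresentations counted, so the coefficient of `M` is
  -- nonzero; its exact value is irrelevant.
  · rw [hlie M hM hT, Hall.delta_mul_delta, Nat.cast_ne_zero]
    refine (Nat.card_pos_iff.2 ⟨⟨(Rep.Sub.closedSetEquiv M).symm ⟨S, hclosed⟩, ?_⟩,
      inferInstance⟩).ne'
    have hL : ((Rep.Sub.closedSetEquiv M).symm ⟨S, hclosed⟩).vertSet = S :=
      congrArg Subtype.val ((Rep.Sub.closedSetEquiv M).apply_symm_apply ⟨S, hclosed⟩)
    have h1 := ((Rep.Sub.closedSetEquiv M).symm ⟨S, hclosed⟩).toRep_winding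
    have h2 := ((Rep.Sub.closedSetEquiv M).symm ⟨S, hclosed⟩).quot_winding
    rw [hL] at h1 h2
    exact ⟨Rep.iso_iff.2 (h1.trans (Winding.equivalent_toRep _).symm),
      Rep.iso_iff.2 (h2.trans (Winding.equivalent_toRep _).symm)⟩
  · rw [hlie R hR hRT, Hall.delta_mul_delta, Nat.cast_ne_zero, ← Nat.pos_iff_ne_zero] at hne
    obtain ⟨⟨L, hL1, hL2⟩⟩ := (Nat.card_pos_iff.1 hne).1
    refine Rep.iso_iff.2 (Winding.equivalent_of_cut hMcard (hcard R hR hRT) hs hs' he hf hcr heS hfS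
      L.isClosed_vertSet ?_ ?_)
    · exact L.toRep_winding.symm.trans ((Rep.iso_iff.1 hL1).trans (Winding.equivalent_toRep _))
    · exact L.quot_winding.symm.trans ((Rep.iso_iff.1 hL2).trans (Winding.equivalent_toRep _))

lemma lieSpan_treeClasses (hQ : Q.IsPseudotree) :
    LieSubalgebra.lieSpan ℂ (nilLie Q) (treeClasses Q) = ⊤ := by
  refine eq_top_iff.2 fun f _ => ?_
  exact mem_of_support (LieSubalgebra.lieSpan ℂ (nilLie Q) (treeClasses Q)).toSubmodule f
    fun M hM _ => nilClass_mem_lieSpan hQ hM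

end Generation

/-! ### The reversal of a tree -/

lemma Rep.isReversal_twist {V : Type u} {A : Type v} [Finite V] [Finite A] {Q : FinQuiver V A}
    (D : Set A) (T : Rep Q) :
    Rep.IsReversal D T (T.winding.twist (Twist.ofReverse Q D)).toRep := by
  classical
  let t := Twist.ofReverse Q D
  let N := (T.winding.twist t).toRep
  obtain ⟨e, hc, he⟩ := (Winding.equivalent_toRep (T.winding.twist t)).symm
  obtain ⟨e₁, he₁⟩ := Winding.Equivalent.exists_arrow_equiv e he
  obtain ⟨c, hcT⟩ := T.exists_arr_equiv
  obtain ⟨d, hdN⟩ := N.exists_arr_equiv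
  obtain ⟨w, hw⟩ := T.winding.exists_twist_arrow_equiv t
  have hD : ∀ b, c b ∈ T.winding.arrowColor ⁻¹' t.reversed ↔ b ∈ T.arrColor ⁻¹' D := fun b => by
    rw [Set.mem_preimage, Set.mem_preimage, (hcT b).1]
    rfl
  refine ⟨e, (c.trans w).trans (e₁.trans d.symm), hc, fun b => ?_, fun b => ⟨?_, ?_⟩⟩
  · have h := (hdN (d.symm (e₁ (w (c b))))).1
    rw [Equiv.apply_symm_apply] at h
    refine h.symm.trans ((he₁ _).1.trans ((hw _).1.trans ?_))
    exact (hcT b).1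
  · have h := (hdN (d.symm (e₁ (w (c b))))).2.1
    rw [Equiv.apply_symm_apply] at h
    refine h.symm.trans ((he₁ _).2.1.trans (congrArg e ((hw _).2.1.trans ?_)))
    simp only [FinQuiver.reverse, hD, (hcT b).2.1, (hcT b).2.2]
  · have h := (hdN (d.symm (e₁ (w (c b))))).2.2
    rw [Equiv.apply_symm_apply] at h
    refine h.symm.trans ((he₁ _).2.2.trans (congrArg e ((hw _).2.2.trans ?_)))
    simp only [FinQuiver.reverse, hD, (hcT b).2.1, (hcT b).2.2]

end F1

end

/-! ### The theorem. -/

open F1 in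
theorem theoremB {V : Type u} {A : Type v} [Finite V] [Finite A] (Q : FinQuiver V A)
    (hQ : Q.IsPseudotree) :
    LieSubalgebra.lieSpan ℂ (nilLie Q) (treeClasses Q) = ⊤ ∧
    ∃ 𝔭 : LieIdeal ℂ (nilLie Q), 𝔭.toSubmodule = pseudotreeSpan Q ∧
      (∀ (W : Type u) (B : Type v) [Finite W] [Finite B] (R : FinQuiver W B),
        Q.SameUnderlyingGraph R →
        ∃ 𝔯 : LieIdeal ℂ (nilLie R), 𝔯.toSubmodule = pseudotreeSpan R ∧
          Nonempty ((nilLie Q ⧸ 𝔭) ≃ₗ⁅ℂ⁆ (nilLie R ⧸ 𝔯))) ∧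
      (∀ D : Set A,
        ∃ 𝔯 : LieIdeal ℂ (nilLie (Q.reverse D)),
          𝔯.toSubmodule = pseudotreeSpan (Q.reverse D) ∧
          ∃ φ : (nilLie Q ⧸ 𝔭) ≃ₗ⁅ℂ⁆ (nilLie (Q.reverse D) ⧸ 𝔯),
            ∀ (T : Rep Q) (hT : T.IsTreeRep),
              ∃ (T' : Rep (Q.reverse D)) (hT' : T'.IsTreeRep), Rep.IsReversal D T T' ∧
                φ (LieSubmodule.Quotient.mk (nilClass T hT.1)) =
                  (-1 : ℂ) ^ Nat.card {b : T.Arr // T.arrColor b ∈ D} •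
                    LieSubmodule.Quotient.mk (nilClass T' hT'.1)) := by
  obtain ⟨s, hs, -⟩ := Q.exists_endpoint_injective ∅ (by
    have := hQ.2
    rw [← Module.finrank_eq_rank] at this
    simpa using (by exact_mod_cast this : Module.finrank ℤ Q.H1 ≤ 1))
  refine ⟨lieSpan_treeClasses hQ, pseudotreeIdeal hs, rfl, fun W B _ _ R hR => ?_, fun D => ?_⟩
  · obtain ⟨t⟩ := Twist.nonempty_of_sameUnderlyingGraph hR
    obtain ⟨s', hs'⟩ := t.exists_endpoint_injective hs
    obtain ⟨φ, -⟩ := exists_quotient_lieEquiv (t.lieHom hs') (t.lieHom_surjective hs') _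
      (t.ker_lieHom hs hs')
    exact ⟨pseudotreeIdeal hs', rfl, ⟨φ⟩⟩
  · let t := Twist.ofReverse Q D
    obtain ⟨s', hs'⟩ := t.exists_endpoint_injective hs
    obtain ⟨φ, hφ⟩ := exists_quotient_lieEquiv (t.lieHom hs') (t.lieHom_surjective hs') _
      (t.ker_lieHom hs hs')
    refine ⟨pseudotreeIdeal hs', rfl, φ, fun T hT => ?_⟩
    have hTw := Rep.isTreeRep_iff.1 hT
    refine ⟨(T.winding.twist t).toRep, (hTw.twist t).isTreeRep_toRep, Rep.isReversal_twist D T, ?_⟩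
    rw [hφ, t.lieHom_apply hs', T.card_arr_colored (· ∈ D)]
    have h1 : T.winding.treeSign t.reversed =
        (-1) ^ Nat.card {b : T.winding.Arrow // T.winding.arrowColor b ∈ D} := if_pos hTw
    rw [← h1]
    exact congrArg (LieSubmodule.Quotient.mk (N := pseudotreeIdeal hs'))
      (Subtype.ext (t.hallMap_delta hTw))
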